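/- **Setting.** Let $E\subset\mathbb{R}^n$ be open with closure $\overline E$ and boundary $\partial E$, and let $\phi:\mathbb{R}^n\times\mathbb{R}_+\to\mathbb{R}^n$ be a continuous flow: $\phi(x,0)=x$, $\phi(x,t+s)=\phi(\phi(x,t),s)$. Put $t_*(x)=\inf\{t>0:\phi(x,t)\in\partial E\}\in(0,\infty]$ for $x\in E$, and $\phi(x,t_*(x))=\Delta$ if $t_*(x)=\infty$, where $\Delta\in\overline E$ is a fixed point (in $\partial E$ if $\partial E\neq\emptyset$). Let $\mathbb{U}$ be a compact metric space; for $x\in\overline E$ let $\mathbb{U}(x)\subset\mathbb{U}$ be non-empty. Let $\lambda,f:\overline E\times\mathbb{U}\to[0,\infty)$ and $r:\partial E\times\mathbb{U}\to[0,\infty)$ be Borel, and $Q$ a stochastic kernel on $E$ given $\overline E\times\mathbb{U}$; write $Qg(x,a)=\int_E g(z)\,Q(x,a;dz)$. **Controls.** $\mathcal{V}^r$ is the set of Lebesgue measurable $\mu:\mathbb{R}_+\to\mathcal{P}(\mathbb{U})$ with the weak* topology $\sigma(L^\infty(\mathbb{R}_+;\mathcal{M}(\mathbb{U})),L^1(\mathbb{R}_+;\mathbb{C}(\mathbb{U})))$,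 and $\mathbb{V}^r=\mathcal{V}^r\times\mathcal{P}(\mathbb{U})$. For $x\in E$, $\mathbb{V}^r(x)$ is the set of $(\mu,\mu_\partial)\in\mathbb{V}^r$ with $\mu(t,\mathbb{U}(\phi(x,t)))=1$ for a.e. $t$ and $\mu_\partial(\mathbb{U}(\phi(x,t_*(x))))=1$; and $\mathbb{V}(x)$ is the set of pairs $(\nu,\nu_\partial)$ of a Borel function $\nu:\mathbb{R}_+\to\mathbb{U}$ with $\nu(t)\in\mathbb{U}(\phi(x,t))$ for all $t$ and a point $\nu_\partial\in\mathbb{U}(\phi(x,t_*(x)))$ (in both cases the constraint at time $t$ is required only if $\phi(x,t)\in\overline E$). Identifying actions with Dirac measures, $\mathbb{V}(x)\subset\mathbb{V}^r(x)$. $\mathcal{S}_{\mathbb{U}}$ is the set of Borel $u:\overline E\to\mathbb{U}$ with $u(x)\in\mathbb{U}(x)$ for all $x$, and $\mathcal{S}_{\mathbb{V}}$ the set of maps $\Gamma$ on $E$ that are measurable for the Borel $\sigma$-algebra inherited from $\mathbb{V}^r$ and satisfy $\Gamma(x)\in\mathbb{V}(x)$ for all $x\in E$. For $u\in\mathcal{S}_{\mathbb{U}}$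 put $u_\phi(x)=\bigl(u(\phi(x,\cdot)),u(\phi(x,t_*(x)))\bigr)$ (with $u$ extended to $\mathbb{R}^n$ as a Borel function). **Assumptions.** 1. Each $\mathbb{U}(x)$, $x\in\overline E$, is compact, and $\{(x,a):x\in\overline E,\ a\in\mathbb{U}(x)\}$ is Borel. 2. For $x\in E$ one has $\int_0^t\sup_{a\in\mathbb{U}(\phi(x,s))}\lambda(\phi(x,s),a)\,ds<\infty$ for all $t<t_*(x)$, and also for $t=t_*(x)$ if $t_*(x)<\infty$. 3. $\{(x,\Theta):x\in E,\ \Theta\in\mathbb{V}^r(x)\}\in\mathcal{B}(E)\otimes\mathcal{B}(\mathbb{V}^r)$. 4. $\lambda(x,\cdot)$ is continuous on $\mathbb{U}(x)$ for $x\in E$; $Qg(x,\cdot)$ is continuous on $\mathbb{U}(x)$ for $x\in\overline E$ and bounded Borel $g$ on $E$. 5. There are Borel $f_j\ge0$ on $\overline E\times\mathbb{U}$ and $r_j\ge0$ on $\partial E\times\mathbb{U}$ such that, on $\mathbb{U}(y)$, $f_j(y,\cdot)$ is continuous and $f_j(y,\cdot)\uparrow f(y,\cdot)$ for each $y\in\overline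 E$, and likewise $r_j(z,\cdot)\uparrow r(z,\cdot)$ for each $z\in\partial E$. 6. There are a Borel $\xi:E\to[0,\infty)$ and $K_\xi<\infty$ such that for all $x\in E$: $\lambda(x,a)\ge\xi(x)$ for $a\in\mathbb{U}(x)$; $\int_0^{t_*(x)}e^{-\int_0^t\xi(\phi(x,s))ds}\,dt\le K_\xi$; and $\int_0^{t_*(x)}e^{-\int_0^t\xi(\phi(x,s))ds}\sup_{a\in\mathbb{U}(\phi(x,t))}f(\phi(x,t),a)\,dt<\infty$. **Operators.** For $\alpha\ge0$, $\Theta=(\mu,\mu_\partial)\in\mathbb{V}^r$, let $\Lambda^\mu(x,t)=\int_0^t\int_{\mathbb{U}}\lambda(\phi(x,s),a)\,\mu(s,da)\,ds$ and, for $v\ge0$ and $g\ge0$, $$L_\alpha v(x,\Theta)=\int_0^{t_*(x)}e^{-\alpha s-\Lambda^\mu(x,s)}\int_{\mathbb{U}}v(\phi(x,s),a)\,\mu(s,da)\,ds,\qquad \mathcal{L}_\alpha=L_\alpha 1,$$ $$H_\alpha v(x,\Theta)=e^{-\alpha t_*(x)-\Lambda^\mu(x,t_*(x))}\int_{\mathbb{U}}v(\phi(x,t_*(x)),a)\,\mu_\partial(da),\qquad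 G_\alpha g=L_\alpha(\lambda\,Qg)+H_\alpha(Qg)$$ (with $e^{-\infty}=0$ and $0\cdot\infty=0$). For $h:E\to\mathbb{R}$ bounded below, $Qh=Qh^+-Qh^-$ and $G_\alpha h=G_\alpha h^+-G_\alpha h^-$. For $\rho\ge0$ set $J(x,\Theta)=-\rho\mathcal{L}_\alpha(x,\Theta)+L_\alpha f(x,\Theta)+H_\alpha r(x,\Theta)+G_\alpha h(x,\Theta)\in(-\infty,\infty]$ for $\Theta\in\mathbb{V}^r(x)$, and $$\mathcal{R}_\alpha(\rho,h)(x)=\inf_{\Theta\in\mathbb{V}^r(x)}J(x,\Theta),\qquad \mathcal{T}_\alpha(\rho,h)(x)=\inf_{\Upsilon\in\mathbb{V}(x)}J(x,\Upsilon).$$ **Theorem.** Let $\alpha\ge0$, $\rho\ge0$, let $h:E\to\mathbb{R}$ be Borel and bounded below, let $w(x)=\mathcal{R}_\alpha(\rho,h)(x)$ for $x\in E$, and suppose that $w(x)\in\mathbb{R}$ for all $x\in E$. Then: (a) $w$ is Borel; for each $x\in E$ the function $t\mapsto w(\phi(x,t))$ is absolutely continuous on $[0,T]$ for every $T<t_*(x)$;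 and if $t_*(x)<\infty$, then $\lim_{t\uparrow t_*(x)}w(\phi(x,t))$ exists in $\mathbb{R}$. (b) $\mathcal{R}_\alpha(\rho,h)(x)=\mathcal{T}_\alpha(\rho,h)(x)$ for all $x\in E$. (c) There is $\widehat u=\widehat u(w,h)\in\mathcal{S}_{\mathbb{U}}$ such that, for all $x\in E$, $a=\widehat u(x)$ attains $\inf_{a\in\mathbb{U}(x)}\{f(x,a)-\lambda(x,a)[w(x)-Qh(x,a)]\}$ and, for all $z\in\partial E$, $a=\widehat u(z)$ attains $\inf_{a\in\mathbb{U}(z)}\{r(z,a)+Qh(z,a)\}$. (d) For every such $\widehat u$, the feedback selector $\widehat u_\phi$ belongs to $\mathcal{S}_{\mathbb{V}}$ and attains both infima: for all $x\in E$, $$\mathcal{R}_\alpha(\rho,h)(x)=\mathcal{T}_\alpha(\rho,h)(x)=J(x,\widehat u_\phi(x)).$$ -/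

import Mathlib

open MeasureTheory ProbabilityTheory Set Filter Topology
open scoped NNReal ENNReal

noncomputable section

/-! Time is `ℝ≥0`, the state space is a subset of `ℝⁿ` with its Euclidean structure.
A function given on a Borel subset of `ℝⁿ` only is represented by a function on all of `ℝⁿ`, of
which only the values on that subset are ever used. -/

/-- Lebesgue measure on the time axis `[0, ∞)`. -/
def timeMeasure : Measure ℝ≥0 := (volume : Measure ℝ).comap ((↑) : ℝ≥0 → ℝ)

/-- `exp (-a)` for `a ∈ [0, ∞]`, with `exp (-∞) = 0`. -/
def expNeg (a : ℝ≥0∞) : ℝ≥0∞ := EReal.exp (-(a : EReal))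

/-- Borel measurability of a function on a subset `S`. -/
def BorelOn {α β : Type*} [MeasurableSpace α] [MeasurableSpace β] (S : Set α) (g : α → β) : Prop :=
  Measurable (fun x : S => g x)

theorem measurable_diracProba_map {α : Type*} [MeasurableSpace α] :
    Measurable (fun a : α => diracProba a) :=
  Measure.measurable_dirac.subtype_mk

/-! ### Relaxed and ordinary controls -/

section Controls

variable (𝕌 : Type*) [MetricSpace 𝕌] [CompactSpace 𝕌] [MeasurableSpace 𝕌] [BorelSpace 𝕌]

/-- Lebesgue measurable functions of time with values in the probability measures on `𝕌`.
(For compact metric `𝕌` the measurable space of `ProbabilityMeasure 𝕌` is the Borel one of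
the weak topology.) -/
def RelaxedPath : Type _ := {μ : ℝ≥0 → ProbabilityMeasure 𝕌 // AEMeasurable μ timeMeasure}

variable {𝕌} in
/-- The pairing of a relaxed path with an element `g` of `L¹(ℝ₊; C(𝕌))`. -/
def RelaxedPath.pairing (g : ℝ≥0 → C(𝕌, ℝ)) (μ : RelaxedPath 𝕌) : ℝ :=
  ∫ t, (∫ u, g t u ∂(μ.1 t : Measure 𝕌)) ∂timeMeasure

/-- The weak-star topology `σ(L^∞(ℝ₊; M(𝕌)), L¹(ℝ₊; C(𝕌)))`: the coarsest one for which the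
pairings with all `g ∈ L¹(ℝ₊; C(𝕌))` are continuous. -/
instance : TopologicalSpace (RelaxedPath 𝕌) :=
  ⨅ g : {g : ℝ≥0 → C(𝕌, ℝ) // Integrable g timeMeasure},
    TopologicalSpace.induced (RelaxedPath.pairing g.1) inferInstance

instance : MeasurableSpace (RelaxedPath 𝕌) := borel _

/-- Relaxed controls: a relaxed path together with a probability measure used at the boundary. -/
abbrev RelaxedControl : Type _ := RelaxedPath 𝕌 × ProbabilityMeasure 𝕌

/-- Ordinary controls: a Borel function of time together with an action used at the boundary. -/
structure OrdinaryControl where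
  path : ℝ≥0 → 𝕌
  measurable_path : Measurable path
  bdry : 𝕌

variable {𝕌}

/-- An action is identified with the Dirac measure at it, hence an ordinary control with a
relaxed one. -/
def OrdinaryControl.toRelaxed (Υ : OrdinaryControl 𝕌) : RelaxedControl 𝕌 :=
  (⟨fun t => diracProba (Υ.path t),
    (measurable_diracProba_map.comp Υ.measurable_path).aemeasurable⟩, diracProba Υ.bdry)

/-- The measurable structure inherited from the relaxed controls. -/
instance : MeasurableSpace (OrdinaryControl 𝕌) :=
  MeasurableSpace.comap OrdinaryControl.toRelaxed inferInstance

end Controls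

/-! ### Controlled piecewise deterministic Markov processes -/

/-- The data of the control problem. The kernel `Q` is a stochastic kernel on `E` given
`closure E × 𝕌`; the running cost `f` and the rate `lam` matter on `closure E × 𝕌`, the boundary
cost `r` on `frontier E × 𝕌`. The point `Δ` stands for the position at time `∞` of a trajectory
that never meets the boundary. -/
structure ControlledPDMP (n : ℕ) (𝕌 : Type*) [MeasurableSpace 𝕌] where
  E : Set (EuclideanSpace ℝ (Fin n))
  isOpen_E : IsOpen E
  φ : Flow ℝ≥0 (EuclideanSpace ℝ (Fin n))
  Δ : EuclideanSpace ℝ (Fin n)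
  Δ_mem : Δ ∈ closure E
  /-- feasible actions -/
  U : EuclideanSpace ℝ (Fin n) → Set 𝕌
  U_nonempty : ∀ x ∈ closure E, (U x).Nonempty
  /-- jump rate -/
  lam : EuclideanSpace ℝ (Fin n) × 𝕌 → ℝ≥0
  measurable_lam : Measurable lam
  /-- post-jump location kernel -/
  Q : Kernel (EuclideanSpace ℝ (Fin n) × 𝕌) (EuclideanSpace ℝ (Fin n))
  isMarkovKernel_Q : IsMarkovKernel Q
  Q_compl : ∀ x ∈ closure E, ∀ a, Q (x, a) Eᶜ = 0
  /-- running cost -/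
  f : EuclideanSpace ℝ (Fin n) × 𝕌 → ℝ≥0
  measurable_f : Measurable f
  /-- boundary cost -/
  r : EuclideanSpace ℝ (Fin n) × 𝕌 → ℝ≥0
  measurable_r : Measurable r

namespace ControlledPDMP

variable {n : ℕ} {𝕌 : Type*} [MetricSpace 𝕌] [CompactSpace 𝕌] [MeasurableSpace 𝕌] [BorelSpace 𝕌]
variable (M : ControlledPDMP n 𝕌)

/-- The time at which the flow from `x` reaches the boundary (`∞` if it never does). -/
def tstar (x : EuclideanSpace ℝ (Fin n)) : ℝ≥0∞ :=
  sInf ((fun t : ℝ≥0 => (t : ℝ≥0∞)) '' {t | 0 < t ∧ M.φ t x ∈ frontier M.E})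

/-- `φ(x, t_*(x))`, equal to `Δ` if `t_*(x) = ∞`. -/
def exitPoint (x : EuclideanSpace ℝ (Fin n)) : EuclideanSpace ℝ (Fin n) :=
  open Classical in if M.tstar x = ⊤ then M.Δ else M.φ (M.tstar x).toNNReal x

/-- Functions on `E` that are absolutely continuous along the flow (on each `[0, T]` with
`T < t_*(x)`), with a finite limit towards the boundary. -/
def Mac (g : EuclideanSpace ℝ (Fin n) → ℝ) : Prop :=
  BorelOn M.E g ∧
  (∀ x ∈ M.E, ∀ T : ℝ≥0, (T : ℝ≥0∞) < M.tstar x →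
    AbsolutelyContinuousOnInterval (fun t : ℝ => g (M.φ t.toNNReal x)) 0 T) ∧
  (∀ x ∈ M.E, M.tstar x < ⊤ →
    ∃ l : ℝ, Tendsto (fun t : ℝ≥0 => g (M.φ t x)) (𝓝[<] (M.tstar x).toNNReal) (𝓝 l))

/-! #### Feasible controls; the constraint at time `t` is imposed whenever `φ(x, t)` lies in
`closure E`, where the sets of feasible actions are given. -/

/-- `𝕍ʳ(x)` -/
def relaxedControls (x : EuclideanSpace ℝ (Fin n)) : Set (RelaxedControl 𝕌) :=
  {Θ | (∀ᵐ t ∂timeMeasure, M.φ t x ∈ closure M.E →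
          (Θ.1.1 t : Measure 𝕌) (M.U (M.φ t x)) = 1) ∧
        (Θ.2 : Measure 𝕌) (M.U (M.exitPoint x)) = 1}

/-- `𝕍(x)` -/
def ordinaryControls (x : EuclideanSpace ℝ (Fin n)) : Set (OrdinaryControl 𝕌) :=
  {Υ | (∀ t, M.φ t x ∈ closure M.E → Υ.path t ∈ M.U (M.φ t x)) ∧ Υ.bdry ∈ M.U (M.exitPoint x)}

/-- Measurable selectors `𝒮_𝕌` of the sets of feasible actions. -/
def actionSelectors : Set (EuclideanSpace ℝ (Fin n) → 𝕌) :=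
  {u | Measurable u ∧ ∀ x ∈ closure M.E, u x ∈ M.U x}

/-- Measurable selectors `𝒮_𝕍` of the sets of feasible ordinary controls. -/
def ordinarySelectors : Set (EuclideanSpace ℝ (Fin n) → OrdinaryControl 𝕌) :=
  {Γ | BorelOn M.E Γ ∧ ∀ x ∈ M.E, Γ x ∈ M.ordinaryControls x}

/-- The feedback control `u_φ(x) = (u(φ(x, ·)), u(φ(x, t_*(x))))`. -/
def feedback (u : EuclideanSpace ℝ (Fin n) → 𝕌) (hu : Measurable u)
    (x : EuclideanSpace ℝ (Fin n)) : OrdinaryControl 𝕌 where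
  path t := u (M.φ t x)
  measurable_path :=
    hu.comp (M.φ.cont'.comp (continuous_id.prodMk continuous_const)).measurable
  bdry := u (M.exitPoint x)

/-! #### Operators -/

/-- `∫ g(z) Q(x, a; dz)` for `g ≥ 0`. -/
def Qpos (g : EuclideanSpace ℝ (Fin n) → ℝ≥0∞) (x : EuclideanSpace ℝ (Fin n)) (a : 𝕌) : ℝ≥0∞ :=
  ∫⁻ z, g z ∂(M.Q (x, a))

/-- `Qh(x, a) = Qh⁺(x, a) - Qh⁻(x, a) ∈ (-∞, ∞]` for real `h` bounded below. -/
def Qop (h : EuclideanSpace ℝ (Fin n) → ℝ) (x : EuclideanSpace ℝ (Fin n)) (a : 𝕌) : EReal :=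
  (M.Qpos (fun z => ENNReal.ofReal (h z)) x a : EReal) -
    (M.Qpos (fun z => ENNReal.ofReal (-h z)) x a : EReal)

/-- `Λ^μ(x, t) = ∫₀ᵗ ∫ λ(φ(x, s), a) μ(s, da) ds`, also for `t = ∞`. -/
def Lam (μ : RelaxedPath 𝕌) (x : EuclideanSpace ℝ (Fin n)) (t : ℝ≥0∞) : ℝ≥0∞ :=
  ∫⁻ s in {s : ℝ≥0 | (s : ℝ≥0∞) < t},
    (∫⁻ a, (M.lam (M.φ s x, a) : ℝ≥0∞) ∂(μ.1 s : Measure 𝕌)) ∂timeMeasure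

/-- `e^{-α t - Λ^μ(x, t)}` -/
def discount (α : ℝ≥0) (μ : RelaxedPath 𝕌) (x : EuclideanSpace ℝ (Fin n)) (t : ℝ≥0∞) : ℝ≥0∞ :=
  expNeg (α * t + M.Lam μ x t)

/-- `L_α v(x, Θ)` for `v ≥ 0`. -/
def Lop (α : ℝ≥0) (v : EuclideanSpace ℝ (Fin n) → 𝕌 → ℝ≥0∞) (x : EuclideanSpace ℝ (Fin n))
    (Θ : RelaxedControl 𝕌) : ℝ≥0∞ :=
  ∫⁻ s in {s : ℝ≥0 | (s : ℝ≥0∞) < M.tstar x},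
    M.discount α Θ.1 x s * (∫⁻ a, v (M.φ s x) a ∂(Θ.1.1 s : Measure 𝕌)) ∂timeMeasure

/-- `H_α v(x, Θ)` for `v ≥ 0`. -/
def Hop (α : ℝ≥0) (v : EuclideanSpace ℝ (Fin n) → 𝕌 → ℝ≥0∞) (x : EuclideanSpace ℝ (Fin n))
    (Θ : RelaxedControl 𝕌) : ℝ≥0∞ :=
  M.discount α Θ.1 x (M.tstar x) * ∫⁻ a, v (M.exitPoint x) a ∂(Θ.2 : Measure 𝕌)

/-- `𝓛_α(x, Θ)` -/
def calL (α : ℝ≥0) (x : EuclideanSpace ℝ (Fin n)) (Θ : RelaxedControl 𝕌) : ℝ≥0∞ :=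
  M.Lop α (fun _ _ => 1) x Θ

/-- The integral `G_α g(x, Θ)` of `g ≥ 0` against the kernel `G_α(x, Θ; dy)`; the value
`G_α(x, Θ; A)` is the case in which `g` is the indicator function of `A`. -/
def Gpos (α : ℝ≥0) (g : EuclideanSpace ℝ (Fin n) → ℝ≥0∞) (x : EuclideanSpace ℝ (Fin n))
    (Θ : RelaxedControl 𝕌) : ℝ≥0∞ :=
  M.Lop α (fun y a => M.lam (y, a) * M.Qpos g y a) x Θ + M.Hop α (M.Qpos g) x Θ

/-- `G_α h = G_α h⁺ - G_α h⁻` for real `h` bounded below. -/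
def Gop (α : ℝ≥0) (h : EuclideanSpace ℝ (Fin n) → ℝ) (x : EuclideanSpace ℝ (Fin n))
    (Θ : RelaxedControl 𝕌) : EReal :=
  (M.Gpos α (fun z => ENNReal.ofReal (h z)) x Θ : EReal) -
    (M.Gpos α (fun z => ENNReal.ofReal (-h z)) x Θ : EReal)

/-- The one-stage cost `-ρ 𝓛_α + L_α f + H_α r + G_α h` of a relaxed control. -/
def cost (α ρ : ℝ≥0) (h : EuclideanSpace ℝ (Fin n) → ℝ) (x : EuclideanSpace ℝ (Fin n))
    (Θ : RelaxedControl 𝕌) : EReal :=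
  -(((ρ : ℝ≥0∞) * M.calL α x Θ : ℝ≥0∞) : EReal)
    + (M.Lop α (fun y a => (M.f (y, a) : ℝ≥0∞)) x Θ : EReal)
    + (M.Hop α (fun y a => (M.r (y, a) : ℝ≥0∞)) x Θ : EReal)
    + M.Gop α h x Θ

/-- The relaxed one-stage optimization operator `ℛ_α(ρ, h)`. -/
def relaxedOp (α ρ : ℝ≥0) (h : EuclideanSpace ℝ (Fin n) → ℝ) (x : EuclideanSpace ℝ (Fin n)) :
    EReal :=
  ⨅ Θ ∈ M.relaxedControls x, M.cost α ρ h x Θ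

/-- The ordinary one-stage optimization operator `𝒯_α(ρ, h)`. -/
def ordinaryOp (α ρ : ℝ≥0) (h : EuclideanSpace ℝ (Fin n) → ℝ) (x : EuclideanSpace ℝ (Fin n)) :
    EReal :=
  ⨅ Υ ∈ M.ordinaryControls x, M.cost α ρ h x Υ.toRelaxed

/-- `f(x, a) - λ(x, a) [w(x) - Qh(x, a)]` -/
def hamiltonian (w h : EuclideanSpace ℝ (Fin n) → ℝ) (x : EuclideanSpace ℝ (Fin n)) (a : 𝕌) :
    EReal :=
  ((M.f (x, a) : ℝ) : EReal) - ((M.lam (x, a) : ℝ) : EReal) * ((w x : EReal) - M.Qop h x a)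

/-- `r(z, a) + Qh(z, a)` -/
def boundaryHamiltonian (h : EuclideanSpace ℝ (Fin n) → ℝ) (z : EuclideanSpace ℝ (Fin n))
    (a : 𝕌) : EReal :=
  ((M.r (z, a) : ℝ) : EReal) + M.Qop h z a

/-- `u` is a measurable selector `û(w, h)`: it minimizes the Hamiltonian at each point of `E`, and
the boundary Hamiltonian at each boundary point. -/
structure IsMinimizingSelector (w h : EuclideanSpace ℝ (Fin n) → ℝ)
    (u : EuclideanSpace ℝ (Fin n) → 𝕌) : Prop where
  mem : u ∈ M.actionSelectors
  interior_min : ∀ x ∈ M.E, ⨅ a ∈ M.U x, M.hamiltonian w h x a = M.hamiltonian w h x (u x)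
  boundary_min : ∀ z ∈ frontier M.E,
    ⨅ a ∈ M.U z, M.boundaryHamiltonian h z a = M.boundaryHamiltonian h z (u z)

/-- The standing assumptions on the data. -/
structure Assumptions : Prop where
  isCompact_U : ∀ x ∈ closure M.E, IsCompact (M.U x)
  measurableSet_graph :
    MeasurableSet {p : EuclideanSpace ℝ (Fin n) × 𝕌 | p.1 ∈ closure M.E ∧ p.2 ∈ M.U p.1}
  rate_integrable : ∀ x ∈ M.E, ∀ t : ℝ≥0, (t : ℝ≥0∞) < M.tstar x →
    ∫⁻ s in {s : ℝ≥0 | s < t}, (⨆ a ∈ M.U (M.φ s x), (M.lam (M.φ s x, a) : ℝ≥0∞)) ∂timeMeasure < ⊤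
  rate_integrable_exit : ∀ x ∈ M.E, M.tstar x < ⊤ →
    ∫⁻ s in {s : ℝ≥0 | (s : ℝ≥0∞) < M.tstar x},
      (⨆ a ∈ M.U (M.φ s x), (M.lam (M.φ s x, a) : ℝ≥0∞)) ∂timeMeasure < ⊤
  measurableSet_relaxed :
    MeasurableSet {p : EuclideanSpace ℝ (Fin n) × RelaxedControl 𝕌 |
      p.1 ∈ M.E ∧ p.2 ∈ M.relaxedControls p.1}
  continuousOn_lam : ∀ x ∈ M.E, ContinuousOn (fun a => M.lam (x, a)) (M.U x)
  approx_f : ∃ F : ℕ → EuclideanSpace ℝ (Fin n) × 𝕌 → ℝ≥0, (∀ j, Measurable (F j)) ∧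
    ∀ y ∈ closure M.E,
      (∀ j, ContinuousOn (fun a => F j (y, a)) (M.U y)) ∧
      ∀ a ∈ M.U y, Monotone (fun j => F j (y, a)) ∧
        Tendsto (fun j => F j (y, a)) atTop (𝓝 (M.f (y, a)))
  approx_r : ∃ F : ℕ → EuclideanSpace ℝ (Fin n) × 𝕌 → ℝ≥0, (∀ j, Measurable (F j)) ∧
    ∀ z ∈ frontier M.E,
      (∀ j, ContinuousOn (fun a => F j (z, a)) (M.U z)) ∧
      ∀ a ∈ M.U z, Monotone (fun j => F j (z, a)) ∧
        Tendsto (fun j => F j (z, a)) atTop (𝓝 (M.r (z, a)))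
  continuousOn_Q : ∀ x ∈ closure M.E, ∀ g : EuclideanSpace ℝ (Fin n) → ℝ, Measurable g →
    (∃ C : ℝ, ∀ z, |g z| ≤ C) → ContinuousOn (fun a => ∫ z, g z ∂(M.Q (x, a))) (M.U x)
  lower_rate : ∃ ξ : EuclideanSpace ℝ (Fin n) → ℝ≥0, Measurable ξ ∧
    (∀ y ∈ M.E, ∀ a ∈ M.U y, ξ y ≤ M.lam (y, a)) ∧
    (∃ K : ℝ≥0, ∀ x ∈ M.E,
      ∫⁻ t in {t : ℝ≥0 | (t : ℝ≥0∞) < M.tstar x},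
        expNeg (∫⁻ s in {s : ℝ≥0 | s < t}, (ξ (M.φ s x) : ℝ≥0∞) ∂timeMeasure) ∂timeMeasure ≤ K) ∧
    (∀ x ∈ M.E,
      ∫⁻ t in {t : ℝ≥0 | (t : ℝ≥0∞) < M.tstar x},
        expNeg (∫⁻ s in {s : ℝ≥0 | s < t}, (ξ (M.φ s x) : ℝ≥0∞) ∂timeMeasure) *
          (⨆ a ∈ M.U (M.φ t x), (M.f (M.φ t x, a) : ℝ≥0∞)) ∂timeMeasure < ⊤)

end ControlledPDMP

end

/-!
The theorem is proved by uniformization and value iteration, without any compactness of the set of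
relaxed controls.

Let `h ≥ -C` on `E`, let `ξ` be the lower bound of the jump rates, and let `k(x)` be the integral up
to `t_*(x)` of the exponential of minus the integral of `ξ` along the flow (`expectedSojourn`),
which is bounded on `E`. If `1 + (α + λ - ξ) k` is charged as a running cost, every feasible control
costs `k(x)` (`stageCost_expectedSojourn`), and a unit charged at the first jump or discounting event
costs `1` (`stageCost_rate_one`). Adding `ρ` times the first charge and `C` times the second, the
one-stage cost becomes `J(x, Θ) + C + ρ k(x)`, and it is the cost of `Θ` for a running cost `c ≥ 0` (`shiftedCost`) and a
boundary cost `ψ ≥ 0` (`shiftedBdry`): see `coe_stageCost_shifted`. Everything then takes place in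
`[0, ∞]`.

Let `Λ(y)` be the maximal jump rate at `y` (`rateSup`). Discounting at a higher rate and paying the
value itself for the additional events does not change a value along a path
(`pathValue_rate_add`). Hence all controls may be given the total rate `α + Λ`, and `c` is replaced
by `c + (Λ - λ) v` (`uniformizedCost`), where `v` is the value. As the discount no longer depends on
the control, minimizing over controls amounts to minimizing over actions at each point of the
trajectory: this is the operator `bellman`. Let `v` be the limit of its iterates from zero (`value`).

* By induction, `v` is a lower bound for the cost of every relaxed control (`value_le_stageCost`).
* Since minimization over compact sets of actions commutes with increasing limits of lower
  semicontinuous functions, `v` is a fixed point of `bellman` (`bellman_value`); it therefore solves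
  a linear differential equation along the flow, which gives its regularity.
* If a feedback control minimizes the uniformized costs for `v`, then returning to the rate of that
  control (`pathValue_eq_of_reward_eq`) shows that it costs at most `v` (`stageCost_feedback_le`).

So `v = w + C + ρ k`, and in terms of `w` the uniformized cost is the Hamiltonian plus a term that
does not depend on the action (`coe_uniformizedCost_shifted`).

What remains is measurability. Minima over the compact sections of a Borel set are Borel functions,
and are attained by Borel selections (`measurable_biInf_section`, `exists_measurable_argmin`); this
rests on Novikov's separation theorem. Feedback selectors are measurable since countably many
pairings determine the weak-star topology (`OrdinaryControl.measurable_of_uncurry`).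
-/

set_option linter.unusedSectionVars false

noncomputable section

/-! ### Borel sets with compact sections -/

/-- A sequence of sets is jointly Borel separable if it can be enlarged to a sequence of measurable
sets with empty intersection. -/
def JointlySeparable {α : Type*} [MeasurableSpace α] (A : ℕ → Set α) : Prop :=
  ∃ B : ℕ → Set α, (∀ n, A n ⊆ B n) ∧ (∀ n, MeasurableSet (B n)) ∧ ⋂ n, B n = ∅

/-- If one of the sets is a countable union, it suffices to separate its pieces from the others. -/
theorem JointlySeparable.of_update_iUnion {α : Type*} [MeasurableSpace α] {A : ℕ → Set α} {k : ℕ}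
    {S : ℕ → Set α} (hA : A k = ⋃ i, S i) (h : ∀ i, JointlySeparable (Function.update A k (S i))) :
    JointlySeparable A := by
  choose B hB hBm hBe using h
  refine ⟨fun n => if n = k then ⋃ i, B i k else ⋂ i, B i n, fun n => ?_, fun n => ?_, ?_⟩
  · by_cases hn : n = k
    · subst hn
      simp only [if_true, hA]
      refine iUnion_mono fun i => ?_
      simpa using hB i n
    · simp only [if_neg hn]
      refine subset_iInter fun i => ?_
      simpa [Function.update_of_ne hn] using hB i n
  · dsimp only
    split_ifs
    · exact .iUnion fun i => hBm i k
    · exact .iInter fun i => hBm i n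
  · refine eq_empty_of_forall_notMem fun x hx => ?_
    rw [mem_iInter] at hx
    have hk := hx k
    simp only [if_true, mem_iUnion] at hk
    obtain ⟨i, hi⟩ := hk
    have : x ∈ ⋂ n, B i n := by
      rw [mem_iInter]
      intro n
      by_cases hn : n = k
      · rwa [hn]
      · have := hx n
        simp only [if_neg hn, mem_iInter] at this
        exact this i
    rw [hBe i] at this
    exact this

open PiNat in
/-- Novikov's separation theorem for continuous images of the Baire space. If separation failed, one
could shrink the images one after the other to images of longer and longer cylinders without ever
being able to separate; the limit points have two distinct images, which open sets separate. -/
theorem jointlySeparable_range {α : Type*} [TopologicalSpace α] [T2Space α] [MeasurableSpace α]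
    [OpensMeasurableSpace α] {f : ℕ → (ℕ → ℕ) → α} (hf : ∀ n, Continuous (f n))
    (h : ⋂ n, range (f n) = ∅) : JointlySeparable fun n => range (f n) := by
  by_contra hsep
  -- at step `p` the cylinder of index `(Nat.unpair p).1` is refined, so each is refined infinitely
  -- often; `len p n` is the length reached by the `n`-th cylinder
  let k : ℕ → ℕ := fun p => (Nat.unpair p).1
  let len : ℕ → ℕ → ℕ := fun p => Nat.rec (fun _ => 0)
    (fun q l => Function.update l (k q) (l (k q) + 1)) p
  have len_succ : ∀ p, len (p + 1) = Function.update (len p) (k p) (len p (k p) + 1) :=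
    fun p => rfl
  have step : ∀ p (Y : ℕ → ℕ → ℕ), ¬ JointlySeparable (fun n => f n '' cylinder (Y n) (len p n)) →
      ∃ Y' : ℕ → ℕ → ℕ, (∀ n, Y' n ∈ cylinder (Y n) (len p n)) ∧
        ¬ JointlySeparable (fun n => f n '' cylinder (Y' n) (len (p + 1) n)) := by
    intro p Y
    contrapose!
    intro H
    refine JointlySeparable.of_update_iUnion (k := k p)
      (S := fun i => f (k p) '' cylinder (Function.update (Y (k p)) (len p (k p)) i)
        (len p (k p) + 1)) ?_ fun i => ?_
    · rw [← image_iUnion]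
      exact congrArg _ (iUnion_cylinder_update (E := fun _ => ℕ) _ _).symm
    · convert H (Function.update Y (k p) (Function.update (Y (k p)) (len p (k p)) i)) ?_ using 2
      · rename_i n
        by_cases hn : n = k p
        · subst hn
          simp [len_succ]
        · simp [len_succ, hn]
      · intro n
        by_cases hn : n = k p
        · subst hn
          rw [Function.update_self]
          exact update_mem_cylinder (E := fun _ => ℕ) _ _ _
        · simp [hn]
  choose F hFmem hF using step
  let Z : ∀ p, {Y : ℕ → ℕ → ℕ // ¬ JointlySeparable (fun n => f n '' cylinder (Y n) (len p n))} :=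
    fun p => Nat.rec ⟨fun _ _ => 0, by simpa [len, cylinder_zero] using hsep⟩
      (fun p Y => ⟨F p Y.1 Y.2, hF p Y.1 Y.2⟩) p
  have Z_succ : ∀ p n, ∀ i < len p n, (Z (p + 1)).1 n i = (Z p).1 n i := fun p n =>
    mem_cylinder_iff.1 (hFmem p (Z p).1 (Z p).2 n)
  have len_mono : ∀ n, Monotone fun p => len p n := fun n => monotone_nat_of_le_succ fun p => by
    rw [len_succ]
    by_cases hn : n = k p
    · subst hn; simp
    · simp [hn]
  have Z_mono : ∀ n p q, p ≤ q → ∀ i < len p n, (Z q).1 n i = (Z p).1 n i := by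
    intro n p q hpq i hi
    induction q, hpq using Nat.le_induction with
    | base => rfl
    | succ q hq ih => rw [Z_succ q n i (hi.trans_le (len_mono n hq)), ih]
  have len_unbdd : ∀ n m, ∃ p, m ≤ len p n := by
    intro n m
    induction m with
    | zero => exact ⟨0, Nat.zero_le _⟩
    | succ m ih =>
      obtain ⟨p, hp⟩ := ih
      refine ⟨Nat.pair n p + 1, ?_⟩
      have h1 : k (Nat.pair n p) = n := by simp [k]
      rw [len_succ, h1, Function.update_self]
      have := len_mono n (Nat.right_le_pair n p)
      dsimp only at this
      lia
  choose P hP using len_unbdd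
  let y : ℕ → ℕ → ℕ := fun n i => (Z (P n (i + 1))).1 n i
  have hy : ∀ p n, ∀ i < len p n, y n i = (Z p).1 n i := by
    intro p n i hi
    rcases le_total p (P n (i + 1)) with hle | hle
    · exact Z_mono n p _ hle i hi
    · exact (Z_mono n _ p hle i (hP n (i + 1))).symm
  have hcyl : ∀ p n, cylinder (y n) (len p n) = cylinder ((Z p).1 n) (len p n) := fun p n =>
    mem_cylinder_iff_eq.1 (mem_cylinder_iff.2 (hy p n))
  -- otherwise the common value would lie in all the images
  obtain ⟨i, j, hij⟩ : ∃ i j, f i (y i) ≠ f j (y j) := by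
    by_contra! hall
    have : f 0 (y 0) ∈ ⋂ n, range (f n) := mem_iInter.2 fun n => ⟨y n, hall n 0⟩
    rw [h] at this
    exact this
  have hne : i ≠ j := fun h => hij (by rw [h])
  obtain ⟨u, v, hu, hv, hxu, hyv, huv⟩ := t2_separation hij
  have hcont : ∀ n (w : Set α), IsOpen w → f n (y n) ∈ w →
      ∃ m, ∀ l, m ≤ l → f n '' cylinder (y n) l ⊆ w := by
    intro n w hw hyw
    let := PiNat.metricSpaceNatNat
    obtain ⟨ε, hε, hsub⟩ := Metric.mem_nhds_iff.1 ((hf n).continuousAt.preimage_mem_nhds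
      (hw.mem_nhds hyw))
    obtain ⟨m, hm⟩ := exists_pow_lt_of_lt_one hε (show (1 / 2 : ℝ) < 1 by norm_num)
    refine ⟨m, fun l hl => ?_⟩
    rw [image_subset_iff]
    refine Subset.trans (fun z hz => ?_) hsub
    rw [Metric.mem_ball]
    exact (mem_cylinder_iff_dist_le.1 (cylinder_anti _ hl hz)).trans_lt hm
  obtain ⟨m₁, h₁⟩ := hcont i u hu hxu
  obtain ⟨m₂, h₂⟩ := hcont j v hv hyv
  let p := max (P i m₁) (P j m₂)
  refine (Z p).2 ⟨Function.update (Function.update (fun _ => univ) i u) j v, fun n => ?_,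
    fun n => ?_, ?_⟩
  · change f n '' cylinder ((Z p).1 n) (len p n) ⊆ _
    rw [← hcyl]
    by_cases hj : n = j
    · subst hj
      rw [Function.update_self]
      exact h₂ _ ((hP n m₂).trans (len_mono n (le_max_right _ _)))
    · rw [Function.update_of_ne hj]
      by_cases hi : n = i
      · subst hi
        rw [Function.update_self]
        exact h₁ _ ((hP n m₁).trans (len_mono n (le_max_left _ _)))
      · simp [Function.update_of_ne hi]
  · by_cases hj : n = j
    · subst hj
      simpa using hv.measurableSet
    · rw [Function.update_of_ne hj]
      by_cases hi : n = i
      · subst hi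
        simpa using hu.measurableSet
      · simp [Function.update_of_ne hi]
  · refine eq_empty_of_forall_notMem fun x hx => ?_
    rw [mem_iInter] at hx
    have hxj := hx j
    have hxi := hx i
    rw [Function.update_self] at hxj
    rw [Function.update_of_ne hne, Function.update_self] at hxi
    exact huv.le_bot ⟨hxi, hxj⟩

/-- **Novikov's separation theorem**: countably many analytic sets with empty intersection are
contained in Borel sets with empty intersection. -/
theorem jointlySeparable_of_analyticSet {α : Type*} [TopologicalSpace α] [T2Space α]
    [MeasurableSpace α] [OpensMeasurableSpace α] {A : ℕ → Set α} (hA : ∀ n, AnalyticSet (A n))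
    (h : ⋂ n, A n = ∅) : JointlySeparable A := by
  by_cases hne : ∃ n, A n = ∅
  · obtain ⟨n, hn⟩ := hne
    refine ⟨Function.update (fun _ => univ) n ∅, fun m => ?_, fun m => ?_, ?_⟩
    · by_cases hm : m = n
      · subst hm; simp [hn]
      · simp [hm]
    · by_cases hm : m = n
      · subst hm; simp
      · simp [hm]
    · exact eq_empty_of_forall_notMem fun x hx => by simpa using mem_iInter.1 hx n
  · push Not at hne
    have : ∀ n, ∃ f : (ℕ → ℕ) → α, Continuous f ∧ range f = A n := fun n => by
      have := hA n
      rw [AnalyticSet] at this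
      exact this.resolve_left (hne n).ne_empty
    choose f hf hr using this
    have := jointlySeparable_range hf (by simpa only [hr] using h)
    simpa only [hr] using this

section Argmin

variable {X Y : Type*} [TopologicalSpace Y] [CompactSpace Y]

theorem isClosed_sections_inter_le [T2Space Y] {G : Set (X × Y)} (hc : ∀ x, IsClosed {y | (x, y) ∈ G})
    {g : X × Y → ℝ≥0∞} (hl : ∀ x, LowerSemicontinuousOn (fun y => g (x, y)) {y | (x, y) ∈ G})
    (c : X → ℝ≥0∞) (x : X) : IsClosed {y | (x, y) ∈ {p | p ∈ G ∧ g p ≤ c p.1}} :=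
  ((hl x).isCompact_inter_preimage_Iic (hc x).isCompact (c x)).isClosed

theorem exists_eq_biInf_section {G : Set (X × Y)} (hc : ∀ x, IsClosed {y | (x, y) ∈ G})
    {g : X × Y → ℝ≥0∞} (hl : ∀ x, LowerSemicontinuousOn (fun y => g (x, y)) {y | (x, y) ∈ G})
    {x : X} (hx : ∃ y, (x, y) ∈ G) :
    ∃ y, (x, y) ∈ G ∧ g (x, y) = ⨅ y ∈ {y | (x, y) ∈ G}, g (x, y) := by
  obtain ⟨y, hy, hmin⟩ := (hl x).exists_isMinOn hx (hc x).isCompact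
  exact ⟨y, hy, le_antisymm (le_iInf₂ fun z hz => hmin hz) (iInf₂_le y hy)⟩

/-- The points of `G` at which `g` is minimal over the section. -/
def argminSection (G : Set (X × Y)) (g : X × Y → ℝ≥0∞) : Set (X × Y) :=
  {p | p ∈ G ∧ g p ≤ ⨅ y ∈ {y | (p.1, y) ∈ G}, g (p.1, y)}

theorem isClosed_argminSection [T2Space Y] {G : Set (X × Y)}
    (hc : ∀ x, IsClosed {y | (x, y) ∈ G}) {g : X × Y → ℝ≥0∞}
    (hl : ∀ x, LowerSemicontinuousOn (fun y => g (x, y)) {y | (x, y) ∈ G}) (x : X) :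
    IsClosed {y | (x, y) ∈ argminSection G g} :=
  isClosed_sections_inter_le hc hl
    (fun x => ⨅ y ∈ {y | (x, y) ∈ G}, g (x, y)) x

theorem exists_mem_argminSection {G : Set (X × Y)}
    (hc : ∀ x, IsClosed {y | (x, y) ∈ G}) {g : X × Y → ℝ≥0∞}
    (hl : ∀ x, LowerSemicontinuousOn (fun y => g (x, y)) {y | (x, y) ∈ G})
    {x : X} (hx : ∃ y, (x, y) ∈ G) : ∃ y, (x, y) ∈ argminSection G g := by
  obtain ⟨y, hy, hmin⟩ := exists_eq_biInf_section hc hl hx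
  exact ⟨y, hy, hmin.le⟩

end Argmin

section CompactSections

variable {X Y : Type*} [TopologicalSpace X] [PolishSpace X] [MeasurableSpace X] [BorelSpace X]
  [TopologicalSpace Y] [PolishSpace Y] [MeasurableSpace Y] [BorelSpace Y]

/-- The **Kunugui–Novikov theorem**: a Borel set with open sections is a countable union of Borel
rectangles whose second factors are open. -/
theorem exists_iUnion_prod_of_isOpen_sections {A : Set (X × Y)} (hA : MeasurableSet A)
    (ho : ∀ x, IsOpen {y | (x, y) ∈ A}) :
    ∃ (B : ℕ → Set X) (V : ℕ → Set Y), (∀ n, MeasurableSet (B n)) ∧ (∀ n, IsOpen (V n)) ∧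
      A = ⋃ n, B n ×ˢ V n := by
  obtain ⟨V, hV⟩ := ((TopologicalSpace.countable_countableBasis Y).insert ∅).exists_eq_range
    (insert_nonempty _ _)
  have hVo : ∀ n, IsOpen (V n) := fun n => by
    have : V n ∈ insert ∅ (TopologicalSpace.countableBasis Y) := hV ▸ mem_range_self n
    rcases this with h | h
    · rw [h]; exact isOpen_empty
    · exact (TopologicalSpace.isBasis_countableBasis Y).isOpen h
  -- the (coanalytic) set of points at which the section contains `V n`
  let P : ℕ → Set X := fun n => {x | ∀ y ∈ V n, (x, y) ∈ A}
  have hPc : ∀ n, AnalyticSet (P n)ᶜ := fun n => by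
    have : (P n)ᶜ = Prod.fst '' (Aᶜ ∩ Prod.snd ⁻¹' V n) := by
      ext x
      simp only [P, mem_compl_iff, mem_ofPred_eq, not_forall, mem_image, mem_inter_iff, mem_preimage,
        Prod.exists, exists_and_right, exists_eq_right]
      exact exists_congr fun y => by tauto
    rw [this]
    exact (hA.compl.inter (measurable_snd (hVo n).measurableSet)).analyticSet_image measurable_fst
  -- the rectangles `P n ×ˢ V n` fill `A`, but need not be Borel; their relative complements are
  -- analytic, and separating these jointly provides the Borel rectangles
  let N : ℕ → Set (X × Y) := fun n => A \ P n ×ˢ V n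
  have hN : ∀ n, AnalyticSet (N n) := fun n => by
    have : N n = (fun q : (X × Y) × Y => q.1) '' {q | q.1 ∈ A ∧
        ((q.2 ∈ V n ∧ (q.1.1, q.2) ∉ A) ∨ q.1.2 ∉ V n)} := by
      ext ⟨x, y⟩
      simp only [N, P, Set.mem_sdiff, mem_prod, mem_ofPred_eq, mem_image, Prod.exists]
      constructor
      · rintro ⟨h1, h2⟩
        by_cases hy : y ∈ V n
        · have : ∃ y' ∈ V n, (x, y') ∉ A := by
            by_contra! hcon
            exact h2 ⟨hcon, hy⟩
          obtain ⟨y', hy', hxy'⟩ := this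
          exact ⟨x, y, y', ⟨h1, Or.inl ⟨hy', hxy'⟩⟩, rfl⟩
        · exact ⟨x, y, y, ⟨h1, Or.inr hy⟩, rfl⟩
      · rintro ⟨x', y', z, ⟨h1, h2⟩, h3⟩
        cases h3
        refine ⟨h1, fun h => ?_⟩
        rcases h2 with ⟨h2, h4⟩ | h2
        · exact h4 (h.1 z h2)
        · exact h2 h.2
    rw [this]
    have hVm : MeasurableSet (V n) := (hVo n).measurableSet
    refine MeasurableSet.analyticSet_image ?_ measurable_fst
    refine (measurable_fst hA).inter (((measurable_snd hVm).inter ?_).union ?_)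
    · exact (hA.preimage (measurable_fst.fst.prodMk measurable_snd)).compl
    · exact (hVm.preimage measurable_fst.snd).compl
  have hNe : ⋂ n, N n = ∅ := by
    refine eq_empty_of_forall_notMem fun ⟨x, y⟩ hx => ?_
    rw [mem_iInter] at hx
    obtain ⟨W, hW, hyW, hWA⟩ := (TopologicalSpace.isBasis_countableBasis Y).exists_subset_of_mem_open
      (show y ∈ {y | (x, y) ∈ A} from (hx 0).1) (ho x)
    obtain ⟨n, rfl⟩ : W ∈ range V := hV ▸ mem_insert_of_mem _ hW
    exact (hx n).2 ⟨fun z hz => hWA hz, hyW⟩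
  obtain ⟨C, hNC, hCm, hCe⟩ := jointlySeparable_of_analyticSet hN hNe
  have hsep : ∀ n, MeasurablySeparable (Prod.fst '' (A \ C n)) (P n)ᶜ := fun n => by
    refine ((hA.diff (hCm n)).analyticSet_image measurable_fst).measurablySeparable (hPc n) ?_
    rw [disjoint_left]
    rintro _ ⟨⟨x, y⟩, ⟨hxA, hxC⟩, rfl⟩ hxP
    exact hxC (hNC n ⟨hxA, fun h => hxP h.1⟩)
  choose B hSB hBP hBm using hsep
  refine ⟨B, V, hBm, hVo, Subset.antisymm ?_ ?_⟩
  · rintro ⟨x, y⟩ hxy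
    have : ∃ n, (x, y) ∉ C n := by
      by_contra! hcon
      have := mem_iInter.2 hcon
      rw [hCe] at this
      exact this
    obtain ⟨n, hn⟩ := this
    refine mem_iUnion.2 ⟨n, hSB n ⟨_, ⟨hxy, hn⟩, rfl⟩, ?_⟩
    by_contra hy
    exact hn (hNC n ⟨hxy, fun h => hy h.2⟩)
  · refine iUnion_subset fun n => ?_
    rintro ⟨x, y⟩ ⟨hx, hy⟩
    have : x ∈ P n := by
      by_contra hcon
      exact (hBP n).le_bot ⟨hcon, hx⟩
    exact this y hy

variable [CompactSpace Y]

/-- The projection of a Borel set with compact sections is Borel: by compactness, the section of the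
complement is the whole space iff finitely many of its Kunugui–Novikov rectangles cover. -/
theorem measurableSet_image_fst_of_isClosed_sections {G : Set (X × Y)} (hG : MeasurableSet G)
    (hc : ∀ x, IsClosed {y | (x, y) ∈ G}) : MeasurableSet (Prod.fst '' G) := by
  obtain ⟨B, V, hB, hV, hGc⟩ := exists_iUnion_prod_of_isOpen_sections hG.compl
    fun x => (hc x).isOpen_compl
  rw [← MeasurableSet.compl_iff]
  have : (Prod.fst '' G)ᶜ = ⋃ (t : Finset ℕ) (_ : ⋃ n ∈ t, V n = univ), ⋂ n ∈ t, B n := by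
    ext x
    simp only [mem_compl_iff, mem_iUnion, exists_prop]
    constructor
    · intro hx
      have hcov : (univ : Set Y) ⊆ ⋃ n, {y | x ∈ B n ∧ y ∈ V n} := by
        intro y _
        have : (x, y) ∈ Gᶜ := fun h => hx ⟨_, h, rfl⟩
        rw [hGc] at this
        simpa using this
      obtain ⟨t, ht⟩ := isCompact_univ.elim_finite_subcover _
        (fun n => isOpen_const.inter (hV n)) hcov
      classical
      refine ⟨t.filter fun n => x ∈ B n, eq_univ_of_univ_subset fun y hy => ?_, ?_⟩
      · have := ht hy
        simp only [mem_iUnion, exists_prop] at this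
        obtain ⟨n, hn, h1, h2⟩ := this
        simp only [mem_iUnion, Finset.mem_filter, exists_prop]
        exact ⟨n, ⟨hn, h1⟩, h2⟩
      · simp only [mem_iInter, Finset.mem_filter]
        exact fun n hn => hn.2
    · rintro ⟨t, ht, hx⟩ ⟨⟨x', y⟩, hxy, rfl⟩
      have hy : y ∈ ⋃ n ∈ t, V n := ht ▸ mem_univ y
      simp only [mem_iUnion, exists_prop] at hy
      obtain ⟨n, hn, hy⟩ := hy
      have : (x', y) ∈ Gᶜ := by
        rw [hGc]
        exact mem_iUnion.2 ⟨n, mem_iInter₂.1 hx n hn, hy⟩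
      exact this hxy
  rw [this]
  exact .iUnion fun t => .iUnion fun _ => t.measurableSet_biInter fun n _ => hB n

/-- The minimum of a lower semicontinuous function over the compact sections of a Borel set is a
Borel function. -/
theorem measurable_biInf_section {G : Set (X × Y)} (hG : MeasurableSet G)
    (hc : ∀ x, IsClosed {y | (x, y) ∈ G}) {g : X × Y → ℝ≥0∞} (hg : Measurable g)
    (hl : ∀ x, LowerSemicontinuousOn (fun y => g (x, y)) {y | (x, y) ∈ G}) :
    Measurable fun x => ⨅ y ∈ {y | (x, y) ∈ G}, g (x, y) := by
  refine measurable_of_Iic fun c => ?_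
  rcases eq_or_ne c ⊤ with rfl | hctop
  · simp
  have : (fun x => ⨅ y ∈ {y | (x, y) ∈ G}, g (x, y)) ⁻¹' Iic c =
      Prod.fst '' {p | p ∈ G ∧ g p ≤ (fun _ => c) p.1} := by
    ext x
    simp only [mem_preimage, mem_Iic, mem_image, Prod.exists, exists_and_right, exists_eq_right]
    constructor
    · intro h
      have hx : ∃ y, (x, y) ∈ G := by
        by_contra! hcon
        refine hctop (top_le_iff.1 (le_trans ?_ h))
        exact le_iInf₂ fun y hy => absurd hy (hcon y)
      obtain ⟨y, hy, hmin⟩ := exists_eq_biInf_section hc hl hx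
      exact ⟨y, hy, hmin.trans_le h⟩
    · rintro ⟨y, hy, hle⟩
      exact (iInf₂_le y hy).trans hle
  rw [this]
  exact measurableSet_image_fst_of_isClosed_sections
    (hG.inter (measurableSet_le hg measurable_const)) (isClosed_sections_inter_le hc hl fun _ => c)

theorem measurableSet_argminSection {G : Set (X × Y)} (hG : MeasurableSet G)
    (hc : ∀ x, IsClosed {y | (x, y) ∈ G}) {g : X × Y → ℝ≥0∞} (hg : Measurable g)
    (hl : ∀ x, LowerSemicontinuousOn (fun y => g (x, y)) {y | (x, y) ∈ G}) :
    MeasurableSet (argminSection G g) :=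
  hG.inter (measurableSet_le hg ((measurable_biInf_section hG hc hg hl).comp measurable_fst))

end CompactSections

section Selection

variable {X Y : Type*} [TopologicalSpace X] [PolishSpace X] [MeasurableSpace X] [BorelSpace X]
  [MetricSpace Y] [CompactSpace Y] [MeasurableSpace Y] [BorelSpace Y]

/-- A Borel set with compact sections contains the graph of a Borel function over its projection.
Successive minimization of the distances to the points of a dense sequence cuts every section down
to a single point. -/
theorem exists_measurable_selection [Nonempty Y] {G : Set (X × Y)} (hG : MeasurableSet G)
    (hc : ∀ x, IsClosed {y | (x, y) ∈ G}) :
    ∃ u : X → Y, Measurable u ∧ ∀ x, (∃ y, (x, y) ∈ G) → (x, u x) ∈ G := by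
  let d := TopologicalSpace.denseSeq Y
  let g : ℕ → X × Y → ℝ≥0∞ := fun k p => edist p.2 (d k)
  have hgm : ∀ k, Measurable (g k) := fun k => measurable_snd.edist measurable_const
  have hgc : ∀ k x (s : Set Y), LowerSemicontinuousOn (fun y => g k (x, y)) s := fun k x s =>
    (continuous_id.edist continuous_const).lowerSemicontinuous.lowerSemicontinuousOn s
  let A : ℕ → Set (X × Y) := fun k => Nat.rec G (fun k S => argminSection S (g k)) k
  have A_succ : ∀ k, A (k + 1) = argminSection (A k) (g k) := fun k => rfl
  have hA : ∀ k, MeasurableSet (A k) ∧ ∀ x, IsClosed {y | (x, y) ∈ A k} := by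
    intro k
    induction k with
    | zero => exact ⟨hG, hc⟩
    | succ k ih =>
      rw [A_succ]
      exact ⟨measurableSet_argminSection ih.1 ih.2 (hgm k) fun x => hgc k x _,
        isClosed_argminSection ih.2 fun x => hgc k x _⟩
  have hAne : ∀ x, (∃ y, (x, y) ∈ G) → ∀ k, ∃ y, (x, y) ∈ A k := by
    intro x hx k
    induction k with
    | zero => exact hx
    | succ k ih => exact exists_mem_argminSection (hA k).2 (fun x => hgc k x _) ih
  have hAsub : ∀ k, A (k + 1) ⊆ A k := fun k p hp => hp.1
  let H : Set (X × Y) := ⋂ k, A k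
  have hHm : MeasurableSet H := .iInter fun k => (hA k).1
  have hHc : ∀ x, IsClosed {y | (x, y) ∈ H} := fun x => by
    have : {y | (x, y) ∈ H} = ⋂ k, {y | (x, y) ∈ A k} := by ext; simp [H]
    rw [this]
    exact isClosed_iInter fun k => (hA k).2 x
  have hHne : ∀ x, (∃ y, (x, y) ∈ G) → ∃ y, (x, y) ∈ H := fun x hx => by
    obtain ⟨y, hy⟩ := IsCompact.nonempty_iInter_of_sequence_nonempty_isCompact_isClosed
      (fun k => {y | (x, y) ∈ A k}) (fun k y hy => hAsub k hy) (fun k => hAne x hx k)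
      ((hA 0).2 x).isCompact fun k => (hA k).2 x
    exact ⟨y, mem_iInter.2 fun k => mem_iInter.1 hy k⟩
  have hHuniq : ∀ x y z, (x, y) ∈ H → (x, z) ∈ H → y = z := by
    intro x y z hy hz
    have heq : ∀ k, edist y (d k) = edist z (d k) := fun k => by
      have h1 : (x, y) ∈ A (k + 1) := mem_iInter.1 hy (k + 1)
      have h2 : (x, z) ∈ A (k + 1) := mem_iInter.1 hz (k + 1)
      exact le_antisymm (h1.2.trans (iInf₂_le z h2.1)) (h2.2.trans (iInf₂_le y h1.1))
    refine edist_le_zero.1 (ENNReal.le_of_forall_pos_le_add fun ε hε _ => ?_)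
    obtain ⟨k, hk⟩ := (TopologicalSpace.denseRange_denseSeq Y).exists_dist_lt z
      (half_pos (NNReal.coe_pos.2 hε))
    have hk' : edist z (d k) ≤ ENNReal.ofReal (ε / 2) := by
      rw [edist_dist]
      exact ENNReal.ofReal_le_ofReal hk.le
    calc edist y z ≤ edist y (d k) + edist (d k) z := edist_triangle _ _ _
      _ = edist z (d k) + edist z (d k) := by rw [heq, edist_comm (d k) z]
      _ ≤ ENNReal.ofReal (ε / 2) + ENNReal.ofReal (ε / 2) := add_le_add hk' hk'
      _ = 0 + ε := by
        rw [← ENNReal.ofReal_add (by positivity) (by positivity), add_halves,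
          ENNReal.ofReal_coe_nnreal, zero_add]
  classical
  let y₀ : Y := Classical.arbitrary Y
  let u : X → Y := fun x => if hx : ∃ y, (x, y) ∈ H then hx.choose else y₀
  have hu : ∀ x, (∃ y, (x, y) ∈ H) → (x, u x) ∈ H := fun x hx => by
    simp only [u, dif_pos hx]
    exact hx.choose_spec
  refine ⟨u, measurable_of_isClosed fun F hF => ?_, fun x hx =>
    mem_iInter.1 (hu x (hHne x hx)) 0⟩
  have h1 : MeasurableSet (Prod.fst '' (H ∩ Prod.snd ⁻¹' F)) := by
    refine measurableSet_image_fst_of_isClosed_sections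
      (hHm.inter (measurable_snd hF.measurableSet)) fun x => ?_
    exact (hHc x).inter hF
  have h2 : MeasurableSet (Prod.fst '' H) := measurableSet_image_fst_of_isClosed_sections hHm hHc
  have : u ⁻¹' F = Prod.fst '' (H ∩ Prod.snd ⁻¹' F) ∪ ((Prod.fst '' H)ᶜ ∩ {_x | y₀ ∈ F}) := by
    ext x
    simp only [mem_preimage, mem_union, mem_image, mem_inter_iff, Prod.exists, exists_and_right,
      exists_eq_right, mem_compl_iff, mem_ofPred_eq]
    by_cases hx : ∃ y, (x, y) ∈ H
    · constructor
      · exact fun h => Or.inl ⟨u x, hu x hx, h⟩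
      · rintro (⟨y, hy, hyF⟩ | h)
        · rwa [hHuniq x (u x) y (hu x hx) hy]
        · exact absurd hx h.1
    · have : u x = y₀ := dif_neg hx
      rw [this]
      constructor
      · exact fun h => Or.inr ⟨hx, h⟩
      · rintro (⟨y, hy, -⟩ | h)
        · exact absurd ⟨y, hy⟩ hx
        · exact h.2
  rw [this]
  exact h1.union (h2.compl.inter (MeasurableSet.const _))

/-- Measurable selection of a minimizer over the compact sections of a Borel set. -/
theorem exists_measurable_argmin [Nonempty Y] {G : Set (X × Y)} (hG : MeasurableSet G)
    (hc : ∀ x, IsClosed {y | (x, y) ∈ G}) {g : X × Y → ℝ≥0∞} (hg : Measurable g)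
    (hl : ∀ x, LowerSemicontinuousOn (fun y => g (x, y)) {y | (x, y) ∈ G}) :
    ∃ u : X → Y, Measurable u ∧ ∀ x, (∃ y, (x, y) ∈ G) →
      (x, u x) ∈ G ∧ ∀ y, (x, y) ∈ G → g (x, u x) ≤ g (x, y) := by
  obtain ⟨u, hu, hsel⟩ := exists_measurable_selection (measurableSet_argminSection hG hc hg hl)
    (isClosed_argminSection hc hl)
  refine ⟨u, hu, fun x hx => ?_⟩
  have := hsel x (exists_mem_argminSection hc hl hx)
  exact ⟨this.1, fun y hy => this.2.trans (iInf₂_le y hy)⟩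

end Selection

/-! ### Integration over the time axis -/

theorem lintegral_timeMeasure (f : ℝ≥0 → ℝ≥0∞) :
    ∫⁻ s, f s ∂timeMeasure = ∫⁻ x in Ici (0 : ℝ), f x.toNNReal := by
  have h := lintegral_subtype_comap (μ := volume) (measurableSet_Ici (a := (0 : ℝ)))
    fun x => f x.toNNReal
  rw [← h]
  refine lintegral_congr (μ := timeMeasure) fun s => ?_
  simp

theorem setLIntegral_timeMeasure {S : Set ℝ≥0} (hS : MeasurableSet S) (f : ℝ≥0 → ℝ≥0∞) :
    ∫⁻ s in S, f s ∂timeMeasure = ∫⁻ x in {x : ℝ | 0 ≤ x ∧ x.toNNReal ∈ S}, f x.toNNReal := by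
  have hm : MeasurableSet (Real.toNNReal ⁻¹' S) := measurable_real_toNNReal hS
  have : {x : ℝ | 0 ≤ x ∧ x.toNNReal ∈ S} = Real.toNNReal ⁻¹' S ∩ Ici 0 := by
    ext x; simp [and_comm]
  rw [← lintegral_indicator hS, lintegral_timeMeasure, this, ← Measure.restrict_restrict hm,
    ← lintegral_indicator hm]
  rfl

theorem setLIntegral_timeMeasure_lt (f : ℝ≥0 → ℝ≥0∞) (t : ℝ≥0) :
    ∫⁻ s in {s : ℝ≥0 | s < t}, f s ∂timeMeasure = ∫⁻ x in Ioc (0 : ℝ) t, f x.toNNReal := by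
  have hm : MeasurableSet {s : ℝ≥0 | s < t} := measurableSet_Iio
  rw [setLIntegral_timeMeasure hm, ← restrict_Ico_eq_restrict_Ioc]
  congr 2
  ext x
  simp only [mem_ofPred_eq, mem_Ico]
  exact and_congr_right fun hx => Real.toNNReal_lt_iff_lt_coe hx

/-- Translation invariance of Lebesgue measure on the half-line. -/
theorem lintegral_timeMeasure_add (f : ℝ≥0 → ℝ≥0∞) (t : ℝ≥0) :
    ∫⁻ s, f (t + s) ∂timeMeasure = ∫⁻ s in {s | t ≤ s}, f s ∂timeMeasure := by
  have hm : MeasurableSet {s : ℝ≥0 | t ≤ s} := measurableSet_Ici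
  rw [setLIntegral_timeMeasure hm, lintegral_timeMeasure,
    ← lintegral_indicator measurableSet_Ici, ← lintegral_indicator
      (show MeasurableSet {x : ℝ | 0 ≤ x ∧ x.toNNReal ∈ {s | t ≤ s}} from
        measurableSet_Ici.inter (measurable_real_toNNReal hm)),
    ← lintegral_add_left_eq_self ({x : ℝ | 0 ≤ x ∧ x.toNNReal ∈ {s | t ≤ s}}.indicator
      fun x => f x.toNNReal) (t : ℝ)]
  refine lintegral_congr fun x => ?_
  by_cases hx : 0 ≤ x
  · have h1 : (t : ℝ) + x ∈ {x : ℝ | 0 ≤ x ∧ x.toNNReal ∈ {s | t ≤ s}} := by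
      refine ⟨by positivity, ?_⟩
      rw [mem_ofPred_eq, Real.toNNReal_add (NNReal.coe_nonneg t) hx]
      simp
    rw [indicator_of_mem (show x ∈ Ici (0 : ℝ) from hx), indicator_of_mem h1,
      Real.toNNReal_add (NNReal.coe_nonneg t) hx, Real.toNNReal_coe]
  · rw [indicator_of_notMem (show x ∉ Ici (0 : ℝ) from hx), indicator_of_notMem]
    rintro ⟨h1, h2⟩
    rw [mem_ofPred_eq, ← NNReal.coe_le_coe, Real.coe_toNNReal _ h1] at h2
    linarith

theorem timeMeasure_lt (t : ℝ≥0) : timeMeasure {s | s < t} = t := by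
  have := setLIntegral_timeMeasure_lt (fun _ => 1) t
  simpa using this

instance : SigmaFinite timeMeasure :=
  ⟨⟨{ set := fun n => {s : ℝ≥0 | s < n}
      set_mem := fun _ => mem_univ _
      finite := fun n => by
        have := timeMeasure_lt (n : ℝ≥0)
        rw [this]
        exact ENNReal.coe_lt_top
      spanning := eq_univ_of_forall fun s => by
        obtain ⟨n, hn⟩ := exists_nat_gt s
        exact mem_iUnion.2 ⟨n, hn⟩ }⟩⟩

instance : NullSingletonClass timeMeasure where
  measure_singleton t := by
    have := setLIntegral_timeMeasure (measurableSet_singleton t) (fun _ => 1)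
    rw [lintegral_one, lintegral_one, Measure.restrict_apply_univ,
      Measure.restrict_apply_univ] at this
    rw [this]
    refine measure_mono_null (t := {(t : ℝ)}) ?_ (by simp)
    rintro x ⟨hx, hxt⟩
    rw [mem_singleton_iff] at hxt ⊢
    rw [← hxt, Real.coe_toNNReal _ hx]

theorem measurableSet_coe_lt (T : ℝ≥0∞) : MeasurableSet {s : ℝ≥0 | (s : ℝ≥0∞) < T} :=
  measurable_coe_nnreal_ennreal measurableSet_Iio

theorem quasiMeasurePreserving_add_left (t : ℝ≥0) :
    Measure.QuasiMeasurePreserving (fun s => t + s) timeMeasure timeMeasure := by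
  refine ⟨measurable_const_add t, Measure.AbsolutelyContinuous.mk fun S hS h0 => ?_⟩
  rw [Measure.map_apply (measurable_const_add t) hS, ← lintegral_indicator_one
    (measurable_const_add t hS)]
  have := lintegral_timeMeasure_add (S.indicator 1) t
  refine le_zero_iff.1 ?_
  calc ∫⁻ s, ((fun s => t + s) ⁻¹' S).indicator 1 s ∂timeMeasure
      = ∫⁻ s, S.indicator 1 (t + s) ∂timeMeasure := rfl
    _ = ∫⁻ s in {s | t ≤ s}, S.indicator 1 s ∂timeMeasure := this
    _ ≤ ∫⁻ s, S.indicator 1 s ∂timeMeasure := setLIntegral_le_lintegral _ _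
    _ = 0 := by rw [lintegral_indicator_one hS, h0]

/-! ### The exponential of a non-positive extended real -/

theorem expNeg_add (a b : ℝ≥0∞) : expNeg (a + b) = expNeg a * expNeg b := by
  rw [expNeg, expNeg, expNeg, EReal.coe_ennreal_add, ← EReal.exp_add,
    EReal.neg_add (by simp) (by simp), sub_eq_add_neg]

@[simp] theorem expNeg_zero : expNeg 0 = 1 := by simp [expNeg]

@[simp] theorem expNeg_top : expNeg ⊤ = 0 := by simp [expNeg]

theorem expNeg_ofReal {x : ℝ} (hx : 0 ≤ x) :
    expNeg (ENNReal.ofReal x) = ENNReal.ofReal (Real.exp (-x)) := by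
  rw [expNeg, EReal.coe_ennreal_ofReal, max_eq_left hx, ← EReal.coe_neg, EReal.exp_coe]

theorem expNeg_anti : Antitone expNeg := fun a b h => by
  unfold expNeg
  exact EReal.exp_monotone (EReal.neg_le_neg_iff.2 (EReal.coe_ennreal_le_coe_ennreal_iff.2 h))

theorem expNeg_le_one (a : ℝ≥0∞) : expNeg a ≤ 1 := expNeg_zero ▸ expNeg_anti zero_le

theorem expNeg_ne_top (a : ℝ≥0∞) : expNeg a ≠ ⊤ :=
  ((expNeg_le_one a).trans_lt ENNReal.one_lt_top).ne

theorem expNeg_ne_zero {a : ℝ≥0∞} (ha : a ≠ ⊤) : expNeg a ≠ 0 := by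
  rw [expNeg, Ne, EReal.exp_eq_zero_iff, EReal.neg_eq_bot_iff]
  simpa using ha

theorem continuous_expNeg : Continuous expNeg := by
  unfold expNeg
  exact (EReal.expHomeomorph.continuous).comp (continuous_neg.comp continuous_coe_ennreal_ereal)

theorem measurable_expNeg : Measurable expNeg := continuous_expNeg.measurable

theorem expNeg_inv_ofReal {x : ℝ} (hx : 0 ≤ x) :
    (expNeg (ENNReal.ofReal x))⁻¹ = ENNReal.ofReal (Real.exp x) := by
  rw [expNeg_ofReal hx, ← ENNReal.ofReal_inv_of_pos (Real.exp_pos _), Real.exp_neg, inv_inv]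

/-! ### Primitives of non-negative functions of time -/

/-- The integral of `a` over the times before `T ∈ [0, ∞]`. -/
def cumul (a : ℝ≥0 → ℝ≥0∞) (T : ℝ≥0∞) : ℝ≥0∞ := ∫⁻ s in {s : ℝ≥0 | (s : ℝ≥0∞) < T}, a s ∂timeMeasure

theorem cumul_zero (a : ℝ≥0 → ℝ≥0∞) : cumul a 0 = 0 := by simp [cumul]

theorem cumul_mono (a : ℝ≥0 → ℝ≥0∞) : Monotone (cumul a) := fun _ _ h =>
  lintegral_mono_set fun _ hs => lt_of_lt_of_le hs h

theorem cumul_le_cumul {a b : ℝ≥0 → ℝ≥0∞} {T : ℝ≥0∞} (h : ∀ s : ℝ≥0, (s : ℝ≥0∞) < T → a s ≤ b s) :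
    cumul a T ≤ cumul b T := setLIntegral_mono' (measurableSet_coe_lt T) h

theorem cumul_congr {a b : ℝ≥0 → ℝ≥0∞} {T : ℝ≥0∞} (h : ∀ s : ℝ≥0, (s : ℝ≥0∞) < T → a s = b s) :
    cumul a T = cumul b T := setLIntegral_congr_fun (measurableSet_coe_lt T) h

theorem cumul_congr_ae {a b : ℝ≥0 → ℝ≥0∞} {T : ℝ≥0∞}
    (h : ∀ᵐ s : ℝ≥0 ∂timeMeasure, (s : ℝ≥0∞) < T → a s = b s) : cumul a T = cumul b T :=
  setLIntegral_congr_fun_ae (measurableSet_coe_lt T) h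

theorem cumul_fun_add {a : ℝ≥0 → ℝ≥0∞} (ha : Measurable a) (b : ℝ≥0 → ℝ≥0∞) (T : ℝ≥0∞) :
    cumul (fun s => a s + b s) T = cumul a T + cumul b T := lintegral_add_left ha b

theorem cumul_const_mul (c : ℝ≥0∞) (hc : c ≠ ⊤) (a : ℝ≥0 → ℝ≥0∞) (T : ℝ≥0∞) :
    cumul (fun s => c * a s) T = c * cumul a T := lintegral_const_mul' c a hc

theorem cumul_const (c : ℝ≥0∞) (t : ℝ≥0) : cumul (fun _ => c) t = c * t := by
  simp only [cumul, lintegral_const, Measure.restrict_apply_univ, ENNReal.coe_lt_coe]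
  rw [timeMeasure_lt]

theorem measurable_cumul (a : ℝ≥0 → ℝ≥0∞) : Measurable fun s : ℝ≥0 => cumul a s :=
  (show Monotone fun s : ℝ≥0 => cumul a s from fun _ _ h =>
    cumul_mono a (ENNReal.coe_le_coe.2 h)).measurable

theorem cumul_add (a : ℝ≥0 → ℝ≥0∞) (t : ℝ≥0) (S : ℝ≥0∞) :
    cumul a (t + S) = cumul a t + cumul (fun s => a (t + s)) S := by
  have hu : {s : ℝ≥0 | (s : ℝ≥0∞) < t + S} =
      {s : ℝ≥0 | (s : ℝ≥0∞) < t} ∪ ({s : ℝ≥0 | (s : ℝ≥0∞) < t + S} ∩ {s | t ≤ s}) := by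
    ext s
    simp only [mem_ofPred_eq, mem_union, mem_inter_iff, ENNReal.coe_lt_coe]
    rcases lt_or_ge s t with h | h
    · simp only [h, true_or, iff_true]
      exact (ENNReal.coe_lt_coe.2 h).trans_le le_self_add
    · simp [h, h.not_gt]
  have hm : MeasurableSet {s : ℝ≥0 | t ≤ s} := measurableSet_Ici
  rw [cumul, hu, lintegral_union ((measurableSet_coe_lt _).inter hm)]
  · congr 1
    rw [← Measure.restrict_restrict (measurableSet_coe_lt _),
      ← lintegral_indicator (measurableSet_coe_lt _), ← lintegral_timeMeasure_add, cumul,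
      ← lintegral_indicator (measurableSet_coe_lt _)]
    refine lintegral_congr fun s => ?_
    have : (t + s ∈ {s : ℝ≥0 | (s : ℝ≥0∞) < t + S}) ↔ s ∈ {s : ℝ≥0 | (s : ℝ≥0∞) < S} := by
      simp only [mem_ofPred_eq, ENNReal.coe_add]
      exact ENNReal.add_lt_add_iff_left ENNReal.coe_ne_top
    simp only [indicator_apply, this]
  · rw [disjoint_left]
    rintro s h1 ⟨-, h2⟩
    exact (ENNReal.coe_lt_coe.1 h1).not_ge h2

theorem tendsto_cumul (a : ℝ≥0 → ℝ≥0∞) {T : ℝ≥0∞} (hT : T ≠ 0) :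
    Tendsto (cumul a) (𝓝[<] T) (𝓝 (cumul a T)) := by
  have h := (cumul_mono a).tendsto_nhdsLT T
  convert h using 2
  refine le_antisymm ?_ (csSup_le ?_ ?_)
  · obtain ⟨u, hu, huT, hlim⟩ := exists_seq_strictMono_tendsto' (pos_iff_ne_zero.2 hT)
    have hU : {s : ℝ≥0 | (s : ℝ≥0∞) < T} = ⋃ n, {s : ℝ≥0 | (s : ℝ≥0∞) < u n} := by
      ext s
      simp only [mem_ofPred_eq, mem_iUnion]
      exact ⟨fun hs => (hlim.eventually_const_lt hs).exists, fun ⟨n, hn⟩ => hn.trans (huT n).2⟩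
    rw [cumul, hU, setLIntegral_iUnion_of_directed]
    · exact iSup_le fun n => le_sSup ⟨u n, (huT n).2, rfl⟩
    · exact Monotone.directed_le fun m n hmn s hs => lt_of_lt_of_le hs (hu.monotone hmn)
  · exact ⟨_, 0, pos_iff_ne_zero.2 hT, rfl⟩
  · rintro _ ⟨t, ht, rfl⟩
    exact cumul_mono a (le_of_lt ht)

theorem cumul_le_of_forall_lt {a : ℝ≥0 → ℝ≥0∞} {T c : ℝ≥0∞}
    (h : ∀ t : ℝ≥0, (t : ℝ≥0∞) < T → cumul a t ≤ c) : cumul a T ≤ c := by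
  rcases eq_or_ne T 0 with rfl | hT
  · simp [cumul_zero]
  have : (𝓝[<] T).NeBot := nhdsLT_neBot_of_exists_lt ⟨0, pos_iff_ne_zero.2 hT⟩
  refine le_of_tendsto (tendsto_cumul a hT) ?_
  filter_upwards [self_mem_nhdsWithin] with t ht
  have := h t.toNNReal
  rw [ENNReal.coe_toNNReal (ne_top_of_lt ht)] at this
  exact this ht

theorem cumul_eq_ofReal {b : ℝ≥0 → ℝ≥0∞} (hb : Measurable b) {t : ℝ≥0} (ht : cumul b t ≠ ⊤) :
    IntervalIntegrable (fun x : ℝ => (b x.toNNReal).toReal) volume 0 t ∧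
    ∀ s : ℝ≥0, s ≤ t →
      cumul b s = ENNReal.ofReal (∫ x in (0 : ℝ)..s, (b x.toNNReal).toReal) := by
  have hbm : Measurable fun x : ℝ => b x.toNNReal := hb.comp measurable_real_toNNReal
  have heq : ∀ s : ℝ≥0, cumul b s = ∫⁻ x in Ioc (0 : ℝ) s, b x.toNNReal := fun s => by
    rw [← setLIntegral_timeMeasure_lt]
    simp [cumul]
  constructor
  · rw [intervalIntegrable_iff_integrableOn_Ioc_of_le (NNReal.coe_nonneg t)]
    refine integrable_toReal_of_lintegral_ne_top hbm.aemeasurable ?_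
    rwa [← heq]
  · intro s hs
    have hs' : cumul b s ≠ ⊤ := ne_top_of_le_ne_top ht (cumul_mono b (ENNReal.coe_le_coe.2 hs))
    rw [intervalIntegral.integral_of_le (NNReal.coe_nonneg s), integral_toReal hbm.aemeasurable, ← heq,
      ENNReal.ofReal_toReal hs']
    rw [heq] at hs'
    exact ae_lt_top hbm hs'

/-- The fundamental theorem of calculus for the exponential of a primitive. -/
theorem intervalIntegral_mul_exp {b : ℝ → ℝ} {t : ℝ} (hb : IntervalIntegrable b volume 0 t) (c : ℝ) :
    ∫ x in (0 : ℝ)..t, c * b x * Real.exp (c * ∫ v in (0 : ℝ)..x, b v) =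
      Real.exp (c * ∫ v in (0 : ℝ)..t, b v) - 1 := by
  have hac := hb.absolutelyContinuousOnInterval_intervalIntegral (c := 0) (by simp)
  have hac' : AbsolutelyContinuousOnInterval (fun x => c * ∫ v in (0 : ℝ)..x, b v) 0 t :=
    hac.const_mul c
  have hexp : AbsolutelyContinuousOnInterval
      (fun x => Real.exp (c * ∫ v in (0 : ℝ)..x, b v)) 0 t := by
    obtain ⟨C, hC⟩ := hac'.exists_bound
    have hlip : ∃ K, LipschitzOnWith K Real.exp (Icc (-C) C) :=
      (Real.contDiff_exp (n := 1)).contDiffOn.exists_lipschitzOnWith (by simp) (convex_Icc _ _)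
        isCompact_Icc
    obtain ⟨K, hK⟩ := hlip
    rw [absolutelyContinuousOnInterval_iff] at hac' ⊢
    intro ε hε
    obtain ⟨δ, hδ, h⟩ := hac' (ε / (K + 1)) (by positivity)
    refine ⟨δ, hδ, fun E hE hlen => ?_⟩
    have hmem : ∀ x ∈ uIcc 0 t, (c * ∫ v in (0 : ℝ)..x, b v) ∈ Icc (-C) C := fun x hx =>
      abs_le.1 (hC x hx)
    calc ∑ i ∈ Finset.range E.1, dist (Real.exp (c * ∫ v in (0 : ℝ)..(E.2 i).1, b v))
          (Real.exp (c * ∫ v in (0 : ℝ)..(E.2 i).2, b v))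
        ≤ ∑ i ∈ Finset.range E.1, K * dist (c * ∫ v in (0 : ℝ)..(E.2 i).1, b v)
          (c * ∫ v in (0 : ℝ)..(E.2 i).2, b v) := by
          refine Finset.sum_le_sum fun i hi => hK.dist_le_mul _ (hmem _ ?_) _ (hmem _ ?_)
          · exact (hE.1 i hi).1
          · exact (hE.1 i hi).2
      _ = K * ∑ i ∈ Finset.range E.1, dist (c * ∫ v in (0 : ℝ)..(E.2 i).1, b v)
          (c * ∫ v in (0 : ℝ)..(E.2 i).2, b v) := (Finset.mul_sum _ _ _).symm
      _ ≤ K * (ε / (K + 1)) := by gcongr; exact (h E hE hlen).le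
      _ < (K + 1) * (ε / (K + 1)) := by gcongr; linarith
      _ = ε := by field
  have h1 : ∀ᵐ x, x ∈ uIoc 0 t →
      c * b x * Real.exp (c * ∫ v in (0 : ℝ)..x, b v) =
        deriv (fun x => Real.exp (c * ∫ v in (0 : ℝ)..x, b v)) x := by
    filter_upwards [hb.ae_hasDerivAt_integral] with x hx hxt
    have := ((hx (uIoc_subset_uIcc hxt) 0 (by simp)).const_mul c).exp
    rw [this.deriv]
    ring
  rw [intervalIntegral.integral_congr_ae h1, hexp.integral_deriv_eq_sub]
  simp

/-- `∫₀ᵗ b(s) ψ(s) ds` in `[0, ∞]` for a continuous real function `ψ`. -/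
theorem cumul_mul_ofReal {b : ℝ≥0 → ℝ≥0∞} (hb : Measurable b) {t : ℝ≥0} (ht : cumul b t ≠ ⊤)
    {ψ : ℝ → ℝ} (hψ : ContinuousOn ψ (uIcc 0 t)) (hψ0 : ∀ x, 0 ≤ ψ x) {Ψ : ℝ≥0 → ℝ≥0∞}
    (hΨ : ∀ s : ℝ≥0, s ≤ t → Ψ s = ENNReal.ofReal (ψ s)) :
    cumul (fun s => b s * Ψ s) t =
      ENNReal.ofReal (∫ x in (0 : ℝ)..t, (b x.toNNReal).toReal * ψ x) := by
  have hbm : Measurable fun x : ℝ => b x.toNNReal := hb.comp measurable_real_toNNReal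
  have hint := (cumul_eq_ofReal hb ht).1.mul_continuousOn hψ
  rw [intervalIntegral.integral_of_le (NNReal.coe_nonneg t), ofReal_integral_eq_lintegral_ofReal
    ((intervalIntegrable_iff_integrableOn_Ioc_of_le (NNReal.coe_nonneg t)).1 hint)
    (ae_of_all _ fun x => mul_nonneg ENNReal.toReal_nonneg (hψ0 x))]
  have heq : ∀ f : ℝ≥0 → ℝ≥0∞, cumul f t = ∫⁻ x in Ioc (0 : ℝ) t, f x.toNNReal := fun f => by
    rw [← setLIntegral_timeMeasure_lt]
    simp [cumul]
  rw [heq]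
  refine lintegral_congr_ae ?_
  rw [heq] at ht
  filter_upwards [ae_lt_top hbm ht, ae_restrict_mem measurableSet_Ioc] with x hx hxt
  rw [hΨ _ (by rw [Real.toNNReal_le_iff_le_coe]; exact hxt.2), Real.coe_toNNReal _ hxt.1.le,
    ENNReal.ofReal_mul ENNReal.toReal_nonneg, ENNReal.ofReal_toReal hx.ne]

/-- `cumul_mul_expNeg_add_of_forall_lt` at a finite time up to which `b` is integrable. -/
theorem cumul_mul_expNeg_add {b : ℝ≥0 → ℝ≥0∞} (hb : Measurable b) {t : ℝ≥0}
    (ht : cumul b t ≠ ⊤) :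
    cumul (fun s => b s * expNeg (cumul b s)) t + expNeg (cumul b t) = 1 := by
  obtain ⟨hint, heq⟩ := cumul_eq_ofReal hb ht
  have hcont : ContinuousOn (fun x : ℝ => ∫ v in (0 : ℝ)..x, (b v.toNNReal).toReal) (uIcc 0 t) :=
    (hint.absolutelyContinuousOnInterval_intervalIntegral (c := 0) (by simp)).continuousOn
  have hpos : ∀ s : ℝ≥0, 0 ≤ ∫ v in (0 : ℝ)..s, (b v.toNNReal).toReal := fun s =>
    intervalIntegral.integral_nonneg (NNReal.coe_nonneg s) fun _ _ => ENNReal.toReal_nonneg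
  rw [cumul_mul_ofReal hb ht (ψ := fun x => Real.exp (-∫ v in (0 : ℝ)..x, (b v.toNNReal).toReal))
    (Real.continuous_exp.comp_continuousOn hcont.neg) (fun x => (Real.exp_pos _).le)
    fun s hs => by rw [heq s hs, expNeg_ofReal (hpos s)], heq t le_rfl, expNeg_ofReal (hpos t)]
  have := intervalIntegral_mul_exp hint (-1)
  simp only [neg_mul, one_mul, intervalIntegral.integral_neg] at this
  rw [← ENNReal.ofReal_add _ (Real.exp_pos _).le]
  · rw [show ∀ a b : ℝ, -a = b - 1 → a + b = 1 from fun a b h => by linarith]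
    · simp
    · exact this
  · exact intervalIntegral.integral_nonneg (NNReal.coe_nonneg t) fun _ _ =>
      mul_nonneg ENNReal.toReal_nonneg (Real.exp_pos _).le

theorem one_add_cumul_mul_inv_expNeg {b : ℝ≥0 → ℝ≥0∞} (hb : Measurable b) {t : ℝ≥0}
    (ht : cumul b t ≠ ⊤) :
    1 + cumul (fun s => b s * (expNeg (cumul b s))⁻¹) t = (expNeg (cumul b t))⁻¹ := by
  obtain ⟨hint, heq⟩ := cumul_eq_ofReal hb ht
  have hcont : ContinuousOn (fun x : ℝ => ∫ v in (0 : ℝ)..x, (b v.toNNReal).toReal) (uIcc 0 t) :=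
    (hint.absolutelyContinuousOnInterval_intervalIntegral (c := 0) (by simp)).continuousOn
  have hpos : ∀ s : ℝ≥0, 0 ≤ ∫ v in (0 : ℝ)..s, (b v.toNNReal).toReal := fun s =>
    intervalIntegral.integral_nonneg (NNReal.coe_nonneg s) fun _ _ => ENNReal.toReal_nonneg
  rw [cumul_mul_ofReal hb ht (ψ := fun x => Real.exp (∫ v in (0 : ℝ)..x, (b v.toNNReal).toReal))
    (Real.continuous_exp.comp_continuousOn hcont) (fun x => (Real.exp_pos _).le)
    fun s hs => by rw [heq s hs, expNeg_inv_ofReal (hpos s)], heq t le_rfl,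
    expNeg_inv_ofReal (hpos t)]
  have := intervalIntegral_mul_exp hint 1
  simp only [one_mul] at this
  rw [this, ← ENNReal.ofReal_one, ← ENNReal.ofReal_add zero_le_one]
  · congr 1; ring
  · rw [sub_nonneg]; exact Real.one_le_exp (hpos t)

/-- An exponential clock of rate `b` rings before `T` or not. The integral of `b` up to `T` may be
infinite. -/
theorem cumul_mul_expNeg_add_of_forall_lt {b : ℝ≥0 → ℝ≥0∞} (hb : Measurable b) {T : ℝ≥0∞}
    (ht : ∀ t : ℝ≥0, (t : ℝ≥0∞) < T → cumul b t ≠ ⊤) :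
    cumul (fun s => b s * expNeg (cumul b s)) T + expNeg (cumul b T) = 1 := by
  rcases eq_or_ne T 0 with rfl | hT
  · simp [cumul_zero]
  have : (𝓝[<] T).NeBot := nhdsLT_neBot_of_exists_lt ⟨0, pos_iff_ne_zero.2 hT⟩
  refine tendsto_nhds_unique ((tendsto_cumul _ hT).add
    ((continuous_expNeg.tendsto _).comp (tendsto_cumul b hT))) ?_
  refine tendsto_const_nhds.congr' ?_
  filter_upwards [self_mem_nhdsWithin] with t htT
  have h := cumul_mul_expNeg_add hb (t := t.toNNReal)
  have h' := ht t.toNNReal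
  rw [ENNReal.coe_toNNReal (ne_top_of_lt htT)] at h h'
  exact (h (h' htT)).symm

/-! ### Discounted values along a path -/

/-- The value at time `0` of a running reward `G` and a terminal reward `B` received at time `T`,
discounted at rate `a`. -/
def pathValue (a G : ℝ≥0 → ℝ≥0∞) (B T : ℝ≥0∞) : ℝ≥0∞ :=
  cumul (fun s => expNeg (cumul a s) * G s) T + expNeg (cumul a T) * B

/-- The value at time `t` of the rewards of `pathValue`. -/
def valueAt (a G : ℝ≥0 → ℝ≥0∞) (B T : ℝ≥0∞) (t : ℝ≥0) : ℝ≥0∞ :=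
  pathValue (fun s => a (t + s)) (fun s => G (t + s)) B (T - t)

theorem valueAt_self (a G : ℝ≥0 → ℝ≥0∞) (B : ℝ≥0∞) (t : ℝ≥0) : valueAt a G B t t = B := by
  simp [valueAt, pathValue, cumul_zero]

theorem pathValue_congr {a a' G G' : ℝ≥0 → ℝ≥0∞} {B B' T : ℝ≥0∞}
    (ha : ∀ s : ℝ≥0, (s : ℝ≥0∞) < T → a s = a' s) (hG : ∀ s : ℝ≥0, (s : ℝ≥0∞) < T → G s = G' s)
    (hB : expNeg (cumul a' T) * B = expNeg (cumul a' T) * B') :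
    pathValue a G B T = pathValue a' G' B' T := by
  have h : ∀ s : ℝ≥0∞, s ≤ T → cumul a s = cumul a' s := fun s hs =>
    cumul_congr fun u hu => ha u (hu.trans_le hs)
  rw [pathValue, pathValue, h T le_rfl, hB, cumul_congr fun s hs => by rw [h s hs.le, hG s hs]]

theorem discounted_valueAt (a G : ℝ≥0 → ℝ≥0∞) (B : ℝ≥0∞) {T : ℝ≥0∞} {t : ℝ≥0}
    (ht : (t : ℝ≥0∞) ≤ T) :
    expNeg (cumul a t) * valueAt a G B T t =
      cumul (fun s => expNeg (cumul a (t + s : ℝ≥0)) * G (t + s)) (T - t) +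
        expNeg (cumul a T) * B := by
  rw [valueAt, pathValue, mul_add, ← mul_assoc, ← expNeg_add, ← cumul_add,
    add_tsub_cancel_of_le ht, ← cumul_const_mul _ (expNeg_ne_top _)]
  congr 2
  funext s
  rw [ENNReal.coe_add, cumul_add, expNeg_add, mul_assoc]

/-- The value at an intermediate time may replace the rewards received after it. -/
theorem pathValue_eq_valueAt (a G : ℝ≥0 → ℝ≥0∞) (B : ℝ≥0∞) {T : ℝ≥0∞} {t : ℝ≥0}
    (ht : (t : ℝ≥0∞) ≤ T) : pathValue a G B T = pathValue a G (valueAt a G B T t) t := by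
  conv_rhs => rw [pathValue, discounted_valueAt a G B ht, ← add_assoc, ← cumul_add,
    add_tsub_cancel_of_le ht]
  rfl

theorem valueAt_eq_valueAt (a G : ℝ≥0 → ℝ≥0∞) (B : ℝ≥0∞) {T : ℝ≥0∞} {s t : ℝ≥0} (hst : s ≤ t)
    (ht : (t : ℝ≥0∞) ≤ T) :
    valueAt a G B T s = valueAt a G (valueAt a G B T t) t s := by
  have h1 : ((t - s : ℝ≥0) : ℝ≥0∞) ≤ T - s := by
    rw [ENNReal.coe_sub]
    exact tsub_le_tsub_right ht _
  rw [valueAt, pathValue_eq_valueAt _ _ _ h1, valueAt, ENNReal.coe_sub, valueAt, valueAt,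
    tsub_tsub, add_tsub_cancel_of_le (ENNReal.coe_le_coe.2 hst)]
  simp only [← add_assoc, add_tsub_cancel_of_le hst]

/-- Tonelli's theorem on the triangle `s < u < T`. -/
theorem cumul_mul_cumul_add {κ g : ℝ≥0 → ℝ≥0∞} (hκ : Measurable κ) (hg : Measurable g)
    (T : ℝ≥0∞) :
    cumul (fun s => κ s * cumul (fun u => g (s + u)) (T - s)) T =
      cumul (fun u => g u * cumul κ u) T := by
  have h1 : ∀ s : ℝ≥0, cumul (fun u => g (s + u)) (T - s) =
      ∫⁻ u, {u : ℝ≥0 | s ≤ u}.indicator ({u : ℝ≥0 | (u : ℝ≥0∞) < T}.indicator g) u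
        ∂timeMeasure := fun s => by
    have hm : MeasurableSet {u : ℝ≥0 | s ≤ u} := measurableSet_Ici
    rw [lintegral_indicator hm, ← lintegral_timeMeasure_add, cumul,
      ← lintegral_indicator (measurableSet_coe_lt _)]
    refine lintegral_congr fun u => ?_
    have : (s + u ∈ {u : ℝ≥0 | (u : ℝ≥0∞) < T}) ↔ u ∈ {u : ℝ≥0 | (u : ℝ≥0∞) < T - s} := by
      simp only [mem_ofPred_eq, ENNReal.coe_add]
      exact (lt_tsub_iff_left).symm
    simp only [indicator_apply, this]
  let F : ℝ≥0 → ℝ≥0 → ℝ≥0∞ := fun s u => {p : ℝ≥0 × ℝ≥0 | p.1 ≤ p.2 ∧ (p.2 : ℝ≥0∞) < T}.indicator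
    (fun p => κ p.1 * g p.2) (s, u)
  have hFm : Measurable (Function.uncurry F) := by
    refine Measurable.indicator ((hκ.comp measurable_fst).mul (hg.comp measurable_snd)) ?_
    exact (measurableSet_le measurable_fst measurable_snd).inter
      (measurable_snd (measurableSet_coe_lt T))
  have hl : cumul (fun s => κ s * cumul (fun u => g (s + u)) (T - s)) T =
      ∫⁻ s, ∫⁻ u, F s u ∂timeMeasure ∂timeMeasure := by
    rw [cumul, ← lintegral_indicator (measurableSet_coe_lt _)]
    refine lintegral_congr fun s => ?_
    rw [indicator_apply]
    split_ifs with hs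
    · have hm : MeasurableSet {u : ℝ≥0 | s ≤ u} := measurableSet_Ici
      rw [h1, ← lintegral_const_mul _ ((hg.indicator (measurableSet_coe_lt T)).indicator hm)]
      refine lintegral_congr fun u => ?_
      by_cases hsu : s ≤ u <;> by_cases hu : (u : ℝ≥0∞) < T <;>
        simp [F, indicator_apply, hsu, hu]
    · refine (lintegral_eq_zero_of_ae_eq_zero (ae_of_all _ fun u => ?_)).symm
      refine indicator_of_notMem (fun h => hs ?_) _
      exact lt_of_le_of_lt (ENNReal.coe_le_coe.2 h.1) h.2
  have hr : cumul (fun u => g u * cumul κ u) T =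
      ∫⁻ u, ∫⁻ s, F s u ∂timeMeasure ∂timeMeasure := by
    rw [cumul, ← lintegral_indicator (measurableSet_coe_lt _)]
    refine lintegral_congr fun u => ?_
    rw [indicator_apply]
    split_ifs with hu
    · have hm : MeasurableSet {s : ℝ≥0 | (s : ℝ≥0∞) < u} := measurableSet_coe_lt _
      rw [cumul, ← lintegral_indicator hm, ← lintegral_const_mul _ (hκ.indicator hm)]
      refine lintegral_congr_ae ?_
      -- the diagonal is negligible
      filter_upwards [compl_mem_ae_iff.2 (measure_singleton (μ := timeMeasure) u)] with s hs
      have hs' : s ≠ u := hs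
      simp only [indicator_apply, mem_ofPred_eq, F, ENNReal.coe_lt_coe,
        show (u : ℝ≥0∞) < T from hu, and_true]
      rcases lt_or_gt_of_ne hs' with h | h
      · rw [if_pos h, if_pos h.le, mul_comm]
      · rw [if_neg h.not_gt, if_neg h.not_ge, mul_zero]
    · refine (lintegral_eq_zero_of_ae_eq_zero (ae_of_all _ fun s => ?_)).symm
      exact indicator_of_notMem (fun h => hu h.2) _
  rw [hl, hr, lintegral_lintegral_swap hFm.aemeasurable]

theorem measurable_expNeg_cumul (a : ℝ≥0 → ℝ≥0∞) : Measurable fun s : ℝ≥0 => expNeg (cumul a s) :=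
  measurable_expNeg.comp (measurable_cumul a)

/-- The discount rate may be increased from `a` to `a + δ` if the value itself is paid at rate `δ`:
to stop the clock and receive the current value is to go on. -/
theorem pathValue_rate_add {a δ G : ℝ≥0 → ℝ≥0∞} (ha : Measurable a) (hδ : Measurable δ)
    (hG : Measurable G) (B : ℝ≥0∞) {T : ℝ≥0∞}
    (hfin : ∀ t : ℝ≥0, (t : ℝ≥0∞) < T → cumul δ t ≠ ⊤) :
    pathValue (fun s => a s + δ s) (fun s => G s + δ s * valueAt a G B T s) B T =
      pathValue a G B T := by
  set g : ℝ≥0 → ℝ≥0∞ := fun s => expNeg (cumul a s) * G s with hg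
  set κ : ℝ≥0 → ℝ≥0∞ := fun s => δ s * expNeg (cumul δ s) with hκ
  have hgm : Measurable g := (measurable_expNeg_cumul a).mul hG
  have hκm : Measurable κ := hδ.mul (measurable_expNeg_cumul δ)
  have hA : ∀ T, expNeg (cumul (fun s => a s + δ s) T) =
      expNeg (cumul a T) * expNeg (cumul δ T) := fun T => by
    rw [cumul_fun_add ha, expNeg_add]
  have h1 : cumul (fun s => expNeg (cumul (fun s => a s + δ s) s) *
      (G s + δ s * valueAt a G B T s)) T =
      cumul (fun s => (expNeg (cumul δ s) * g s + κ s * (expNeg (cumul a T) * B)) +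
        κ s * cumul (fun u => g (s + u)) (T - s)) T := by
    refine cumul_congr fun s hs => ?_
    have := discounted_valueAt a G B hs.le
    rw [hA]
    calc expNeg (cumul a s) * expNeg (cumul δ s) * (G s + δ s * valueAt a G B T s)
        = expNeg (cumul δ s) * (expNeg (cumul a s) * G s) +
          δ s * expNeg (cumul δ s) * (expNeg (cumul a s) * valueAt a G B T s) := by ring
      _ = _ := by rw [this]; simp only [hκ, hg]; ring
  have hm : Measurable fun s : ℝ≥0 => expNeg (cumul δ s) * g s :=
    (measurable_expNeg_cumul δ).mul hgm
  have hc : cumul (fun s => κ s * (expNeg (cumul a T) * B)) T =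
      cumul κ T * (expNeg (cumul a T) * B) := lintegral_mul_const _ hκm
  have h2 : cumul (fun s => expNeg (cumul δ s) * g s + g s * cumul κ s) T = cumul g T := by
    refine cumul_congr fun s hs => ?_
    have := cumul_mul_expNeg_add hδ (hfin s hs)
    rw [mul_comm (expNeg _), ← mul_add, add_comm (expNeg _), this, mul_one]
  have h3 := cumul_mul_expNeg_add_of_forall_lt hδ hfin
  rw [cumul_fun_add hm] at h2
  have hm' : Measurable fun s : ℝ≥0 =>
      expNeg (cumul δ s) * g s + κ s * (expNeg (cumul a T) * B) := hm.add (hκm.mul_const _)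
  rw [pathValue, h1, cumul_fun_add hm', cumul_fun_add hm,
    cumul_mul_cumul_add hκm hgm, hc, hA, pathValue, ← h2]
  calc _ = cumul (fun s => expNeg (cumul δ s) * g s) T + cumul (fun u => g u * cumul κ u) T +
        expNeg (cumul a T) * B * (cumul κ T + expNeg (cumul δ T)) := by ring
    _ = _ := by rw [h3, mul_one]

/-- The discount rate may be decreased from `a + δ` to `a` if the value itself is charged at rate
`δ`. As there is no subtraction in `[0, ∞]`, the charge is added on the other side. -/
theorem pathValue_rate_sub_aux {a δ G : ℝ≥0 → ℝ≥0∞} (ha : Measurable a) (hδ : Measurable δ)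
    (hG : Measurable G) (B : ℝ≥0∞) {t : ℝ≥0} (hfin : cumul δ t ≠ ⊤) :
    pathValue (fun s => a s + δ s) G B t +
        cumul (fun s => expNeg (cumul a s) *
          (δ s * valueAt (fun s => a s + δ s) G B t s)) t = pathValue a G B t := by
  set a' : ℝ≥0 → ℝ≥0∞ := fun s => a s + δ s with ha'
  set g : ℝ≥0 → ℝ≥0∞ := fun s => expNeg (cumul a' s) * G s with hg
  set κ : ℝ≥0 → ℝ≥0∞ := fun s => δ s * (expNeg (cumul δ s))⁻¹ with hκ
  have hgm : Measurable g := (measurable_expNeg_cumul a').mul hG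
  have hκm : Measurable κ := hδ.mul (measurable_expNeg_cumul δ).inv
  have hfin' : ∀ s : ℝ≥0∞, s ≤ t → cumul δ s ≠ ⊤ := fun s hs =>
    ne_top_of_le_ne_top hfin (cumul_mono δ hs)
  have hA : ∀ s : ℝ≥0∞, s ≤ t → expNeg (cumul a s) =
      (expNeg (cumul δ s))⁻¹ * expNeg (cumul a' s) := fun s hs => by
    rw [ha', cumul_fun_add ha, expNeg_add, mul_left_comm, ENNReal.inv_mul_cancel
      (expNeg_ne_zero (hfin' s hs)) (expNeg_ne_top _), mul_one]
  have h1 : cumul (fun s => expNeg (cumul a s) * (δ s * valueAt a' G B t s)) t =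
      cumul (fun s => κ s * (expNeg (cumul a' t) * B) +
        κ s * cumul (fun u => g (s + u)) (t - s)) t := by
    refine cumul_congr fun s hs => ?_
    have := discounted_valueAt a' G B hs.le
    calc expNeg (cumul a s) * (δ s * valueAt a' G B t s)
        = δ s * (expNeg (cumul δ s))⁻¹ * (expNeg (cumul a' s) * valueAt a' G B t s) := by
          rw [hA s hs.le]; ring
      _ = _ := by rw [this]; simp only [hκ, hg]; ring
  have hc : cumul (fun s => κ s * (expNeg (cumul a' t) * B)) t =
      cumul κ t * (expNeg (cumul a' t) * B) := lintegral_mul_const _ hκm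
  have h2 : cumul (fun s => g s + g s * cumul κ s) t =
      cumul (fun s => expNeg (cumul a s) * G s) t := by
    refine cumul_congr fun s hs => ?_
    have := one_add_cumul_mul_inv_expNeg hδ (hfin' s hs.le)
    calc g s + g s * cumul κ s = g s * (1 + cumul κ s) := by ring
      _ = _ := by rw [this, hA s hs.le]; simp only [hg]; ring
  have h3 := one_add_cumul_mul_inv_expNeg hδ hfin
  rw [cumul_fun_add hgm] at h2
  rw [h1, cumul_fun_add (hκm.mul_const _), hc, cumul_mul_cumul_add hκm hgm, pathValue, pathValue,
    ← h2, hA t le_rfl, ← h3]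
  ring

/-- The identity of `pathValue_rate_sub_aux` for the rewards up to an intermediate time `t`. -/
theorem pathValue_rate_sub {a δ G : ℝ≥0 → ℝ≥0∞} (ha : Measurable a) (hδ : Measurable δ)
    (hG : Measurable G) (B : ℝ≥0∞) {T : ℝ≥0∞} {t : ℝ≥0} (ht : (t : ℝ≥0∞) ≤ T)
    (hfin : cumul δ t ≠ ⊤) :
    pathValue (fun s => a s + δ s) G B T +
        cumul (fun s => expNeg (cumul a s) *
          (δ s * valueAt (fun s => a s + δ s) G B T s)) t =
      cumul (fun s => expNeg (cumul a s) * G s) t +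
        expNeg (cumul a t) * valueAt (fun s => a s + δ s) G B T t := by
  have := pathValue_rate_sub_aux ha hδ hG (valueAt (fun s => a s + δ s) G B T t) hfin
  rw [← pathValue_eq_valueAt _ _ _ ht] at this
  rw [← pathValue, ← this]
  congr 1
  refine cumul_congr fun s hs => ?_
  rw [valueAt_eq_valueAt _ _ _ (ENNReal.coe_le_coe.1 hs.le) ht]

/-- The value satisfies the linear differential equation `V' = a V - G` in integrated form. -/
theorem pathValue_add_cumul_mul_valueAt {a G : ℝ≥0 → ℝ≥0∞} (ha : Measurable a) (hG : Measurable G)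
    (B : ℝ≥0∞) {T : ℝ≥0∞} {t : ℝ≥0} (ht : (t : ℝ≥0∞) ≤ T) (hfin : cumul a t ≠ ⊤) :
    pathValue a G B T + cumul (fun s => a s * valueAt a G B T s) t =
      cumul G t + valueAt a G B T t := by
  have := pathValue_rate_sub (a := fun _ => 0) measurable_const ha hG B ht hfin
  simpa [cumul] using this

/-! ### Measurable families of relaxed paths -/

section RelaxedPaths

variable {𝕌 : Type*} [MetricSpace 𝕌] [CompactSpace 𝕌] [MeasurableSpace 𝕌] [BorelSpace 𝕌]

theorem stronglyMeasurable_eval {Ω : Type*} [MeasurableSpace Ω] {g : Ω → C(𝕌, ℝ)} {v : Ω → 𝕌}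
    (hg : StronglyMeasurable g) (hv : Measurable v) : StronglyMeasurable fun ω => g ω (v ω) := by
  have h : StronglyMeasurable fun ω => (g ω, v ω) := hg.prodMk hv.stronglyMeasurable
  have he : Continuous fun p : C(𝕌, ℝ) × 𝕌 => p.1 p.2 := continuous_eval
  exact he.comp_stronglyMeasurable h

theorem RelaxedPath.aestronglyMeasurable_integral {g : ℝ≥0 → C(𝕌, ℝ)}
    (hg : AEStronglyMeasurable g timeMeasure) (μ : RelaxedPath 𝕌) :
    AEStronglyMeasurable (fun t => ∫ u, g t u ∂(μ.1 t : Measure 𝕌)) timeMeasure := by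
  obtain ⟨ν, hν, hae⟩ := μ.2
  let κ : Kernel ℝ≥0 𝕌 := ⟨fun t => (ν t).1, measurable_subtype_coe.comp hν⟩
  have : IsMarkovKernel κ := ⟨fun t => (ν t).2⟩
  have h : StronglyMeasurable fun t => ∫ u, hg.mk g t u ∂(κ t) := by
    refine StronglyMeasurable.integral_kernel_prod_right (f := fun t u => hg.mk g t u) ?_
    exact stronglyMeasurable_eval (hg.stronglyMeasurable_mk.comp_measurable measurable_fst)
      measurable_snd
  refine ⟨_, h, ?_⟩
  filter_upwards [hg.ae_eq_mk, hae] with t h1 h2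
  rw [h1, h2]
  rfl

theorem norm_integral_le_norm (g : C(𝕌, ℝ)) (P : ProbabilityMeasure 𝕌) :
    ‖∫ u, g u ∂(P : Measure 𝕌)‖ ≤ ‖g‖ := by
  have := norm_integral_le_of_norm_le_const (μ := (P : Measure 𝕌)) (f := g) (C := ‖g‖)
    (ae_of_all _ g.norm_coe_le_norm)
  simpa using this

theorem RelaxedPath.integrable_integral {g : ℝ≥0 → C(𝕌, ℝ)} (hg : Integrable g timeMeasure)
    (μ : RelaxedPath 𝕌) :
    Integrable (fun t => ∫ u, g t u ∂(μ.1 t : Measure 𝕌)) timeMeasure :=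
  hg.norm.mono' (μ.aestronglyMeasurable_integral hg.1)
    (ae_of_all _ fun t => norm_integral_le_norm (g t) (μ.1 t))

theorem RelaxedPath.dist_pairing_le {g g' : ℝ≥0 → C(𝕌, ℝ)} (hg : Integrable g timeMeasure)
    (hg' : Integrable g' timeMeasure) (μ : RelaxedPath 𝕌) :
    dist (RelaxedPath.pairing g μ) (RelaxedPath.pairing g' μ) ≤
      ∫ t, ‖g t - g' t‖ ∂timeMeasure := by
  rw [RelaxedPath.pairing, RelaxedPath.pairing, dist_eq_norm,
    ← integral_sub (μ.integrable_integral hg) (μ.integrable_integral hg')]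
  refine norm_integral_le_of_norm_le (hg.sub hg').norm (ae_of_all _ fun t => ?_)
  have hi : ∀ f : C(𝕌, ℝ), Integrable f (μ.1 t : Measure 𝕌) := fun f =>
    f.continuous.integrable_of_hasCompactSupport (HasCompactSupport.of_compactSpace _)
  rw [← integral_sub (hi _) (hi _)]
  exact norm_integral_le_norm (g t - g' t) (μ.1 t)

/-- Countably many pairings determine the weak-star topology, as `L¹(ℝ₊; C(𝕌))` is separable. -/
theorem RelaxedPath.exists_isInducing_pairing :
    ∃ g : ℕ → ℝ≥0 → C(𝕌, ℝ), (∀ k, Integrable (g k) timeMeasure) ∧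
      IsInducing fun (μ : RelaxedPath 𝕌) k => RelaxedPath.pairing (g k) μ := by
  have : Fact ((1 : ℝ≥0∞) ≠ ⊤) := ⟨ENNReal.one_ne_top⟩
  let d : ℕ → Lp C(𝕌, ℝ) 1 timeMeasure := TopologicalSpace.denseSeq _
  have hd : ∀ k, Integrable (d k) timeMeasure := fun k => L1.integrable_coeFn (d k)
  refine ⟨fun k => d k, hd, ⟨le_antisymm ?_ ?_⟩⟩
  · rw [← continuous_iff_le_induced]
    refine continuous_pi fun k => ?_
    rw [continuous_iff_le_induced]
    exact iInf_le (fun g : {g : ℝ≥0 → C(𝕌, ℝ) // Integrable g timeMeasure} =>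
      TopologicalSpace.induced (RelaxedPath.pairing g.1) inferInstance) ⟨d k, hd k⟩
  · refine le_iInf fun g => ?_
    rw [← continuous_iff_le_induced]
    let τ : TopologicalSpace (RelaxedPath 𝕌) :=
      TopologicalSpace.induced (fun μ k => RelaxedPath.pairing (d k) μ) inferInstance
    refine @continuous_of_uniform_approx_of_continuous _ _ τ _ _ fun u hu => ?_
    obtain ⟨ε, hε, hεu⟩ := Metric.mem_uniformity_dist.1 hu
    obtain ⟨k, hk⟩ := (TopologicalSpace.denseRange_denseSeq
      (Lp C(𝕌, ℝ) 1 timeMeasure)).exists_dist_lt (g.2.toL1 g.1) hε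
    refine ⟨RelaxedPath.pairing (d k), ?_, fun μ => hεu ?_⟩
    · have h1 : @Continuous _ _ τ _ fun μ k => RelaxedPath.pairing (d k : ℝ≥0 → C(𝕌, ℝ)) μ :=
        continuous_induced_dom
      exact (continuous_apply k).comp h1
    · refine (RelaxedPath.dist_pairing_le g.2 (hd k) μ).trans_lt (lt_of_eq_of_lt ?_ hk)
      rw [dist_eq_norm, L1.norm_eq_integral_norm]
      refine integral_congr_ae ?_
      filter_upwards [Lp.coeFn_sub (g.2.toL1 g.1) (d k), g.2.coeFn_toL1] with t h1 h2
      change ‖g.1 t - d k t‖ = ‖(g.2.toL1 g.1 - d k : Lp C(𝕌, ℝ) 1 timeMeasure) t‖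
      rw [h1, Pi.sub_apply, h2]

/-- The Borel structure of the relaxed paths is generated by the pairings. -/
theorem RelaxedPath.measurable_of_pairing {Ω : Type*} [MeasurableSpace Ω] {F : Ω → RelaxedPath 𝕌}
    (hF : ∀ g : ℝ≥0 → C(𝕌, ℝ), Integrable g timeMeasure →
      Measurable fun ω => RelaxedPath.pairing g (F ω)) : Measurable F := by
  obtain ⟨g, hg, htop⟩ := RelaxedPath.exists_isInducing_pairing (𝕌 := 𝕌)
  have hb : borel (RelaxedPath 𝕌) =
      MeasurableSpace.comap (fun μ k => RelaxedPath.pairing (g k) μ) inferInstance := by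
    rw [htop.eq_induced, borel_comap, ← BorelSpace.measurable_eq]
  intro S hS
  change MeasurableSet[borel (RelaxedPath 𝕌)] S at hS
  rw [hb] at hS
  obtain ⟨S', hS', rfl⟩ := hS
  have : Measurable fun ω k => RelaxedPath.pairing (g k) (F ω) :=
    measurable_pi_lambda _ fun k => hF (g k) (hg k)
  exact this hS'

/-- A jointly measurable family of ordinary paths is a measurable family of relaxed paths. -/
theorem OrdinaryControl.measurable_of_uncurry {Ω : Type*} [MeasurableSpace Ω]
    {F : Ω → OrdinaryControl 𝕌} (hp : Measurable fun q : Ω × ℝ≥0 => (F q.1).path q.2)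
    (hb : Measurable fun ω => (F ω).bdry) : Measurable F := by
  rw [measurable_iff_comap_le]
  rintro _ ⟨_, ⟨S, hS, rfl⟩, rfl⟩
  have : Measurable fun ω => (F ω).toRelaxed := by
    refine Measurable.prodMk ?_ (measurable_diracProba_map.comp hb)
    refine RelaxedPath.measurable_of_pairing fun g hg => ?_
    have h : ∀ ω, RelaxedPath.pairing g (F ω).toRelaxed.1 =
        ∫ t, hg.1.mk g t ((F ω).path t) ∂timeMeasure := fun ω => by
      refine integral_congr_ae ?_
      -- a strongly measurable version of `g` makes the pairing jointly measurable
      filter_upwards [hg.1.ae_eq_mk] with t ht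
      rw [← ht]
      exact integral_dirac _ _
    have hfun : (fun ω => RelaxedPath.pairing g (F ω).toRelaxed.1) =
        fun ω => ∫ t, hg.1.mk g t ((F ω).path t) ∂timeMeasure := funext h
    change Measurable fun ω => RelaxedPath.pairing g (F ω).toRelaxed.1
    rw [hfun]
    refine (StronglyMeasurable.integral_prod_right
      (f := fun ω t => hg.1.mk g t ((F ω).path t)) ?_).measurable
    exact stronglyMeasurable_eval (hg.1.stronglyMeasurable_mk.comp_measurable measurable_snd) hp
  exact this hS

end RelaxedPaths

/-! ### Regularity of discounted values -/

theorem measurable_cumul_param {Ω : Type*} [MeasurableSpace Ω] {a : Ω → ℝ≥0 → ℝ≥0∞}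
    (ha : Measurable (Function.uncurry a)) {T : Ω → ℝ≥0∞} (hT : Measurable T) :
    Measurable fun ω => cumul (a ω) (T ω) := by
  have h : ∀ ω, cumul (a ω) (T ω) = ∫⁻ s, {p : Ω × ℝ≥0 | (p.2 : ℝ≥0∞) < T p.1}.indicator
      (Function.uncurry a) (ω, s) ∂timeMeasure := fun ω => by
    rw [cumul, ← lintegral_indicator (measurableSet_coe_lt _)]
    rfl
  simp only [h]
  refine Measurable.lintegral_prod_right' (ha.indicator ?_)
  exact measurableSet_lt measurable_snd.coe_nnreal_ennreal (hT.comp measurable_fst)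

theorem measurable_pathValue_param {Ω : Type*} [MeasurableSpace Ω] {a G : Ω → ℝ≥0 → ℝ≥0∞}
    (ha : Measurable (Function.uncurry a)) (hG : Measurable (Function.uncurry G)) {B T : Ω → ℝ≥0∞}
    (hB : Measurable B) (hT : Measurable T) :
    Measurable fun ω => pathValue (a ω) (G ω) (B ω) (T ω) := by
  have h1 : Measurable fun p : Ω × ℝ≥0 => cumul (a p.1) p.2 :=
    measurable_cumul_param (a := fun p : Ω × ℝ≥0 => a p.1)
      (ha.comp (measurable_fst.fst.prodMk measurable_snd)) measurable_snd.coe_nnreal_ennreal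
  refine Measurable.add (measurable_cumul_param (a := fun ω s => expNeg (cumul (a ω) s) * G ω s)
    ((measurable_expNeg.comp h1).mul hG) hT) ?_
  exact (measurable_expNeg.comp (measurable_cumul_param ha hT)).mul hB

theorem measurable_valueAt {a G : ℝ≥0 → ℝ≥0∞} (ha : Measurable a) (hG : Measurable G)
    (B T : ℝ≥0∞) : Measurable (valueAt a G B T) := by
  refine measurable_pathValue_param (a := fun t s => a (t + s)) (G := fun t s => G (t + s))
    ?_ ?_ measurable_const (measurable_const.sub measurable_coe_nnreal_ennreal)
  · exact ha.comp (measurable_fst.add measurable_snd)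
  · exact hG.comp (measurable_fst.add measurable_snd)

theorem pathValue_congr_ae {a a' G G' : ℝ≥0 → ℝ≥0∞} {B B' T : ℝ≥0∞}
    (ha : ∀ᵐ s : ℝ≥0 ∂timeMeasure, (s : ℝ≥0∞) < T → a s = a' s)
    (hG : ∀ᵐ s : ℝ≥0 ∂timeMeasure, (s : ℝ≥0∞) < T → G s = G' s)
    (hB : expNeg (cumul a' T) * B = expNeg (cumul a' T) * B') :
    pathValue a G B T = pathValue a' G' B' T := by
  have h : ∀ s : ℝ≥0∞, s ≤ T → cumul a s = cumul a' s := fun s hs =>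
    cumul_congr_ae (ha.mono fun u hu hus => hu (hus.trans_le hs))
  rw [pathValue, pathValue, h T le_rfl, hB, cumul_congr_ae (hG.mono fun s hs hsT => by
    rw [h s hsT.le, hs hsT])]

theorem pathValue_mono_ae {a G G' : ℝ≥0 → ℝ≥0∞} {B B' T : ℝ≥0∞}
    (hG : ∀ᵐ s : ℝ≥0 ∂timeMeasure, (s : ℝ≥0∞) < T → G s ≤ G' s)
    (hB : expNeg (cumul a T) * B ≤ expNeg (cumul a T) * B') :
    pathValue a G B T ≤ pathValue a G' B' T := by
  refine add_le_add (setLIntegral_mono_ae' (measurableSet_coe_lt T) ?_) hB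
  exact hG.mono fun s hs hsT => mul_le_mul_right (hs hsT) _

theorem pathValue_iSup {a : ℝ≥0 → ℝ≥0∞} {G : ℕ → ℝ≥0 → ℝ≥0∞} (hG : ∀ n, Measurable (G n))
    (hmono : Monotone G) (B T : ℝ≥0∞) :
    pathValue a (fun s => ⨆ n, G n s) B T = ⨆ n, pathValue a (G n) B T := by
  simp only [pathValue, ← ENNReal.iSup_add]
  congr 1
  simp only [ENNReal.mul_iSup]
  exact lintegral_iSup (fun n => (measurable_expNeg_cumul a).mul (hG n))
    fun m n hmn s => mul_le_mul_right (hmono hmn s) _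

theorem valueAt_ne_top {a G : ℝ≥0 → ℝ≥0∞} {B T : ℝ≥0∞} {t : ℝ≥0} (ht : (t : ℝ≥0∞) ≤ T)
    (hfin : cumul a t ≠ ⊤) (hV : pathValue a G B T ≠ ⊤) : valueAt a G B T t ≠ ⊤ := by
  intro h
  rw [pathValue_eq_valueAt a G B ht, pathValue, h, ENNReal.mul_top (expNeg_ne_zero hfin),
    add_top] at hV
  exact hV rfl

theorem cumul_reward_ne_top {a G : ℝ≥0 → ℝ≥0∞} {B T : ℝ≥0∞} (hfin : cumul a T ≠ ⊤)
    (hV : pathValue a G B T ≠ ⊤) : cumul G T ≠ ⊤ := by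
  have h : expNeg (cumul a T) * cumul G T ≤ pathValue a G B T := by
    rw [← cumul_const_mul _ (expNeg_ne_top _)]
    refine le_trans (cumul_le_cumul fun s hs => ?_) le_self_add
    exact mul_le_mul_left (expNeg_anti (cumul_mono a hs.le)) _
  intro htop
  rw [htop, ENNReal.mul_top (expNeg_ne_zero hfin), top_le_iff] at h
  exact hV h

theorem AbsolutelyContinuousOnInterval.congr_of_eqOn {f g : ℝ → ℝ} {a b : ℝ}
    (hf : AbsolutelyContinuousOnInterval f a b) (h : ∀ x ∈ uIcc a b, g x = f x) :
    AbsolutelyContinuousOnInterval g a b := by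
  rw [absolutelyContinuousOnInterval_iff] at hf ⊢
  intro ε hε
  obtain ⟨δ, hδ, H⟩ := hf ε hε
  refine ⟨δ, hδ, fun E hE hlen => ?_⟩
  rw [Finset.sum_congr rfl fun i hi => by rw [h _ (hE.1 i hi).1, h _ (hE.1 i hi).2]]
  exact H E hE hlen

theorem absolutelyContinuousOnInterval_cumul {b : ℝ≥0 → ℝ≥0∞} (hb : Measurable b) {t : ℝ≥0}
    (ht : cumul b t ≠ ⊤) :
    AbsolutelyContinuousOnInterval (fun s : ℝ => (cumul b s.toNNReal).toReal) 0 t := by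
  obtain ⟨hint, heq⟩ := cumul_eq_ofReal hb ht
  refine (hint.absolutelyContinuousOnInterval_intervalIntegral (c := 0) (by simp)).congr_of_eqOn
    fun x hx => ?_
  rw [uIcc_of_le (NNReal.coe_nonneg t)] at hx
  have h := heq x.toNNReal (Real.toNNReal_le_iff_le_coe.2 hx.2)
  rw [Real.coe_toNNReal x hx.1] at h
  rw [h, ENNReal.toReal_ofReal (intervalIntegral.integral_nonneg hx.1 fun _ _ =>
    ENNReal.toReal_nonneg)]

theorem valueAt_toReal_eq {a G : ℝ≥0 → ℝ≥0∞} (ha : Measurable a) (hG : Measurable G)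
    {B T : ℝ≥0∞} {t : ℝ≥0} (ht : (t : ℝ≥0∞) ≤ T) (hfin : cumul a t ≠ ⊤)
    (hV : pathValue a G B T ≠ ⊤) :
    cumul G t ≠ ⊤ ∧ cumul (fun s => a s * valueAt a G B T s) t ≠ ⊤ ∧
      (valueAt a G B T t).toReal = (pathValue a G B T).toReal +
        (cumul (fun s => a s * valueAt a G B T s) t).toReal - (cumul G t).toReal := by
  have h1 : cumul G t ≠ ⊤ := cumul_reward_ne_top hfin (by rwa [← pathValue_eq_valueAt a G B ht])
  have h2 := valueAt_ne_top ht hfin hV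
  have h := pathValue_add_cumul_mul_valueAt ha hG B ht hfin
  have h3 : cumul (fun s => a s * valueAt a G B T s) t ≠ ⊤ :=
    ne_top_of_le_ne_top (ENNReal.add_ne_top.2 ⟨h1, h2⟩) (h ▸ le_add_self)
  refine ⟨h1, h3, ?_⟩
  have := congrArg ENNReal.toReal h
  rw [ENNReal.toReal_add hV h3, ENNReal.toReal_add h1 h2] at this
  linarith

theorem absolutelyContinuousOnInterval_valueAt {a G : ℝ≥0 → ℝ≥0∞} (ha : Measurable a)
    (hG : Measurable G) {B T : ℝ≥0∞} {t : ℝ≥0} (ht : (t : ℝ≥0∞) ≤ T) (hfin : cumul a t ≠ ⊤)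
    (hV : pathValue a G B T ≠ ⊤) :
    AbsolutelyContinuousOnInterval (fun s : ℝ => (valueAt a G B T s.toNNReal).toReal) 0 t := by
  obtain ⟨h1, h2, -⟩ := valueAt_toReal_eq ha hG ht hfin hV
  have hm : Measurable fun s => a s * valueAt a G B T s := ha.mul (measurable_valueAt ha hG B T)
  have hconst : AbsolutelyContinuousOnInterval (fun _ : ℝ => (pathValue a G B T).toReal) 0 t :=
    (LipschitzWith.const _).lipschitzOnWith.absolutelyContinuousOnInterval
  refine ((hconst.add (absolutelyContinuousOnInterval_cumul hm h2)).sub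
    (absolutelyContinuousOnInterval_cumul hG h1)).congr_of_eqOn fun x hx => ?_
  rw [uIcc_of_le (NNReal.coe_nonneg t)] at hx
  have hle : (x.toNNReal : ℝ≥0∞) ≤ t :=
    ENNReal.coe_le_coe.2 (Real.toNNReal_le_iff_le_coe.2 hx.2)
  exact (valueAt_toReal_eq ha hG (hle.trans ht)
    (ne_top_of_le_ne_top hfin (cumul_mono a hle)) hV).2.2

theorem exists_tendsto_valueAt {a G : ℝ≥0 → ℝ≥0∞} (ha : Measurable a) (hG : Measurable G)
    {B : ℝ≥0∞} {T : ℝ≥0} (hT : T ≠ 0) (hfin : cumul a T ≠ ⊤) (hV : pathValue a G B T ≠ ⊤) :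
    ∃ l : ℝ, Tendsto (fun t : ℝ≥0 => (valueAt a G B T t).toReal) (𝓝[<] T) (𝓝 l) := by
  obtain ⟨h1, h2, -⟩ := valueAt_toReal_eq ha hG le_rfl hfin hV
  have hcoe : Tendsto (fun t : ℝ≥0 => (t : ℝ≥0∞)) (𝓝[<] T) (𝓝[<] (T : ℝ≥0∞)) := by
    refine tendsto_nhdsWithin_of_tendsto_nhds_of_eventually_within _
      ((ENNReal.continuous_coe.tendsto T).mono_left nhdsWithin_le_nhds) ?_
    filter_upwards [self_mem_nhdsWithin] with t ht
    exact ENNReal.coe_lt_coe.2 ht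
  have hlim : ∀ b : ℝ≥0 → ℝ≥0∞, cumul b T ≠ ⊤ →
      Tendsto (fun t : ℝ≥0 => (cumul b t).toReal) (𝓝[<] T) (𝓝 (cumul b T).toReal) := fun b hb =>
    (ENNReal.tendsto_toReal hb).comp ((tendsto_cumul b (by exact_mod_cast hT)).comp hcoe)
  refine ⟨_, (((tendsto_const_nhds (x := (pathValue a G B T).toReal)).add (hlim _ h2)).sub
    (hlim _ h1)).congr' ?_⟩
  filter_upwards [self_mem_nhdsWithin] with t ht
  have hle : (t : ℝ≥0∞) ≤ T := ENNReal.coe_le_coe.2 (le_of_lt ht)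
  exact (valueAt_toReal_eq ha hG hle (ne_top_of_le_ne_top hfin (cumul_mono a hle)) hV).2.2.symm

/-- If the running reward is `G + δ W`, where `W` is the value discounted at rate `a + δ`, then the
value is also that of the reward `G` discounted at the lower rate `a`. -/
theorem pathValue_eq_of_reward_eq {a δ G W m : ℝ≥0 → ℝ≥0∞} (ha : Measurable a) (hδ : Measurable δ)
    (hG : Measurable G) (hm : Measurable m) {B T : ℝ≥0∞} {t : ℝ≥0} (ht : (t : ℝ≥0∞) ≤ T)
    (hfin : cumul δ t ≠ ⊤)
    (hmW : ∀ s : ℝ≥0, (s : ℝ≥0∞) < T → m s = G s + δ s * W s)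
    (hW : ∀ s : ℝ≥0, (s : ℝ≥0∞) < T → W s = valueAt (fun s => a s + δ s) m B T s)
    (hV : pathValue (fun s => a s + δ s) m B T ≠ ⊤) :
    pathValue (fun s => a s + δ s) m B T = cumul (fun s => expNeg (cumul a s) * G s) t +
      expNeg (cumul a t) * valueAt (fun s => a s + δ s) m B T t := by
  set V := valueAt (fun s => a s + δ s) m B T
  have h := pathValue_rate_sub ha hδ hm B ht hfin
  have h1 : cumul (fun s => expNeg (cumul a s) * m s) t =
      cumul (fun s => expNeg (cumul a s) * G s) t +
        cumul (fun s => expNeg (cumul a s) * (δ s * V s)) t := by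
    have : Measurable fun s : ℝ≥0 => expNeg (cumul a s) * G s :=
      (measurable_expNeg_cumul a).mul hG
    rw [← cumul_fun_add this]
    refine cumul_congr fun s hs => ?_
    rw [hmW s (hs.trans_le ht), hW s (hs.trans_le ht), mul_add]
  have h2 : expNeg (cumul δ t) * cumul (fun s => expNeg (cumul a s) * m s) t ≤
      pathValue (fun s => a s + δ s) m B T := by
    rw [← cumul_const_mul _ (expNeg_ne_top _), pathValue]
    refine le_trans (le_trans (cumul_le_cumul fun s hs => ?_) (cumul_mono _ ht)) le_self_add
    rw [cumul_fun_add ha, expNeg_add, ← mul_assoc, mul_comm (expNeg (cumul a s))]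
    gcongr
    exact expNeg_anti (cumul_mono δ hs.le)
  have h3 : cumul (fun s => expNeg (cumul a s) * m s) t ≠ ⊤ := by
    intro htop
    rw [htop, ENNReal.mul_top (expNeg_ne_zero hfin), top_le_iff] at h2
    exact hV h2
  have h4 : cumul (fun s => expNeg (cumul a s) * (δ s * V s)) t ≠ ⊤ :=
    ne_top_of_le_ne_top h3 (h1 ▸ le_add_self)
  -- the charge for `δ V` occurs on both sides, and it is finite
  rw [h1, add_right_comm] at h
  exact (ENNReal.add_left_inj h4).1 h

/-! ### Exit from the open set along the flow -/

namespace ControlledPDMP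

variable {n : ℕ} {𝕌 : Type*} [MeasurableSpace 𝕌] (M : ControlledPDMP n 𝕌)

theorem measurableSet_E : MeasurableSet M.E := M.isOpen_E.measurableSet

theorem continuous_flow : Continuous fun p : ℝ≥0 × EuclideanSpace ℝ (Fin n) => M.φ p.1 p.2 :=
  M.φ.cont'

theorem measurable_flow : Measurable fun p : EuclideanSpace ℝ (Fin n) × ℝ≥0 => M.φ p.2 p.1 :=
  (M.continuous_flow.comp continuous_swap).measurable

theorem continuous_path (x : EuclideanSpace ℝ (Fin n)) : Continuous fun s : ℝ≥0 => M.φ s x :=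
  M.continuous_flow.comp (continuous_id.prodMk continuous_const)

theorem notMem_frontier {x : EuclideanSpace ℝ (Fin n)} (hx : x ∈ M.E) : x ∉ frontier M.E :=
  fun h => (M.isOpen_E.frontier_eq ▸ h).2 hx

theorem closure_eq : closure M.E = M.E ∪ frontier M.E := by
  rw [M.isOpen_E.frontier_eq, union_sdiff_cancel subset_closure]

theorem tstar_le_iff {x : EuclideanSpace ℝ (Fin n)} (hx : x ∈ M.E) (t : ℝ≥0) :
    M.tstar x ≤ t ↔ ∃ s ≤ t, M.φ s x ∈ frontier M.E := by
  constructor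
  · intro h
    have hclosed : IsClosed {s : ℝ≥0 | M.φ s x ∈ frontier M.E} :=
      isClosed_frontier.preimage (M.continuous_path x)
    have heq : {s : ℝ≥0 | 0 < s ∧ M.φ s x ∈ frontier M.E} = {s | M.φ s x ∈ frontier M.E} := by
      ext s
      refine and_iff_right_of_imp fun hs => pos_iff_ne_zero.2 ?_
      rintro rfl
      have hs' : M.φ 0 x ∈ frontier M.E := hs
      rw [M.φ.map_zero_apply] at hs'
      exact M.notMem_frontier hx hs'
    rw [tstar, heq] at h
    have hne : {s : ℝ≥0 | M.φ s x ∈ frontier M.E}.Nonempty := by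
      by_contra hcon
      rw [not_nonempty_iff_eq_empty] at hcon
      rw [hcon, image_empty, sInf_empty, top_le_iff] at h
      exact ENNReal.coe_ne_top h
    rw [sInf_image, ← ENNReal.coe_sInf hne, ENNReal.coe_le_coe] at h
    exact ⟨_, h, hclosed.csInf_mem hne (OrderBot.bddBelow _)⟩
  · rintro ⟨s, hs, hmem⟩
    have hs0 : s ≠ 0 := by
      rintro rfl
      rw [M.φ.map_zero_apply] at hmem
      exact M.notMem_frontier hx hmem
    exact (sInf_le (mem_image_of_mem _ (show s ∈ {t : ℝ≥0 | 0 < t ∧ M.φ t x ∈ frontier M.E} from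
      ⟨pos_iff_ne_zero.2 hs0, hmem⟩))).trans (ENNReal.coe_le_coe.2 hs)

/-- A trajectory is connected, so it stays in `E` until it meets the boundary. -/
theorem flow_mem_E {x : EuclideanSpace ℝ (Fin n)} (hx : x ∈ M.E) {t : ℝ≥0}
    (ht : (t : ℝ≥0∞) < M.tstar x) : M.φ t x ∈ M.E := by
  by_contra hcon
  have hpre : IsPreconnected ((fun s : ℝ≥0 => M.φ s x) '' Icc 0 t) :=
    isPreconnected_Icc.image _ (M.continuous_path x).continuousOn
  have hfree : ∀ s ∈ Icc 0 t, M.φ s x ∉ frontier M.E := fun s hs hfr =>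
    ht.not_ge ((M.tstar_le_iff hx t).2 ⟨s, hs.2, hfr⟩)
  obtain ⟨y, -, hyE, hyc⟩ := hpre M.E (closure M.E)ᶜ M.isOpen_E isClosed_closure.isOpen_compl
    (by
      rintro _ ⟨s, hs, rfl⟩
      by_contra hcon
      rw [mem_union, not_or, mem_compl_iff, not_not, M.closure_eq] at hcon
      exact hfree s hs (hcon.2.resolve_left hcon.1))
    ⟨x, ⟨0, by simp, M.φ.map_zero_apply x⟩, hx⟩
    ⟨_, ⟨t, by simp, rfl⟩, fun h => (M.closure_eq ▸ h).elim hcon (hfree t (by simp))⟩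
  exact hyc (subset_closure hyE)

theorem tstar_ne_zero {x : EuclideanSpace ℝ (Fin n)} (hx : x ∈ M.E) : M.tstar x ≠ 0 := by
  intro h
  obtain ⟨s, hs, hfr⟩ := (M.tstar_le_iff hx 0).1 (by rw [h]; simp)
  rw [le_zero_iff.1 hs, M.φ.map_zero_apply] at hfr
  exact M.notMem_frontier hx hfr

theorem flow_flow (s t : ℝ≥0) (x : EuclideanSpace ℝ (Fin n)) :
    M.φ t (M.φ s x) = M.φ (s + t) x := by
  rw [add_comm, M.φ.map_add]

theorem tstar_flow {x : EuclideanSpace ℝ (Fin n)} (hx : x ∈ M.E) {t : ℝ≥0}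
    (ht : (t : ℝ≥0∞) < M.tstar x) : M.tstar (M.φ t x) = M.tstar x - t := by
  refine ENNReal.eq_of_forall_le_nnreal_iff fun u => ?_
  rw [M.tstar_le_iff (M.flow_mem_E hx ht), tsub_le_iff_left, ← ENNReal.coe_add,
    M.tstar_le_iff hx]
  constructor
  · rintro ⟨s, hs, hfr⟩
    exact ⟨t + s, by gcongr, M.flow_flow t s x ▸ hfr⟩
  · rintro ⟨s, hs, hfr⟩
    have hts : t ≤ s := by
      by_contra! hcon
      exact ht.not_ge ((M.tstar_le_iff hx t).2 ⟨s, hcon.le, hfr⟩)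
    refine ⟨s - t, tsub_le_iff_left.2 hs, ?_⟩
    rwa [M.flow_flow, add_tsub_cancel_of_le hts]

theorem exitPoint_of_top {x : EuclideanSpace ℝ (Fin n)} (h : M.tstar x = ⊤) :
    M.exitPoint x = M.Δ := if_pos h

theorem exitPoint_of_ne_top {x : EuclideanSpace ℝ (Fin n)} (h : M.tstar x ≠ ⊤) :
    M.exitPoint x = M.φ (M.tstar x).toNNReal x := if_neg h

theorem exitPoint_flow {x : EuclideanSpace ℝ (Fin n)} (hx : x ∈ M.E) {t : ℝ≥0}
    (ht : (t : ℝ≥0∞) < M.tstar x) : M.exitPoint (M.φ t x) = M.exitPoint x := by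
  have h := M.tstar_flow hx ht
  by_cases htop : M.tstar x = ⊤
  · rw [M.exitPoint_of_top htop, M.exitPoint_of_top]
    rw [h, htop, ENNReal.top_sub_coe]
  · have htop' : M.tstar x - t ≠ ⊤ := ENNReal.sub_ne_top htop
    rw [M.exitPoint_of_ne_top htop, M.exitPoint_of_ne_top (h ▸ htop'), h, M.flow_flow]
    congr 1
    rw [← ENNReal.coe_inj, ENNReal.coe_add, ENNReal.coe_toNNReal htop', ENNReal.coe_toNNReal htop,
      add_tsub_cancel_of_le ht.le]

theorem exitPoint_mem_frontier {x : EuclideanSpace ℝ (Fin n)} (hx : x ∈ M.E)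
    (h : M.tstar x ≠ ⊤) : M.exitPoint x ∈ frontier M.E := by
  obtain ⟨s, hs, hfr⟩ := (M.tstar_le_iff hx (M.tstar x).toNNReal).1
    (by rw [ENNReal.coe_toNNReal h])
  have hge : (M.tstar x).toNNReal ≤ s := by
    rw [← ENNReal.coe_le_coe, ENNReal.coe_toNNReal h, M.tstar_le_iff hx]
    exact ⟨s, le_rfl, hfr⟩
  rw [M.exitPoint_of_ne_top h, le_antisymm hge hs]
  exact hfr

theorem exitPoint_mem_closure {x : EuclideanSpace ℝ (Fin n)} (hx : x ∈ M.E) :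
    M.exitPoint x ∈ closure M.E := by
  by_cases h : M.tstar x = ⊤
  · rw [M.exitPoint_of_top h]
    exact M.Δ_mem
  · exact frontier_subset_closure (M.exitPoint_mem_frontier hx h)

/-- The exit time, set to zero off `E`. -/
def exitTime : EuclideanSpace ℝ (Fin n) → ℝ≥0∞ := M.E.indicator M.tstar

theorem exitTime_of_mem {x : EuclideanSpace ℝ (Fin n)} (hx : x ∈ M.E) :
    M.exitTime x = M.tstar x := indicator_of_mem hx _

/-- The points from which the boundary is met by time `c` form a closed set: it is the projection of
a closed set along the compact interval `[0, c]`. -/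
theorem measurable_exitTime : Measurable M.exitTime := by
  refine measurable_of_Iic fun c => ?_
  rcases eq_or_ne c ⊤ with rfl | hc
  · simp
  lift c to ℝ≥0 using hc
  have hclosed : IsClosed {x | ∃ s ≤ c, M.φ s x ∈ frontier M.E} := by
    have : {x | ∃ s ≤ c, M.φ s x ∈ frontier M.E} =
        Prod.fst '' {p : EuclideanSpace ℝ (Fin n) × Icc (0 : ℝ≥0) c |
          M.φ p.2 p.1 ∈ frontier M.E} := by
      ext x
      constructor
      · rintro ⟨s, hs, h⟩
        exact ⟨(x, ⟨s, zero_le, hs⟩), h, rfl⟩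
      · rintro ⟨⟨y, s⟩, h, rfl⟩
        exact ⟨s, s.2.2, h⟩
    rw [this]
    refine isClosedMap_fst_of_compactSpace _ (isClosed_frontier.preimage ?_)
    exact M.continuous_flow.comp ((continuous_subtype_val.comp continuous_snd).prodMk continuous_fst)
  have : M.exitTime ⁻¹' Iic (c : ℝ≥0∞) =
      M.Eᶜ ∪ {x | ∃ s ≤ c, M.φ s x ∈ frontier M.E} ∩ M.E := by
    ext x
    by_cases hx : x ∈ M.E
    · simp only [mem_preimage, M.exitTime_of_mem hx, mem_Iic, M.tstar_le_iff hx, mem_union,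
        mem_compl_iff, hx, not_true_eq_false, false_or, mem_inter_iff, and_true]
      rfl
    · simp [exitTime, hx]
  rw [this]
  exact M.measurableSet_E.compl.union (hclosed.measurableSet.inter M.measurableSet_E)

/-- A globally Borel version of the exit point. -/
def exitPointBorel (x : EuclideanSpace ℝ (Fin n)) : EuclideanSpace ℝ (Fin n) :=
  open Classical in if M.exitTime x = ⊤ then M.Δ else M.φ (M.exitTime x).toNNReal x

theorem exitPointBorel_of_mem {x : EuclideanSpace ℝ (Fin n)} (hx : x ∈ M.E) :
    M.exitPointBorel x = M.exitPoint x := by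
  rw [exitPointBorel, exitPoint, M.exitTime_of_mem hx]

theorem measurable_exitPointBorel : Measurable M.exitPointBorel := by
  refine Measurable.ite (M.measurable_exitTime (measurableSet_singleton ⊤)) measurable_const ?_
  exact M.measurable_flow.comp (measurable_id.prodMk M.measurable_exitTime.ennreal_toNNReal)

end ControlledPDMP

namespace ControlledPDMP

variable {n : ℕ} {𝕌 : Type*} [MetricSpace 𝕌] [CompactSpace 𝕌] [MeasurableSpace 𝕌] [BorelSpace 𝕌]
variable (M : ControlledPDMP n 𝕌)

/-! ### Minimization over the feasible actions -/

/-- The pairs of a state in `S` and an action feasible at it. -/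
def graphOn (S : Set (EuclideanSpace ℝ (Fin n))) : Set (EuclideanSpace ℝ (Fin n) × 𝕌) :=
  {p | p.1 ∈ S ∧ p.2 ∈ M.U p.1}

/-- The minimum of `g` over the actions feasible at `x`; it is `∞` if `x ∉ S`. -/
def minOn (S : Set (EuclideanSpace ℝ (Fin n))) (g : EuclideanSpace ℝ (Fin n) × 𝕌 → ℝ≥0∞)
    (x : EuclideanSpace ℝ (Fin n)) : ℝ≥0∞ :=
  ⨅ a ∈ {a | (x, a) ∈ M.graphOn S}, g (x, a)

variable {M} {S : Set (EuclideanSpace ℝ (Fin n))} {g : EuclideanSpace ℝ (Fin n) × 𝕌 → ℝ≥0∞}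

theorem section_graphOn {x : EuclideanSpace ℝ (Fin n)} (hx : x ∈ S) :
    {a | (x, a) ∈ M.graphOn S} = M.U x := by
  ext a
  exact and_iff_right hx

theorem section_graphOn_of_notMem {x : EuclideanSpace ℝ (Fin n)} (hx : x ∉ S) :
    {a | (x, a) ∈ M.graphOn S} = ∅ :=
  eq_empty_of_forall_notMem fun _ h => hx h.1

theorem minOn_of_mem {x : EuclideanSpace ℝ (Fin n)} (hx : x ∈ S) :
    M.minOn S g x = ⨅ a ∈ M.U x, g (x, a) := by
  rw [minOn, section_graphOn hx]

theorem minOn_le {x : EuclideanSpace ℝ (Fin n)} (hx : x ∈ S) {a : 𝕌} (ha : a ∈ M.U x) :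
    M.minOn S g x ≤ g (x, a) := iInf₂_le a ⟨hx, ha⟩

theorem measurableSet_graphOn (hM : M.Assumptions) (hS : MeasurableSet S) (hSc : S ⊆ closure M.E) :
    MeasurableSet (M.graphOn S) := by
  have : M.graphOn S = {p : EuclideanSpace ℝ (Fin n) × 𝕌 | p.1 ∈ closure M.E ∧ p.2 ∈ M.U p.1} ∩
      Prod.fst ⁻¹' S := by
    ext p
    exact ⟨fun h => ⟨⟨hSc h.1, h.2⟩, h.1⟩, fun h => ⟨h.2, h.1.2⟩⟩
  rw [this]
  exact hM.measurableSet_graph.inter (measurable_fst hS)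

theorem isClosed_section_graphOn (hM : M.Assumptions) (hSc : S ⊆ closure M.E)
    (x : EuclideanSpace ℝ (Fin n)) : IsClosed {a | (x, a) ∈ M.graphOn S} := by
  by_cases hx : x ∈ S
  · rw [section_graphOn hx]
    exact (hM.isCompact_U x (hSc hx)).isClosed
  · rw [section_graphOn_of_notMem hx]
    exact isClosed_empty

theorem lowerSemicontinuousOn_section
    (hl : ∀ x ∈ S, LowerSemicontinuousOn (fun a => g (x, a)) (M.U x))
    (x : EuclideanSpace ℝ (Fin n)) :
    LowerSemicontinuousOn (fun a => g (x, a)) {a | (x, a) ∈ M.graphOn S} := by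
  by_cases hx : x ∈ S
  · rw [section_graphOn hx]
    exact hl x hx
  · rw [section_graphOn_of_notMem hx]
    exact fun a ha => absurd ha (notMem_empty a)

theorem measurable_minOn (hM : M.Assumptions) (hS : MeasurableSet S) (hSc : S ⊆ closure M.E)
    (hg : Measurable g) (hl : ∀ x ∈ S, LowerSemicontinuousOn (fun a => g (x, a)) (M.U x)) :
    Measurable (M.minOn S g) :=
  measurable_biInf_section (measurableSet_graphOn hM hS hSc) (isClosed_section_graphOn hM hSc) hg
    (lowerSemicontinuousOn_section hl)

/-- Minimization over a compact set of actions commutes with increasing limits of lower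
semicontinuous functions. -/
theorem minOn_iSup (hM : M.Assumptions) (hSc : S ⊆ closure M.E)
    {g : ℕ → EuclideanSpace ℝ (Fin n) × 𝕌 → ℝ≥0∞} (hmono : Monotone g)
    {x : EuclideanSpace ℝ (Fin n)} (hx : x ∈ S)
    (hl : ∀ k, LowerSemicontinuousOn (fun a => g k (x, a)) (M.U x)) :
    M.minOn S (fun p => ⨆ k, g k p) x = ⨆ k, M.minOn S (g k) x := by
  have hcomp := hM.isCompact_U x (hSc hx)
  have hne := M.U_nonempty x (hSc hx)
  refine le_antisymm ?_ (iSup_le fun k => ?_)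
  · set c := ⨆ k, M.minOn S (g k) x
    have hmin : ∀ k, ∃ a ∈ M.U x, g k (x, a) ≤ c := fun k => by
      obtain ⟨a, ha, hmin⟩ := (hl k).exists_isMinOn hne hcomp
      refine ⟨a, ha, le_trans ?_ (le_iSup (fun k => M.minOn S (g k) x) k)⟩
      rw [minOn_of_mem hx]
      exact le_iInf₂ fun b hb => hmin hb
    have hK : ∀ k, IsCompact (M.U x ∩ (fun a => g k (x, a)) ⁻¹' Iic c) := fun k =>
      (hl k).isCompact_inter_preimage_Iic hcomp c
    obtain ⟨a, ha⟩ := IsCompact.nonempty_iInter_of_sequence_nonempty_isCompact_isClosed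
      (fun k => M.U x ∩ (fun a => g k (x, a)) ⁻¹' Iic c)
      (fun k a ha => ⟨ha.1, le_trans (hmono (Nat.le_succ k) _) ha.2⟩)
      (fun k => (hmin k).imp fun a ha => ha) (hK 0) fun k => (hK k).isClosed
    rw [mem_iInter] at ha
    exact (minOn_le hx (ha 0).1).trans (iSup_le fun k => (ha k).2)
  · rw [minOn_of_mem hx, minOn_of_mem hx]
    exact iInf₂_mono fun a _ => le_iSup (fun k => g k (x, a)) k

theorem measurableSet_U (hM : M.Assumptions) {x : EuclideanSpace ℝ (Fin n)}
    (hx : x ∈ closure M.E) : MeasurableSet (M.U x) :=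
  (hM.isCompact_U x hx).isClosed.measurableSet

theorem ae_mem_U (hM : M.Assumptions) {x : EuclideanSpace ℝ (Fin n)} (hx : x ∈ closure M.E)
    {P : ProbabilityMeasure 𝕌} (h : (P : Measure 𝕌) (M.U x) = 1) :
    ∀ᵐ a ∂(P : Measure 𝕌), a ∈ M.U x :=
  mem_ae_iff.2 ((prob_compl_eq_zero_iff (measurableSet_U hM hx)).2 h)

theorem minOn_le_lintegral (hM : M.Assumptions) (hSc : S ⊆ closure M.E)
    {x : EuclideanSpace ℝ (Fin n)} (hx : x ∈ S) {P : ProbabilityMeasure 𝕌}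
    (h : (P : Measure 𝕌) (M.U x) = 1) :
    M.minOn S g x ≤ ∫⁻ a, g (x, a) ∂(P : Measure 𝕌) := by
  calc M.minOn S g x = ∫⁻ _, M.minOn S g x ∂(P : Measure 𝕌) := by simp
    _ ≤ _ := lintegral_mono_ae ((ae_mem_U hM (hSc hx) h).mono fun a ha => minOn_le hx ha)

/-! ### The maximal jump rate -/

variable (M) in
/-- The maximal jump rate at a point of `E`, as a function that is Borel on the whole space. -/
def rateSup (x : EuclideanSpace ℝ (Fin n)) : ℝ≥0∞ :=
  (M.minOn M.E (fun p => (M.lam p : ℝ≥0∞)⁻¹) x)⁻¹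

theorem rateSup_of_mem {x : EuclideanSpace ℝ (Fin n)} (hx : x ∈ M.E) :
    M.rateSup x = ⨆ a ∈ M.U x, (M.lam (x, a) : ℝ≥0∞) := by
  rw [rateSup, minOn_of_mem hx]
  simp only [ENNReal.inv_iInf, inv_inv]

theorem lam_le_rateSup {x : EuclideanSpace ℝ (Fin n)} (hx : x ∈ M.E) {a : 𝕌} (ha : a ∈ M.U x) :
    (M.lam (x, a) : ℝ≥0∞) ≤ M.rateSup x := by
  rw [rateSup_of_mem hx]
  exact le_iSup₂ (f := fun a (_ : a ∈ M.U x) => (M.lam (x, a) : ℝ≥0∞)) a ha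

theorem continuousOn_lam_coe (hM : M.Assumptions) {x : EuclideanSpace ℝ (Fin n)} (hx : x ∈ M.E) :
    ContinuousOn (fun a => (M.lam (x, a) : ℝ≥0∞)) (M.U x) :=
  ENNReal.continuous_coe.comp_continuousOn (hM.continuousOn_lam x hx)

theorem measurable_lam_coe : Measurable fun p => (M.lam p : ℝ≥0∞) :=
  M.measurable_lam.coe_nnreal_ennreal

theorem measurable_rateSup (hM : M.Assumptions) : Measurable M.rateSup := by
  refine (measurable_minOn hM M.measurableSet_E subset_closure measurable_lam_coe.inv
    fun x hx => ?_).inv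
  exact ((continuous_inv (G := ℝ≥0∞)).comp_continuousOn (continuousOn_lam_coe hM hx)).lowerSemicontinuousOn

theorem rateSup_ne_top (hM : M.Assumptions) {x : EuclideanSpace ℝ (Fin n)} (hx : x ∈ M.E) :
    M.rateSup x ≠ ⊤ := by
  obtain ⟨a, ha, hmax⟩ := (hM.isCompact_U x (subset_closure hx)).exists_isMaxOn
    (M.U_nonempty x (subset_closure hx)) (continuousOn_lam_coe hM hx)
  have : M.rateSup x ≤ M.lam (x, a) := by
    rw [rateSup_of_mem hx]
    exact iSup₂_le fun b hb => hmax hb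
  exact ne_top_of_le_ne_top ENNReal.coe_ne_top this

variable (M) in
/-- The maximal jump rate along the trajectory from `x`. -/
def rateSupPath (x : EuclideanSpace ℝ (Fin n)) (s : ℝ≥0) : ℝ≥0∞ := M.rateSup (M.φ s x)

theorem measurable_rateSupPath (hM : M.Assumptions) (x : EuclideanSpace ℝ (Fin n)) :
    Measurable (M.rateSupPath x) :=
  (measurable_rateSup hM).comp (M.continuous_path x).measurable

theorem cumul_rateSupPath_ne_top (hM : M.Assumptions) {x : EuclideanSpace ℝ (Fin n)} (hx : x ∈ M.E)
    {t : ℝ≥0} (ht : (t : ℝ≥0∞) ≤ M.tstar x) : cumul (M.rateSupPath x) t ≠ ⊤ := by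
  have h : ∀ T ≤ M.tstar x, cumul (M.rateSupPath x) T =
      ∫⁻ s in {s : ℝ≥0 | (s : ℝ≥0∞) < T},
        (⨆ a ∈ M.U (M.φ s x), (M.lam (M.φ s x, a) : ℝ≥0∞)) ∂timeMeasure := fun T hT =>
    cumul_congr fun s hs => rateSup_of_mem (M.flow_mem_E hx (hs.trans_le hT))
  rcases ht.lt_or_eq with hlt | heq
  · have := hM.rate_integrable x hx t hlt
    rw [h _ ht]
    simpa only [ENNReal.coe_lt_coe] using this.ne
  · rw [h _ ht, heq]
    exact (hM.rate_integrable_exit x hx (heq ▸ ENNReal.coe_lt_top)).ne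

/-- A trajectory that never leaves `E` is killed: the lower bound of the jump rates has an infinite
integral along it. -/
theorem exists_rate_lower_bound (hM : M.Assumptions) {x : EuclideanSpace ℝ (Fin n)} (hx : x ∈ M.E)
    (hT : M.tstar x = ⊤) :
    ∃ ξ : EuclideanSpace ℝ (Fin n) → ℝ≥0, (∀ y ∈ M.E, ∀ a ∈ M.U y, ξ y ≤ M.lam (y, a)) ∧
      cumul (fun s => ξ (M.φ s x)) ⊤ = ⊤ := by
  obtain ⟨ξ, -, hle, ⟨K, hK⟩, -⟩ := hM.lower_rate
  refine ⟨ξ, hle, ?_⟩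
  by_contra hfin
  have h := hK x hx
  rw [hT] at h
  set e := expNeg (cumul (fun s => ξ (M.φ s x)) ⊤)
  have he0 : e ≠ 0 := expNeg_ne_zero hfin
  have hbound : ∀ t : ℝ≥0, e * t ≤ K := fun t => by
    rw [← cumul_const]
    refine (cumul_mono (fun _ => e) le_top).trans (le_trans ?_ h)
    refine cumul_le_cumul fun s _ => expNeg_anti ?_
    simpa only [cumul, ENNReal.coe_lt_coe] using cumul_mono (fun s => (ξ (M.φ s x) : ℝ≥0∞))
      (show (s : ℝ≥0∞) ≤ ⊤ from le_top)
  lift e to ℝ≥0 using expNeg_ne_top _ with e'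
  have h1 := hbound ((K + 1) / e')
  rw [← ENNReal.coe_mul, ENNReal.coe_le_coe, mul_div_cancel₀ _ (by exact_mod_cast he0)] at h1
  exact absurd h1 (by simp)

/-- A rate that almost always exceeds every lower bound of the jump rates has an infinite integral
along a trajectory that never leaves `E`. -/
theorem cumul_eq_top_of_lam_le (hM : M.Assumptions) {x : EuclideanSpace ℝ (Fin n)} (hx : x ∈ M.E)
    (hT : M.tstar x = ⊤) {b : ℝ≥0 → ℝ≥0∞}
    (hb : ∀ᵐ s ∂timeMeasure, ∀ c : ℝ≥0,
      (∀ a ∈ M.U (M.φ s x), c ≤ M.lam (M.φ s x, a)) → (c : ℝ≥0∞) ≤ b s) : cumul b ⊤ = ⊤ := by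
  obtain ⟨ξ, hle, htop⟩ := exists_rate_lower_bound hM hx hT
  have h : cumul (fun s => ξ (M.φ s x)) ⊤ ≤ cumul b ⊤ :=
    setLIntegral_mono_ae' (measurableSet_coe_lt _) (hb.mono fun s hs hsT => hs _ fun a ha =>
      hle _ (M.flow_mem_E hx (hT ▸ hsT)) a ha)
  rwa [htop, top_le_iff] at h

/-! ### The one-stage problem with non-negative costs -/

variable (M) in
/-- The rate at which the control `Θ` discounts and jumps along the trajectory from `x`. -/
def controlRate (α : ℝ≥0) (x : EuclideanSpace ℝ (Fin n)) (Θ : RelaxedControl 𝕌) (s : ℝ≥0) : ℝ≥0∞ :=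
  α + ∫⁻ a, (M.lam (M.φ s x, a) : ℝ≥0∞) ∂(Θ.1.1 s : Measure 𝕌)

variable (M) in
/-- The one-stage cost of `Θ` for a non-negative running cost `c` and boundary cost `ψ`. -/
def stageCost (α : ℝ≥0) (c ψ : EuclideanSpace ℝ (Fin n) × 𝕌 → ℝ≥0∞)
    (x : EuclideanSpace ℝ (Fin n)) (Θ : RelaxedControl 𝕌) : ℝ≥0∞ :=
  pathValue (M.controlRate α x Θ) (fun s => ∫⁻ a, c (M.φ s x, a) ∂(Θ.1.1 s : Measure 𝕌))
    (∫⁻ a, ψ (M.exitPoint x, a) ∂(Θ.2 : Measure 𝕌)) (M.tstar x)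

variable (M) in
/-- The running cost of an action after uniformization: a jump is offered at the maximal rate, and
where the action jumps at a lower rate, the excess leaves the state unchanged, at the cost `v`. -/
def uniformizedCost (c : EuclideanSpace ℝ (Fin n) × 𝕌 → ℝ≥0∞)
    (v : EuclideanSpace ℝ (Fin n) → ℝ≥0∞) (p : EuclideanSpace ℝ (Fin n) × 𝕌) : ℝ≥0∞ :=
  c p + (M.rateSup p.1 - M.lam p) * v p.1

variable (M) in
/-- The uniformized Bellman operator: since every action is discounted at the same rate, minimizing
over controls amounts to minimizing at each point of the trajectory. -/
def bellman (α : ℝ≥0) (c ψ : EuclideanSpace ℝ (Fin n) × 𝕌 → ℝ≥0∞)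
    (v : EuclideanSpace ℝ (Fin n) → ℝ≥0∞) (x : EuclideanSpace ℝ (Fin n)) : ℝ≥0∞ :=
  pathValue (fun s => α + M.rateSupPath x s)
    (fun s => M.minOn M.E (M.uniformizedCost c v) (M.φ s x))
    (M.minOn (frontier M.E) ψ (M.exitPointBorel x)) (M.exitTime x)

variable (M) in
/-- The limit of value iteration from zero. -/
def value (α : ℝ≥0) (c ψ : EuclideanSpace ℝ (Fin n) × 𝕌 → ℝ≥0∞)
    (x : EuclideanSpace ℝ (Fin n)) : ℝ≥0∞ :=
  ⨆ k, (M.bellman α c ψ)^[k] 0 x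

variable {α : ℝ≥0} {c ψ : EuclideanSpace ℝ (Fin n) × 𝕌 → ℝ≥0∞}

/-- In `[0, ∞]`, `y ↦ y * ∞` is not continuous at `0`, but it is lower semicontinuous. -/
theorem lowerSemicontinuous_mul_const (b : ℝ≥0∞) : LowerSemicontinuous fun y : ℝ≥0∞ => y * b := by
  rcases eq_or_ne b ⊤ with rfl | hb
  · have : (fun y : ℝ≥0∞ => y * ⊤) = fun y => ⨆ k : ℕ, y * (k : ℝ≥0∞) := by
      funext y
      rw [← ENNReal.mul_iSup, ENNReal.iSup_natCast]
    rw [this]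
    exact lowerSemicontinuous_iSup fun k =>
      (ENNReal.continuous_mul_const (ENNReal.natCast_ne_top k)).lowerSemicontinuous
  · exact (ENNReal.continuous_mul_const hb).lowerSemicontinuous

theorem lowerSemicontinuousOn_uniformizedCost (hM : M.Assumptions)
    {x : EuclideanSpace ℝ (Fin n)} (hx : x ∈ M.E)
    (hc : LowerSemicontinuousOn (fun a => c (x, a)) (M.U x))
    (v : EuclideanSpace ℝ (Fin n) → ℝ≥0∞) :
    LowerSemicontinuousOn (fun a => M.uniformizedCost c v (x, a)) (M.U x) := by
  refine hc.add ?_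
  have h : ContinuousOn (fun a => M.rateSup x - M.lam (x, a)) (M.U x) :=
    (ENNReal.continuous_sub_left (rateSup_ne_top hM hx)).comp_continuousOn
      (continuousOn_lam_coe hM hx)
  exact fun a ha y hy => (h a ha).eventually (lowerSemicontinuous_mul_const (v x) _ y hy)

theorem measurable_uniformizedCost (hM : M.Assumptions) (hc : Measurable c)
    {v : EuclideanSpace ℝ (Fin n) → ℝ≥0∞} (hv : Measurable v) :
    Measurable (M.uniformizedCost c v) :=
  hc.add ((((measurable_rateSup hM).comp measurable_fst).sub measurable_lam_coe).mul
    (hv.comp measurable_fst))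

theorem measurable_minOn_uniformizedCost (hM : M.Assumptions) (hc : Measurable c)
    (hcl : ∀ x ∈ M.E, LowerSemicontinuousOn (fun a => c (x, a)) (M.U x))
    {v : EuclideanSpace ℝ (Fin n) → ℝ≥0∞} (hv : Measurable v) :
    Measurable (M.minOn M.E (M.uniformizedCost c v)) :=
  measurable_minOn hM M.measurableSet_E subset_closure (measurable_uniformizedCost hM hc hv)
    fun _ hx => lowerSemicontinuousOn_uniformizedCost hM hx (hcl _ hx) v

theorem measurable_bellman (hM : M.Assumptions) (hc : Measurable c)
    (hcl : ∀ x ∈ M.E, LowerSemicontinuousOn (fun a => c (x, a)) (M.U x)) (hψ : Measurable ψ)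
    (hψl : ∀ z ∈ frontier M.E, LowerSemicontinuousOn (fun a => ψ (z, a)) (M.U z))
    {v : EuclideanSpace ℝ (Fin n) → ℝ≥0∞} (hv : Measurable v) :
    Measurable (M.bellman α c ψ v) := by
  refine measurable_pathValue_param (a := fun x s => (α : ℝ≥0∞) + M.rateSupPath x s)
    (G := fun x s => M.minOn M.E (M.uniformizedCost c v) (M.φ s x)) ?_ ?_ ?_ M.measurable_exitTime
  · exact measurable_const.add ((measurable_rateSup hM).comp M.measurable_flow)
  · exact (measurable_minOn_uniformizedCost hM hc hcl hv).comp M.measurable_flow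
  · exact (measurable_minOn hM isClosed_frontier.measurableSet frontier_subset_closure hψ
      hψl).comp M.measurable_exitPointBorel

theorem measurable_iterate_bellman (hM : M.Assumptions) (hc : Measurable c)
    (hcl : ∀ x ∈ M.E, LowerSemicontinuousOn (fun a => c (x, a)) (M.U x)) (hψ : Measurable ψ)
    (hψl : ∀ z ∈ frontier M.E, LowerSemicontinuousOn (fun a => ψ (z, a)) (M.U z)) (k : ℕ) :
    Measurable ((M.bellman α c ψ)^[k] 0) := by
  induction k with
  | zero => exact measurable_const
  | succ k ih =>
    rw [Function.iterate_succ_apply']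
    exact measurable_bellman hM hc hcl hψ hψl ih

theorem measurable_value (hM : M.Assumptions) (hc : Measurable c)
    (hcl : ∀ x ∈ M.E, LowerSemicontinuousOn (fun a => c (x, a)) (M.U x)) (hψ : Measurable ψ)
    (hψl : ∀ z ∈ frontier M.E, LowerSemicontinuousOn (fun a => ψ (z, a)) (M.U z)) :
    Measurable (M.value α c ψ) :=
  .iSup fun k => measurable_iterate_bellman hM hc hcl hψ hψl k

theorem uniformizedCost_mono : Monotone (M.uniformizedCost c) := fun v v' h p => by
  unfold uniformizedCost
  gcongr
  exact h p.1

theorem bellman_mono : Monotone (M.bellman α c ψ) := fun v v' h x => by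
  refine pathValue_mono_ae (ae_of_all _ fun s _ => ?_) le_rfl
  exact iInf₂_mono fun a _ => uniformizedCost_mono h _

theorem iterate_bellman_mono : Monotone fun k => (M.bellman α c ψ)^[k] 0 :=
  monotone_nat_of_le_succ fun k => by
    rw [Function.iterate_succ_apply]
    exact bellman_mono.iterate k fun _ => bot_le

/-- The limit of value iteration is a fixed point of the Bellman operator. -/
theorem bellman_value (hM : M.Assumptions) (hc : Measurable c)
    (hcl : ∀ x ∈ M.E, LowerSemicontinuousOn (fun a => c (x, a)) (M.U x)) (hψ : Measurable ψ)
    (hψl : ∀ z ∈ frontier M.E, LowerSemicontinuousOn (fun a => ψ (z, a)) (M.U z))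
    {x : EuclideanSpace ℝ (Fin n)} (hx : x ∈ M.E) :
    M.bellman α c ψ (M.value α c ψ) x = M.value α c ψ x := by
  have hsup : ∀ p, M.uniformizedCost c (M.value α c ψ) p =
      ⨆ k, M.uniformizedCost c ((M.bellman α c ψ)^[k] 0) p := fun p => by
    simp only [uniformizedCost, value, ENNReal.mul_iSup, ENNReal.add_iSup]
  have hmono : Monotone fun k => M.uniformizedCost c ((M.bellman α c ψ)^[k] 0) :=
    uniformizedCost_mono.comp iterate_bellman_mono
  have hstep : M.bellman α c ψ (M.value α c ψ) x =
      ⨆ k, M.bellman α c ψ ((M.bellman α c ψ)^[k] 0) x := by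
    rw [bellman, show M.uniformizedCost c (M.value α c ψ) = fun p =>
      ⨆ k, M.uniformizedCost c ((M.bellman α c ψ)^[k] 0) p from funext hsup]
    simp only [bellman]
    rw [← pathValue_iSup]
    · refine pathValue_congr (fun s _ => rfl) (fun s hs => ?_) rfl
      rw [M.exitTime_of_mem hx] at hs
      have hy := M.flow_mem_E hx hs
      exact minOn_iSup hM subset_closure hmono hy fun k =>
        lowerSemicontinuousOn_uniformizedCost hM hy (hcl _ hy) _
    · exact fun k => (measurable_minOn_uniformizedCost hM hc hcl
        (measurable_iterate_bellman hM hc hcl hψ hψl k)).comp (M.continuous_path x).measurable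
    · exact fun k l hkl s => iInf₂_mono fun a _ => hmono hkl _
  rw [hstep]
  simp only [← Function.iterate_succ_apply' (M.bellman α c ψ)]
  exact le_antisymm (iSup_le fun k => le_iSup (fun k => (M.bellman α c ψ)^[k] 0 x) (k + 1))
    (iSup_mono fun k => iterate_bellman_mono (Nat.le_succ k) x)

/-- Along a trajectory, the limit of value iteration is the value of a running reward discounted at
the maximal rate. -/
theorem value_flow (hM : M.Assumptions) (hc : Measurable c)
    (hcl : ∀ x ∈ M.E, LowerSemicontinuousOn (fun a => c (x, a)) (M.U x)) (hψ : Measurable ψ)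
    (hψl : ∀ z ∈ frontier M.E, LowerSemicontinuousOn (fun a => ψ (z, a)) (M.U z))
    {x : EuclideanSpace ℝ (Fin n)} (hx : x ∈ M.E) {t : ℝ≥0} (ht : (t : ℝ≥0∞) < M.tstar x) :
    M.value α c ψ (M.φ t x) = valueAt (fun s => α + M.rateSupPath x s)
      (fun s => M.minOn M.E (M.uniformizedCost c (M.value α c ψ)) (M.φ s x))
      (M.minOn (frontier M.E) ψ (M.exitPoint x)) (M.tstar x) t := by
  have hy := M.flow_mem_E hx ht
  rw [← bellman_value hM hc hcl hψ hψl hy, bellman, valueAt, M.exitTime_of_mem hy,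
    M.tstar_flow hx ht, M.exitPointBorel_of_mem hy, M.exitPoint_flow hx ht]
  simp only [rateSupPath, M.flow_flow]

theorem value_eq_pathValue (hM : M.Assumptions) (hc : Measurable c)
    (hcl : ∀ x ∈ M.E, LowerSemicontinuousOn (fun a => c (x, a)) (M.U x)) (hψ : Measurable ψ)
    (hψl : ∀ z ∈ frontier M.E, LowerSemicontinuousOn (fun a => ψ (z, a)) (M.U z))
    {x : EuclideanSpace ℝ (Fin n)} (hx : x ∈ M.E) :
    M.value α c ψ x = pathValue (fun s => α + M.rateSupPath x s)
      (fun s => M.minOn M.E (M.uniformizedCost c (M.value α c ψ)) (M.φ s x))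
      (M.minOn (frontier M.E) ψ (M.exitPoint x)) (M.tstar x) := by
  rw [← bellman_value hM hc hcl hψ hψl hx, bellman, M.exitTime_of_mem hx,
    M.exitPointBorel_of_mem hx]

/-! ### Value iteration bounds the cost of every control from below -/

theorem ae_feasible {x : EuclideanSpace ℝ (Fin n)} (hx : x ∈ M.E) {Θ : RelaxedControl 𝕌}
    (hΘ : Θ ∈ M.relaxedControls x) : ∀ᵐ s : ℝ≥0 ∂timeMeasure, (s : ℝ≥0∞) < M.tstar x →
      M.φ s x ∈ M.E ∧ (Θ.1.1 s : Measure 𝕌) (M.U (M.φ s x)) = 1 := by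
  filter_upwards [hΘ.1] with s hs hsT
  have := M.flow_mem_E hx hsT
  exact ⟨this, hs (subset_closure this)⟩

theorem measurable_lintegral_path {g : EuclideanSpace ℝ (Fin n) × 𝕌 → ℝ≥0∞} (hg : Measurable g)
    (x : EuclideanSpace ℝ (Fin n)) {μ : ℝ≥0 → ProbabilityMeasure 𝕌} (hμ : Measurable μ) :
    Measurable fun s => ∫⁻ a, g (M.φ s x, a) ∂(μ s : Measure 𝕌) := by
  let κ : Kernel ℝ≥0 𝕌 := ⟨fun s => (μ s).1, measurable_subtype_coe.comp hμ⟩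
  have : IsMarkovKernel κ := ⟨fun s => (μ s).2⟩
  exact Measurable.lintegral_kernel_prod_right' (κ := κ) (f := fun p : ℝ≥0 × 𝕌 => g (M.φ p.1 x, p.2))
    (hg.comp (((M.continuous_path x).measurable.comp measurable_fst).prodMk measurable_snd))

theorem measurable_controlRate (x : EuclideanSpace ℝ (Fin n)) {Θ : RelaxedControl 𝕌}
    (hΘ : Measurable Θ.1.1) : Measurable (M.controlRate α x Θ) :=
  measurable_const.add (measurable_lintegral_path measurable_lam_coe x hΘ)

/-- The control obtained by following `Θ` from time `s` on. -/
def shiftControl (Θ : RelaxedControl 𝕌) (s : ℝ≥0) : RelaxedControl 𝕌 :=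
  (⟨fun u => Θ.1.1 (s + u),
    AEMeasurable.comp_quasiMeasurePreserving Θ.1.2 (quasiMeasurePreserving_add_left s)⟩, Θ.2)

theorem shiftControl_mem {x : EuclideanSpace ℝ (Fin n)} (hx : x ∈ M.E) {Θ : RelaxedControl 𝕌}
    (hΘ : Θ ∈ M.relaxedControls x) {s : ℝ≥0} (hs : (s : ℝ≥0∞) < M.tstar x) :
    shiftControl Θ s ∈ M.relaxedControls (M.φ s x) := by
  refine ⟨?_, ?_⟩
  · filter_upwards [(quasiMeasurePreserving_add_left s).ae hΘ.1] with u hu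
    rw [M.flow_flow]
    exact hu
  · rw [M.exitPoint_flow hx hs]
    exact hΘ.2

theorem stageCost_shiftControl {x : EuclideanSpace ℝ (Fin n)} (hx : x ∈ M.E) (Θ : RelaxedControl 𝕌)
    {s : ℝ≥0} (hs : (s : ℝ≥0∞) < M.tstar x) :
    M.stageCost α c ψ (M.φ s x) (shiftControl Θ s) =
      valueAt (M.controlRate α x Θ) (fun s => ∫⁻ a, c (M.φ s x, a) ∂(Θ.1.1 s : Measure 𝕌))
        (∫⁻ a, ψ (M.exitPoint x, a) ∂(Θ.2 : Measure 𝕌)) (M.tstar x) s := by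
  have h : M.controlRate α (M.φ s x) (shiftControl Θ s) =
      fun u => M.controlRate α x Θ (s + u) := by
    funext u
    simp only [controlRate, shiftControl, M.flow_flow]
  rw [stageCost, valueAt, M.tstar_flow hx hs, M.exitPoint_flow hx hs, h]
  simp only [shiftControl, M.flow_flow]

/-- The difference between the maximal jump rate and that of `Θ`. -/
def rateGap (M : ControlledPDMP n 𝕌) (x : EuclideanSpace ℝ (Fin n)) (Θ : RelaxedControl 𝕌)
    (s : ℝ≥0) : ℝ≥0∞ :=
  ∫⁻ a, (M.rateSup (M.φ s x) - M.lam (M.φ s x, a)) ∂(Θ.1.1 s : Measure 𝕌)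

theorem measurable_rateGap (hM : M.Assumptions) (x : EuclideanSpace ℝ (Fin n))
    {Θ : RelaxedControl 𝕌} (hΘ : Measurable Θ.1.1) : Measurable (M.rateGap x Θ) :=
  measurable_lintegral_path (g := fun p => M.rateSup p.1 - M.lam p)
    (((measurable_rateSup hM).comp measurable_fst).sub measurable_lam_coe) x hΘ

theorem rateGap_le (x : EuclideanSpace ℝ (Fin n)) (Θ : RelaxedControl 𝕌) (s : ℝ≥0) :
    M.rateGap x Θ s ≤ M.rateSupPath x s := by
  calc M.rateGap x Θ s ≤ ∫⁻ _, M.rateSup (M.φ s x) ∂(Θ.1.1 s : Measure 𝕌) :=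
        lintegral_mono fun _ => tsub_le_self
    _ = _ := by simp [rateSupPath]

theorem cumul_rateGap_ne_top (hM : M.Assumptions) {x : EuclideanSpace ℝ (Fin n)} (hx : x ∈ M.E)
    (Θ : RelaxedControl 𝕌) {t : ℝ≥0} (ht : (t : ℝ≥0∞) ≤ M.tstar x) :
    cumul (M.rateGap x Θ) t ≠ ⊤ :=
  ne_top_of_le_ne_top (cumul_rateSupPath_ne_top hM hx ht) (cumul_le_cumul fun s _ => rateGap_le x Θ s)

theorem controlRate_add_rateGap (hM : M.Assumptions) {x : EuclideanSpace ℝ (Fin n)}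
    {Θ : RelaxedControl 𝕌} {s : ℝ≥0} (hs : M.φ s x ∈ M.E)
    (hU : (Θ.1.1 s : Measure 𝕌) (M.U (M.φ s x)) = 1) :
    M.controlRate α x Θ s + M.rateGap x Θ s = α + M.rateSupPath x s := by
  have hm : Measurable fun a => (M.lam (M.φ s x, a) : ℝ≥0∞) :=
    measurable_lam_coe.comp measurable_prodMk_left
  rw [controlRate, rateGap, add_assoc, ← lintegral_add_left hm]
  congr 1
  calc _ = ∫⁻ _, M.rateSup (M.φ s x) ∂(Θ.1.1 s : Measure 𝕌) := by
        refine lintegral_congr_ae ((ae_mem_U hM (subset_closure hs) hU).mono fun a ha => ?_)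
        exact add_tsub_cancel_of_le (lam_le_rateSup hs ha)
    _ = _ := by simp [rateSupPath]

theorem cumul_controlRate_top (hM : M.Assumptions) {x : EuclideanSpace ℝ (Fin n)} (hx : x ∈ M.E)
    {Θ : RelaxedControl 𝕌} (hΘ : Θ ∈ M.relaxedControls x) (hT : M.tstar x = ⊤) :
    cumul (M.controlRate α x Θ) ⊤ = ⊤ := by
  refine cumul_eq_top_of_lam_le hM hx hT ?_
  filter_upwards [ae_feasible hx hΘ] with s hs b hb
  obtain ⟨hy, hU⟩ := hs (hT ▸ ENNReal.coe_lt_top)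
  refine le_trans ?_ le_add_self
  calc (b : ℝ≥0∞) = ∫⁻ _, (b : ℝ≥0∞) ∂(Θ.1.1 s : Measure 𝕌) := by simp
    _ ≤ _ := lintegral_mono_ae ((ae_mem_U hM (subset_closure hy) hU).mono fun a ha =>
      ENNReal.coe_le_coe.2 (hb a ha))

/-- After uniformization the cost of `Θ` is that of a running cost `c + (Λ - λ) V`, where `Λ` is the
maximal jump rate and `V` the cost of the rest of `Θ`, to which the induction hypothesis applies. -/
theorem iterate_bellman_le_stageCost (hM : M.Assumptions) (hc : Measurable c) (k : ℕ)
    {x : EuclideanSpace ℝ (Fin n)} (hx : x ∈ M.E) {Θ : RelaxedControl 𝕌}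
    (hΘ : Θ ∈ M.relaxedControls x) (hΘm : Measurable Θ.1.1) :
    (M.bellman α c ψ)^[k] 0 x ≤ M.stageCost α c ψ x Θ := by
  induction k generalizing x Θ with
  | zero => exact bot_le
  | succ k ih =>
    rw [Function.iterate_succ_apply']
    set v := (M.bellman α c ψ)^[k] 0
    set a := M.controlRate α x Θ with ha
    set δ := M.rateGap x Θ
    set G : ℝ≥0 → ℝ≥0∞ := fun s => ∫⁻ a, c (M.φ s x, a) ∂(Θ.1.1 s : Measure 𝕌) with hG
    set B := ∫⁻ a, ψ (M.exitPoint x, a) ∂(Θ.2 : Measure 𝕌) with hB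
    have hrate : ∀ᵐ s : ℝ≥0 ∂timeMeasure, (s : ℝ≥0∞) < M.tstar x →
        (α : ℝ≥0∞) + M.rateSupPath x s = a s + δ s := by
      filter_upwards [ae_feasible hx hΘ] with s hs hsT
      exact (controlRate_add_rateGap hM (hs hsT).1 (hs hsT).2).symm
    have hfin : ∀ t : ℝ≥0, (t : ℝ≥0∞) < M.tstar x → cumul δ t ≠ ⊤ := fun t ht =>
      cumul_rateGap_ne_top hM hx Θ ht.le
    calc M.bellman α c ψ v x
        = pathValue (fun s => a s + δ s) (fun s => M.minOn M.E (M.uniformizedCost c v) (M.φ s x))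
            (M.minOn (frontier M.E) ψ (M.exitPoint x)) (M.tstar x) := by
          rw [bellman, M.exitTime_of_mem hx, M.exitPointBorel_of_mem hx]
          exact pathValue_congr_ae hrate (ae_of_all _ fun s _ => rfl) rfl
      _ ≤ pathValue (fun s => a s + δ s) (fun s => G s + δ s * valueAt a G B (M.tstar x) s) B
            (M.tstar x) := by
          refine pathValue_mono_ae ?_ ?_
          · filter_upwards [ae_feasible hx hΘ] with s hs hsT
            obtain ⟨hy, hU⟩ := hs hsT
            have hcm : Measurable fun a => c (M.φ s x, a) := hc.comp measurable_prodMk_left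
            have hgm : Measurable fun a => M.rateSup (M.φ s x) - (M.lam (M.φ s x, a) : ℝ≥0∞) :=
              measurable_const.sub (measurable_lam_coe.comp measurable_prodMk_left)
            have hv : v (M.φ s x) ≤ valueAt a G B (M.tstar x) s := by
              rw [ha, hG, hB, ← stageCost_shiftControl hx Θ hsT]
              exact ih hy (shiftControl_mem hx hΘ hsT) (hΘm.comp (measurable_const_add s))
            calc M.minOn M.E (M.uniformizedCost c v) (M.φ s x)
                ≤ ∫⁻ a, M.uniformizedCost c v (M.φ s x, a) ∂(Θ.1.1 s : Measure 𝕌) :=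
                  minOn_le_lintegral hM subset_closure hy hU
              _ = G s + δ s * v (M.φ s x) := by
                  simp only [uniformizedCost]
                  rw [lintegral_add_left hcm, lintegral_mul_const _ hgm]
                  rfl
              _ ≤ _ := by gcongr
          · by_cases hT : M.tstar x = ⊤
            · have htop : cumul (fun s => a s + δ s) (M.tstar x) = ⊤ := by
                rw [← top_le_iff, ← cumul_controlRate_top (α := α) hM hx hΘ hT, hT]
                exact cumul_le_cumul fun s _ => le_self_add
              rw [htop, expNeg_top, zero_mul, zero_mul]
            · gcongr
              exact minOn_le_lintegral hM frontier_subset_closure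
                (M.exitPoint_mem_frontier hx hT) hΘ.2
      _ = pathValue a G B (M.tstar x) := pathValue_rate_add (measurable_controlRate x hΘm)
          (measurable_rateGap hM x hΘm) (measurable_lintegral_path hc x hΘm) B hfin
      _ = M.stageCost α c ψ x Θ := rfl

/-- A relaxed control may be replaced by one that depends on time in a Borel way. -/
theorem exists_measurable_control {x : EuclideanSpace ℝ (Fin n)} {Θ : RelaxedControl 𝕌}
    (hΘ : Θ ∈ M.relaxedControls x) :
    ∃ Θ' ∈ M.relaxedControls x, Measurable Θ'.1.1 ∧ Θ.2 = Θ'.2 ∧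
      ∀ᵐ s ∂timeMeasure, Θ.1.1 s = Θ'.1.1 s := by
  obtain ⟨ν, hν, hae⟩ := Θ.1.2
  refine ⟨(⟨ν, hν.aemeasurable⟩, Θ.2), ⟨?_, hΘ.2⟩, hν, rfl, hae⟩
  filter_upwards [hΘ.1, hae] with s hs hs' hmem
  rw [← hs']
  exact hs hmem

theorem stageCost_congr_ae {x : EuclideanSpace ℝ (Fin n)} {Θ Θ' : RelaxedControl 𝕌}
    (hb : Θ.2 = Θ'.2) (h : ∀ᵐ s ∂timeMeasure, Θ.1.1 s = Θ'.1.1 s) :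
    M.stageCost α c ψ x Θ = M.stageCost α c ψ x Θ' := by
  rw [stageCost, stageCost, hb]
  refine pathValue_congr_ae ?_ ?_ rfl
  · filter_upwards [h] with s hs _
    rw [controlRate, controlRate, hs]
  · filter_upwards [h] with s hs _
    rw [hs]

theorem value_le_stageCost (hM : M.Assumptions) (hc : Measurable c)
    {x : EuclideanSpace ℝ (Fin n)} (hx : x ∈ M.E) {Θ : RelaxedControl 𝕌}
    (hΘ : Θ ∈ M.relaxedControls x) : M.value α c ψ x ≤ M.stageCost α c ψ x Θ := by
  obtain ⟨Θ', hΘ', hm, hb, hae⟩ := exists_measurable_control hΘ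
  rw [stageCost_congr_ae hb hae]
  exact iSup_le fun k => iterate_bellman_le_stageCost hM hc k hx hΘ' hm

/-! ### Minimizing feedback controls are optimal -/

theorem toRelaxed_mem {x : EuclideanSpace ℝ (Fin n)} {Υ : OrdinaryControl 𝕌}
    (hx : x ∈ M.E) (hΥ : Υ ∈ M.ordinaryControls x) :
    Υ.toRelaxed ∈ M.relaxedControls x := by
  have h : ∀ y ∈ closure M.E, ∀ a ∈ M.U y, (diracProba a : Measure 𝕌) (M.U y) = 1 :=
    fun y hy a ha => Measure.dirac_apply_of_mem ha
  exact ⟨ae_of_all _ fun s hs => h _ hs _ (hΥ.1 s hs),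
    h _ (M.exitPoint_mem_closure hx) _ hΥ.2⟩

theorem feedback_mem {u : EuclideanSpace ℝ (Fin n) → 𝕌} (hu : u ∈ M.actionSelectors)
    {x : EuclideanSpace ℝ (Fin n)} (hx : x ∈ M.E) :
    M.feedback u hu.1 x ∈ M.ordinaryControls x :=
  ⟨fun _ hs => hu.2 _ hs, hu.2 _ (M.exitPoint_mem_closure hx)⟩

theorem feedback_mem_ordinarySelectors {u : EuclideanSpace ℝ (Fin n) → 𝕌}
    (hu : u ∈ M.actionSelectors) : M.feedback u hu.1 ∈ M.ordinarySelectors := by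
  refine ⟨?_, fun x hx => feedback_mem hu hx⟩
  refine OrdinaryControl.measurable_of_uncurry ?_ ?_
  · exact hu.1.comp (M.measurable_flow.comp
      ((measurable_subtype_coe.comp measurable_fst).prodMk measurable_snd))
  · have : (fun x : M.E => (M.feedback u hu.1 x).bdry) = fun x : M.E => u (M.exitPointBorel x) := by
      funext x
      rw [M.exitPointBorel_of_mem x.2]
      rfl
    rw [this]
    exact hu.1.comp (M.measurable_exitPointBorel.comp measurable_subtype_coe)

/-- A feedback control that minimizes the uniformized costs for the limit of value iteration does
not cost more than this limit. -/
theorem stageCost_feedback_le (hM : M.Assumptions) (hc : Measurable c)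
    (hcl : ∀ x ∈ M.E, LowerSemicontinuousOn (fun a => c (x, a)) (M.U x)) (hψ : Measurable ψ)
    (hψl : ∀ z ∈ frontier M.E, LowerSemicontinuousOn (fun a => ψ (z, a)) (M.U z))
    {u : EuclideanSpace ℝ (Fin n) → 𝕌} (hu : u ∈ M.actionSelectors)
    (humin : ∀ y ∈ M.E, ∀ a ∈ M.U y, M.uniformizedCost c (M.value α c ψ) (y, u y) ≤
      M.uniformizedCost c (M.value α c ψ) (y, a))
    (hubd : ∀ z ∈ frontier M.E, ∀ a ∈ M.U z, ψ (z, u z) ≤ ψ (z, a))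
    {x : EuclideanSpace ℝ (Fin n)} (hx : x ∈ M.E) (hfin : M.value α c ψ x ≠ ⊤) :
    M.stageCost α c ψ x (M.feedback u hu.1 x).toRelaxed ≤ M.value α c ψ x := by
  set v := M.value α c ψ with hv
  set Θ := (M.feedback u hu.1 x).toRelaxed
  have hΘ : Θ ∈ M.relaxedControls x := toRelaxed_mem hx (feedback_mem hu hx)
  have hΘm : Measurable Θ.1.1 :=
    measurable_diracProba_map.comp (M.feedback u hu.1 x).measurable_path
  have hdirac : ∀ (g : EuclideanSpace ℝ (Fin n) × 𝕌 → ℝ≥0∞), Measurable g → ∀ s : ℝ≥0,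
      ∫⁻ a, g (M.φ s x, a) ∂(Θ.1.1 s : Measure 𝕌) = g (M.φ s x, u (M.φ s x)) := fun g hg s =>
    lintegral_dirac' _ (hg.comp measurable_prodMk_left)
  have hbdry : ∫⁻ a, ψ (M.exitPoint x, a) ∂(Θ.2 : Measure 𝕌) =
      ψ (M.exitPoint x, u (M.exitPoint x)) :=
    lintegral_dirac' _ (hψ.comp measurable_prodMk_left)
  set a := M.controlRate α x Θ
  set δ := M.rateGap x Θ
  set G : ℝ≥0 → ℝ≥0∞ := fun s => ∫⁻ a, c (M.φ s x, a) ∂(Θ.1.1 s : Measure 𝕌)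
  set m : ℝ≥0 → ℝ≥0∞ := fun s => M.minOn M.E (M.uniformizedCost c v) (M.φ s x)
  set B := M.minOn (frontier M.E) ψ (M.exitPoint x) with hB
  set T := M.tstar x with hT
  have hmm : Measurable m := (measurable_minOn_uniformizedCost hM hc hcl
    (measurable_value hM hc hcl hψ hψl)).comp (M.continuous_path x).measurable
  have hU : ∀ y ∈ closure M.E, u y ∈ M.U y := hu.2
  have hrate : ∀ s : ℝ≥0, (s : ℝ≥0∞) < T → (α : ℝ≥0∞) + M.rateSupPath x s = a s + δ s :=
    fun s hs => by
      have hy := M.flow_mem_E hx hs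
      have h1 : (Θ.1.1 s : Measure 𝕌) (M.U (M.φ s x)) = 1 :=
        Measure.dirac_apply_of_mem (hU _ (subset_closure hy))
      exact (controlRate_add_rateGap hM hy h1).symm
  have hmeq : ∀ s : ℝ≥0, (s : ℝ≥0∞) < T → m s = G s + δ s * v (M.φ s x) := fun s hs => by
    have hy := M.flow_mem_E hx hs
    have h1 : G s = c (M.φ s x, u (M.φ s x)) := hdirac c hc s
    have h2 : δ s = M.rateSup (M.φ s x) - M.lam (M.φ s x, u (M.φ s x)) :=
      hdirac (fun p => M.rateSup p.1 - M.lam p)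
        (((measurable_rateSup hM).comp measurable_fst).sub measurable_lam_coe) s
    rw [h1, h2]
    refine le_antisymm (minOn_le hy (hU _ (subset_closure hy))) ?_
    change _ ≤ M.minOn M.E (M.uniformizedCost c v) (M.φ s x)
    rw [minOn_of_mem hy]
    exact le_iInf₂ fun b hb => humin _ hy b hb
  have hval : ∀ s : ℝ≥0, (s : ℝ≥0∞) < T → v (M.φ s x) = valueAt (fun s => a s + δ s) m B T s :=
    fun s hs => by
      rw [hv, value_flow hM hc hcl hψ hψl hx hs]
      refine pathValue_congr (fun r hr => hrate _ ?_) (fun r _ => rfl) rfl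
      rw [ENNReal.coe_add]
      exact lt_tsub_iff_left.1 hr
  have hval0 : v x = pathValue (fun s => a s + δ s) m B T := by
    rw [hv, value_eq_pathValue hM hc hcl hψ hψl hx]
    exact pathValue_congr hrate (fun r _ => rfl) rfl
  -- return from the maximal rate to that of the control
  have hkey : ∀ t : ℝ≥0, (t : ℝ≥0∞) ≤ T →
      v x = cumul (fun s => expNeg (cumul a s) * G s) t +
        expNeg (cumul a t) * valueAt (fun s => a s + δ s) m B T t := fun t ht => by
    rw [hval0]
    exact pathValue_eq_of_reward_eq (measurable_controlRate x hΘm) (measurable_rateGap hM x hΘm)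
      (measurable_lintegral_path hc x hΘm) hmm ht (cumul_rateGap_ne_top hM hx Θ ht) hmeq hval
      (hval0 ▸ hfin)
  rw [stageCost, pathValue, hbdry]
  by_cases htop : T = ⊤
  · have h1 : cumul (M.controlRate α x Θ) (M.tstar x) = ⊤ := by
      rw [← hT, htop]
      exact cumul_controlRate_top hM hx hΘ htop
    rw [h1, expNeg_top, zero_mul, add_zero]
    exact cumul_le_of_forall_lt fun t ht => (hkey t ht.le).symm ▸ le_self_add
  · have hT' : ((T.toNNReal : ℝ≥0) : ℝ≥0∞) = T := ENNReal.coe_toNNReal htop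
    have h := hkey T.toNNReal hT'.le
    have hself : valueAt (fun s => a s + δ s) m B T T.toNNReal = B := by
      conv_lhs => rw [← hT', ENNReal.toNNReal_coe]
      exact valueAt_self _ _ _ _
    rw [hself, hT'] at h
    rw [h]
    have hz := M.exitPoint_mem_frontier hx htop
    gcongr
    rw [hB, minOn_of_mem hz]
    exact le_iInf₂ fun b hb => hubd _ hz b hb

variable {ρ C : ℝ≥0} {ξ : EuclideanSpace ℝ (Fin n) → ℝ≥0} {h : EuclideanSpace ℝ (Fin n) → ℝ}

/-! ### One-stage costs as values along a trajectory -/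

theorem cumul_controlRate_coe (x : EuclideanSpace ℝ (Fin n)) (Θ : RelaxedControl 𝕌) (t : ℝ≥0) :
    cumul (M.controlRate α x Θ) t = α * t + M.Lam Θ.1 x t := by
  rw [← cumul_const]
  exact cumul_fun_add measurable_const _ _

/-- The discount up to the exit time is that of the total rate; if the trajectory never leaves `E`,
both vanish at time `∞`. -/
theorem discount_eq (hM : M.Assumptions) {x : EuclideanSpace ℝ (Fin n)} (hx : x ∈ M.E)
    {Θ : RelaxedControl 𝕌} (hΘ : Θ ∈ M.relaxedControls x) {t : ℝ≥0∞} (ht : t ≤ M.tstar x) :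
    M.discount α Θ.1 x t = expNeg (cumul (M.controlRate α x Θ) t) := by
  induction t with
  | coe t => rw [cumul_controlRate_coe, discount]
  | top =>
    have hT := top_le_iff.1 ht
    have h0 : M.Lam Θ.1 x ⊤ = ⊤ := by
      refine Eq.trans ?_ (cumul_controlRate_top (α := 0) hM hx hΘ hT)
      refine cumul_congr fun s _ => ?_
      rw [controlRate, ENNReal.coe_zero, zero_add]
    rw [cumul_controlRate_top hM hx hΘ hT, discount, h0, add_top]

theorem stageCost_eq_Lop_add_Hop (hM : M.Assumptions) {x : EuclideanSpace ℝ (Fin n)} (hx : x ∈ M.E)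
    {Θ : RelaxedControl 𝕌} (hΘ : Θ ∈ M.relaxedControls x) :
    M.stageCost α c ψ x Θ =
      M.Lop α (fun y a => c (y, a)) x Θ + M.Hop α (fun y a => ψ (y, a)) x Θ := by
  rw [stageCost, pathValue, Hop, discount_eq hM hx hΘ le_rfl]
  congr 1
  refine cumul_congr fun s hs => ?_
  rw [discount_eq hM hx hΘ hs.le]

theorem cost_congr_ae {x : EuclideanSpace ℝ (Fin n)} {Θ Θ' : RelaxedControl 𝕌}
    (hb : Θ.2 = Θ'.2) (hae : ∀ᵐ s ∂timeMeasure, Θ.1.1 s = Θ'.1.1 s) :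
    M.cost α ρ h x Θ = M.cost α ρ h x Θ' := by
  have hLam : ∀ t, M.Lam Θ.1 x t = M.Lam Θ'.1 x t := fun t => by
    refine cumul_congr_ae ?_
    filter_upwards [hae] with s hs _
    rw [hs]
  have hLop : ∀ v, M.Lop α v x Θ = M.Lop α v x Θ' := fun v => by
    refine cumul_congr_ae ?_
    filter_upwards [hae] with s hs _
    rw [hs, discount, discount, hLam]
  have hHop : ∀ v, M.Hop α v x Θ = M.Hop α v x Θ' := fun v => by
    rw [Hop, Hop, hb, discount, discount, hLam]
  simp only [cost, Gop, Gpos, calL, hLop, hHop]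

theorem stageCost_mono (hM : M.Assumptions) {x : EuclideanSpace ℝ (Fin n)} (hx : x ∈ M.E)
    {Θ : RelaxedControl 𝕌} (hΘ : Θ ∈ M.relaxedControls x)
    {c' ψ' : EuclideanSpace ℝ (Fin n) × 𝕌 → ℝ≥0∞}
    (hc : ∀ y ∈ M.E, ∀ a ∈ M.U y, c (y, a) ≤ c' (y, a))
    (hψ : ∀ z ∈ closure M.E, ∀ a ∈ M.U z, ψ (z, a) ≤ ψ' (z, a)) :
    M.stageCost α c ψ x Θ ≤ M.stageCost α c' ψ' x Θ := by
  refine pathValue_mono_ae ?_ ?_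
  · filter_upwards [ae_feasible hx hΘ] with s hs hsT
    obtain ⟨hy, hU⟩ := hs hsT
    exact lintegral_mono_ae ((ae_mem_U hM (subset_closure hy) hU).mono fun a ha => hc _ hy a ha)
  · have hz := M.exitPoint_mem_closure hx
    gcongr 1
    exact lintegral_mono_ae ((ae_mem_U hM hz hΘ.2).mono fun a ha => hψ _ hz a ha)

theorem stageCost_congr (hM : M.Assumptions) {x : EuclideanSpace ℝ (Fin n)} (hx : x ∈ M.E)
    {Θ : RelaxedControl 𝕌} (hΘ : Θ ∈ M.relaxedControls x)
    {c' ψ' : EuclideanSpace ℝ (Fin n) × 𝕌 → ℝ≥0∞}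
    (hc : ∀ y ∈ M.E, ∀ a ∈ M.U y, c (y, a) = c' (y, a))
    (hψ : ∀ z ∈ closure M.E, ∀ a ∈ M.U z, ψ (z, a) = ψ' (z, a)) :
    M.stageCost α c ψ x Θ = M.stageCost α c' ψ' x Θ :=
  le_antisymm
    (stageCost_mono hM hx hΘ (fun y hy a ha => (hc y hy a ha).le) fun z hz a ha => (hψ z hz a ha).le)
    (stageCost_mono hM hx hΘ (fun y hy a ha => (hc y hy a ha).ge) fun z hz a ha => (hψ z hz a ha).ge)

theorem stageCost_add (x : EuclideanSpace ℝ (Fin n)) {Θ : RelaxedControl 𝕌}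
    (hΘ : Measurable Θ.1.1) (hc : Measurable c) (hψ : Measurable ψ)
    (c' ψ' : EuclideanSpace ℝ (Fin n) × 𝕌 → ℝ≥0∞) :
    M.stageCost α (fun p => c p + c' p) (fun p => ψ p + ψ' p) x Θ =
      M.stageCost α c ψ x Θ + M.stageCost α c' ψ' x Θ := by
  have hcy : ∀ y, Measurable fun a => c (y, a) := fun y => hc.comp measurable_prodMk_left
  have hψy : ∀ y, Measurable fun a => ψ (y, a) := fun y => hψ.comp measurable_prodMk_left
  simp only [stageCost, pathValue, lintegral_add_left (hcy _), lintegral_add_left (hψy _), mul_add]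
  have hm : Measurable fun s : ℝ≥0 => expNeg (cumul (M.controlRate α x Θ) s) *
      ∫⁻ a, c (M.φ s x, a) ∂(Θ.1.1 s : Measure 𝕌) :=
    (measurable_expNeg_cumul _).mul (measurable_lintegral_path hc x hΘ)
  rw [cumul_fun_add hm]
  exact add_add_add_comm _ _ _ _

theorem stageCost_const_mul (x : EuclideanSpace ℝ (Fin n)) (Θ : RelaxedControl 𝕌) (b : ℝ≥0)
    (c ψ : EuclideanSpace ℝ (Fin n) × 𝕌 → ℝ≥0∞) :
    M.stageCost α (fun p => b * c p) (fun p => b * ψ p) x Θ = b * M.stageCost α c ψ x Θ := by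
  simp only [stageCost, pathValue, lintegral_const_mul' _ _ (ENNReal.coe_ne_top (r := b)),
    mul_left_comm _ (b : ℝ≥0∞), cumul_const_mul _ (ENNReal.coe_ne_top (r := b)), mul_add]

theorem cumul_controlRate_ne_top (hM : M.Assumptions) {x : EuclideanSpace ℝ (Fin n)} (hx : x ∈ M.E)
    {Θ : RelaxedControl 𝕌} (hΘ : Θ ∈ M.relaxedControls x) {t : ℝ≥0} (ht : (t : ℝ≥0∞) ≤ M.tstar x) :
    cumul (M.controlRate α x Θ) t ≠ ⊤ := by
  have h1 : cumul (M.controlRate α x Θ) t ≤ cumul (fun s => α + M.rateSupPath x s) t := by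
    refine setLIntegral_mono_ae' (measurableSet_coe_lt _) ?_
    filter_upwards [ae_feasible hx hΘ] with s hs hst
    obtain ⟨hy, hU⟩ := hs (lt_of_lt_of_le hst ht)
    rw [← controlRate_add_rateGap hM hy hU]
    exact le_self_add
  refine ne_top_of_le_ne_top ?_ h1
  rw [cumul_fun_add measurable_const, cumul_const]
  exact ENNReal.add_ne_top.2 ⟨ENNReal.mul_ne_top ENNReal.coe_ne_top ENNReal.coe_ne_top,
    cumul_rateSupPath_ne_top hM hx ht⟩

/-- A cost of one unit, paid at the first jump or discounting event, costs one unit. -/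
theorem stageCost_rate_one (hM : M.Assumptions) {x : EuclideanSpace ℝ (Fin n)} (hx : x ∈ M.E)
    {Θ : RelaxedControl 𝕌} (hΘ : Θ ∈ M.relaxedControls x) (hΘm : Measurable Θ.1.1) :
    M.stageCost α (fun p => α + M.lam p) (fun _ => 1) x Θ = 1 := by
  refine Eq.trans ?_ (cumul_mul_expNeg_add_of_forall_lt (measurable_controlRate (α := α) x hΘm)
    fun t ht => cumul_controlRate_ne_top hM hx hΘ ht.le)
  rw [stageCost, pathValue]
  congr 1
  · refine cumul_congr fun s _ => ?_
    rw [mul_comm, controlRate, lintegral_add_left measurable_const]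
    simp
  · simp

/-! ### The expected time to the next jump at the lowest rate -/

variable (M) in
/-- The expected time to the next jump or the exit from `E`, if jumps occur at rate `ξ`. -/
def expectedSojourn (ξ : EuclideanSpace ℝ (Fin n) → ℝ≥0) (x : EuclideanSpace ℝ (Fin n)) : ℝ≥0∞ :=
  pathValue (fun s => ξ (M.φ s x)) (fun _ => 1) 0 (M.exitTime x)

theorem measurable_expectedSojourn (hξ : Measurable ξ) : Measurable (M.expectedSojourn ξ) :=
  measurable_pathValue_param (a := fun x s => (ξ (M.φ s x) : ℝ≥0∞)) (G := fun _ _ => 1)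
    (hξ.comp M.measurable_flow).coe_nnreal_ennreal measurable_const measurable_const
    M.measurable_exitTime

theorem expectedSojourn_eq {x : EuclideanSpace ℝ (Fin n)} (hx : x ∈ M.E) :
    M.expectedSojourn ξ x = ∫⁻ t in {t : ℝ≥0 | (t : ℝ≥0∞) < M.tstar x},
      expNeg (∫⁻ s in {s : ℝ≥0 | s < t}, (ξ (M.φ s x) : ℝ≥0∞) ∂timeMeasure) ∂timeMeasure := by
  rw [expectedSojourn, pathValue, M.exitTime_of_mem hx]
  simp only [mul_one, mul_zero, add_zero, cumul, ENNReal.coe_lt_coe]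

theorem expectedSojourn_flow {x : EuclideanSpace ℝ (Fin n)} (hx : x ∈ M.E) {t : ℝ≥0}
    (ht : (t : ℝ≥0∞) < M.tstar x) :
    M.expectedSojourn ξ (M.φ t x) =
      valueAt (fun s => ξ (M.φ s x)) (fun _ => 1) 0 (M.tstar x) t := by
  rw [expectedSojourn, valueAt, M.exitTime_of_mem (M.flow_mem_E hx ht), M.tstar_flow hx ht]
  simp only [M.flow_flow]

theorem expectedSojourn_eq_pathValue {x : EuclideanSpace ℝ (Fin n)} (hx : x ∈ M.E) :
    M.expectedSojourn ξ x =
      pathValue (fun s => ξ (M.φ s x)) (fun _ => 1) 0 (M.tstar x) := by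
  rw [expectedSojourn, M.exitTime_of_mem hx]

/-- The expected sojourn is the one-stage cost of time, if each excess jump over the rate `ξ` costs
the expected remaining sojourn. -/
theorem stageCost_expectedSojourn (hM : M.Assumptions) (hξ : Measurable ξ)
    (hle : ∀ y ∈ M.E, ∀ a ∈ M.U y, ξ y ≤ M.lam (y, a)) {x : EuclideanSpace ℝ (Fin n)}
    (hx : x ∈ M.E) {Θ : RelaxedControl 𝕌} (hΘ : Θ ∈ M.relaxedControls x)
    (hΘm : Measurable Θ.1.1) :
    M.stageCost α (fun p => 1 + (α + (M.lam p - ξ p.1)) * M.expectedSojourn ξ p.1)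
      (fun _ => 0) x Θ = M.expectedSojourn ξ x := by
  have hgap : Measurable fun p : EuclideanSpace ℝ (Fin n) × 𝕌 =>
      (α : ℝ≥0∞) + ((M.lam p : ℝ≥0∞) - ξ p.1) :=
    measurable_const.add (measurable_lam_coe.sub (hξ.comp measurable_fst).coe_nnreal_ennreal)
  set δ : ℝ≥0 → ℝ≥0∞ := fun s =>
    ∫⁻ a, ((α : ℝ≥0∞) + (M.lam (M.φ s x, a) - ξ (M.φ s x))) ∂(Θ.1.1 s : Measure 𝕌) with hδ
  have hδm : Measurable δ := measurable_lintegral_path hgap x hΘm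
  have hξm : Measurable fun s => (ξ (M.φ s x) : ℝ≥0∞) :=
    (hξ.comp (M.continuous_path x).measurable).coe_nnreal_ennreal
  have hrate : ∀ᵐ s : ℝ≥0 ∂timeMeasure, (s : ℝ≥0∞) < M.tstar x →
      M.controlRate α x Θ s = ξ (M.φ s x) + δ s := by
    filter_upwards [ae_feasible hx hΘ] with s hs hsT
    obtain ⟨hy, hU⟩ := hs hsT
    have h1 : (ξ (M.φ s x) : ℝ≥0∞) = ∫⁻ _, (ξ (M.φ s x) : ℝ≥0∞) ∂(Θ.1.1 s : Measure 𝕌) := by simp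
    have h2 : (α : ℝ≥0∞) = ∫⁻ _, (α : ℝ≥0∞) ∂(Θ.1.1 s : Measure 𝕌) := by simp
    rw [controlRate, h1, hδ, ← lintegral_add_left measurable_const]
    conv_lhs => rw [h2, ← lintegral_add_left measurable_const]
    refine lintegral_congr_ae ((ae_mem_U hM (subset_closure hy) hU).mono fun a ha => ?_)
    change _ = (ξ (M.φ s x) : ℝ≥0∞) + (α + (M.lam (M.φ s x, a) - ξ (M.φ s x)))
    rw [add_left_comm, add_tsub_cancel_of_le (ENNReal.coe_le_coe.2 (hle _ hy a ha))]
  have hfin : ∀ t : ℝ≥0, (t : ℝ≥0∞) < M.tstar x → cumul δ t ≠ ⊤ := fun t ht => by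
    refine ne_top_of_le_ne_top (cumul_controlRate_ne_top (α := α) hM hx hΘ ht.le) ?_
    refine setLIntegral_mono_ae' (measurableSet_coe_lt _) ?_
    filter_upwards [hrate] with s hs hst
    rw [hs (lt_trans hst ht)]
    exact le_add_self
  rw [expectedSojourn_eq_pathValue hx, ← pathValue_rate_add hξm hδm measurable_const 0 hfin,
    stageCost]
  refine pathValue_congr_ae hrate (ae_of_all _ fun s hs => ?_) (by simp)
  have hg : Measurable fun a => (α : ℝ≥0∞) + ((M.lam (M.φ s x, a) : ℝ≥0∞) - ξ (M.φ s x)) :=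
    hgap.comp measurable_prodMk_left
  rw [← expectedSojourn_flow hx hs, lintegral_add_left measurable_const]
  dsimp only
  rw [lintegral_mul_const _ hg]
  simp [hδ]

/-! ### Reduction to non-negative costs -/

variable (M) in
/-- The values of `h + C` on `E`, for `h ≥ -C`. -/
def shifted (C : ℝ≥0) (h : EuclideanSpace ℝ (Fin n) → ℝ) : EuclideanSpace ℝ (Fin n) → ℝ≥0∞ :=
  M.E.indicator fun z => ENNReal.ofReal (h z + C)

variable (M) in
/-- The running cost of the problem whose value is `w + C + ρ k`, where `k` is the expected sojourn
at rate `ξ` and `w` the value of the given problem. -/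
def shiftedCost (α ρ C : ℝ≥0) (ξ : EuclideanSpace ℝ (Fin n) → ℝ≥0)
    (h : EuclideanSpace ℝ (Fin n) → ℝ) (p : EuclideanSpace ℝ (Fin n) × 𝕌) : ℝ≥0∞ :=
  M.f p + C * α + ρ * ((α + (M.lam p - ξ p.1)) * M.expectedSojourn ξ p.1) +
    M.lam p * M.Qpos (M.shifted C h) p.1 p.2

variable (M) in
/-- The boundary cost that goes with `shiftedCost`. -/
def shiftedBdry (C : ℝ≥0) (h : EuclideanSpace ℝ (Fin n) → ℝ)
    (p : EuclideanSpace ℝ (Fin n) × 𝕌) : ℝ≥0∞ :=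
  M.r p + M.Qpos (M.shifted C h) p.1 p.2

theorem measurable_indicator_of_borelOn {g : EuclideanSpace ℝ (Fin n) → ℝ≥0∞}
    (hg : BorelOn M.E g) : Measurable (M.E.indicator g) := by
  refine measurable_of_restrict_of_restrict_compl M.measurableSet_E ?_ ?_
  · exact (funext fun z : M.E => indicator_of_mem z.2 g : M.E.domRestrict (M.E.indicator g) = _) ▸ hg
  · exact (funext fun z => indicator_of_notMem z.2 g : M.Eᶜ.domRestrict (M.E.indicator g) = fun _ => 0) ▸
      measurable_const

theorem measurable_shifted (hh : BorelOn M.E h) : Measurable (M.shifted C h) :=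
  measurable_indicator_of_borelOn (ENNReal.measurable_ofReal.comp (hh.add_const (C : ℝ)))

theorem measurable_Qpos {g : EuclideanSpace ℝ (Fin n) → ℝ≥0∞} (hg : Measurable g) :
    Measurable fun p : EuclideanSpace ℝ (Fin n) × 𝕌 => M.Qpos g p.1 p.2 :=
  hg.lintegral_kernel

theorem Qpos_congr {g g' : EuclideanSpace ℝ (Fin n) → ℝ≥0∞} (hg : ∀ z ∈ M.E, g z = g' z)
    {x : EuclideanSpace ℝ (Fin n)} (hx : x ∈ closure M.E) (a : 𝕌) :
    M.Qpos g x a = M.Qpos g' x a :=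
  lintegral_congr_ae ((show ∀ᵐ z ∂M.Q (x, a), z ∈ M.E from
    mem_ae_iff.2 (M.Q_compl x hx a)).mono hg)

theorem Qpos_indicator (g : EuclideanSpace ℝ (Fin n) → ℝ≥0∞) {x : EuclideanSpace ℝ (Fin n)}
    (hx : x ∈ closure M.E) (a : 𝕌) : M.Qpos (M.E.indicator g) x a = M.Qpos g x a :=
  Qpos_congr (fun _ hz => indicator_of_mem hz _) hx a

theorem measurable_shiftedBdry (hh : BorelOn M.E h) :
    Measurable (M.shiftedBdry C h) :=
  M.measurable_r.coe_nnreal_ennreal.add (measurable_Qpos (measurable_shifted hh))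

theorem measurable_shiftedCost (hξ : Measurable ξ) (hh : BorelOn M.E h) :
    Measurable (M.shiftedCost α ρ C ξ h) := by
  refine ((M.measurable_f.coe_nnreal_ennreal.add measurable_const).add
    (measurable_const.mul (Measurable.mul (measurable_const.add (measurable_lam_coe.sub
      (hξ.comp measurable_fst).coe_nnreal_ennreal)) ?_))).add
    (measurable_lam_coe.mul (measurable_Qpos (measurable_shifted hh)))
  exact (measurable_expectedSojourn hξ).comp measurable_fst

theorem ofReal_add_coe_add_ofReal_neg {y : ℝ} (hy : -(C : ℝ) ≤ y) :
    ENNReal.ofReal (y + C) + ENNReal.ofReal (-y) = ENNReal.ofReal y + C := by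
  rw [← ENNReal.ofReal_coe_nnreal]
  rcases le_total 0 y with h0 | h0
  · rw [ENNReal.ofReal_of_nonpos (neg_nonpos.2 h0), add_zero,
      ENNReal.ofReal_add h0 C.coe_nonneg]
  · rw [ENNReal.ofReal_of_nonpos h0, zero_add, ← ENNReal.ofReal_add (by linarith) (by linarith)]
    congr 1
    ring

theorem Qpos_shifted (hh : BorelOn M.E h) (hC : ∀ z ∈ M.E, -(C : ℝ) ≤ h z)
    {x : EuclideanSpace ℝ (Fin n)} (hx : x ∈ closure M.E) (a : 𝕌) :
    M.Qpos (M.shifted C h) x a + M.Qpos (fun z => ENNReal.ofReal (-h z)) x a =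
      M.Qpos (fun z => ENNReal.ofReal (h z)) x a + C := by
  have := M.isMarkovKernel_Q
  have h1 : (C : ℝ≥0∞) = M.Qpos (fun _ => C) x a := by simp [Qpos]
  rw [h1, ← Qpos_indicator (fun z => ENNReal.ofReal (h z)) hx]
  unfold Qpos
  rw [← lintegral_add_left (measurable_shifted hh), ← lintegral_add_right _ measurable_const]
  refine Qpos_congr (fun z hz => ?_) hx a
  rw [shifted, indicator_of_mem hz, indicator_of_mem hz]
  exact ofReal_add_coe_add_ofReal_neg (hC z hz)

theorem Qpos_neg_le (hC : ∀ z ∈ M.E, -(C : ℝ) ≤ h z)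
    {x : EuclideanSpace ℝ (Fin n)} (hx : x ∈ closure M.E) (a : 𝕌) :
    M.Qpos (fun z => ENNReal.ofReal (-h z)) x a ≤ C := by
  have := M.isMarkovKernel_Q
  rw [← Qpos_indicator _ hx]
  calc M.Qpos (M.E.indicator fun z => ENNReal.ofReal (-h z)) x a ≤ M.Qpos (fun _ => C) x a := by
        refine lintegral_mono fun z => indicator_le (g := fun _ => (C : ℝ≥0∞)) (fun z hz => ?_) z
        rw [← ENNReal.ofReal_coe_nnreal]
        exact ENNReal.ofReal_le_ofReal (by linarith [hC z hz])
    _ = C := by simp [Qpos]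

/-- An equation in `[0, ∞]` solved for `s`; the terms that change sides are finite. -/
theorem coe_eq_neg_add_add_add_sub {s A B F R P k : ℝ≥0∞} (hA : A ≠ ⊤) (hB : B ≠ ⊤) (hk : k ≠ ⊤)
    (h : s + A + B = F + R + P + k) :
    (s : EReal) = -(A : EReal) + F + R + ((P : EReal) - B) + k := by
  lift A to ℝ≥0 using hA
  lift B to ℝ≥0 using hB
  lift k to ℝ≥0 using hk
  by_cases hs : s = ⊤
  · subst hs
    simp only [top_add] at h
    have h1 : F = ⊤ ∨ R = ⊤ ∨ P = ⊤ := by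
      simpa [or_assoc] using h.symm
    have key : ∀ u : ℝ≥0∞, ∀ b : ℝ≥0, ((u : EReal) - ((b : ℝ≥0∞) : EReal)) ≠ ⊥ := fun u b => by
      induction u with
      | coe u => exact EReal.coe_ne_bot (u - b : ℝ)
      | top =>
        rw [show ((⊤ : ℝ≥0∞) : EReal) - ((b : ℝ≥0∞) : EReal) = ⊤ from EReal.top_sub_coe (b : ℝ)]
        exact top_ne_bot
    have keyA : ∀ u : ℝ≥0∞, -((A : ℝ≥0∞) : EReal) + u ≠ ⊥ := fun u => by
      rw [add_comm, ← sub_eq_add_neg]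
      exact key u A
    have nb : ∀ u : ℝ≥0∞, (u : EReal) ≠ ⊥ := EReal.coe_ennreal_ne_bot
    symm
    rcases h1 with rfl | rfl | rfl
    · rw [show -((A : ℝ≥0∞) : EReal) + ((⊤ : ℝ≥0∞) : EReal) = ⊤ from
        EReal.add_top_of_ne_bot (EReal.coe_ne_bot (-A : ℝ)), EReal.top_add_of_ne_bot (nb _),
        EReal.top_add_of_ne_bot (key _ _), EReal.top_add_of_ne_bot (nb _)]
      rfl
    · rw [EReal.coe_ennreal_top, EReal.add_top_of_ne_bot (keyA _),
        EReal.top_add_of_ne_bot (key _ _), EReal.top_add_of_ne_bot (nb _)]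
    · have : ((⊤ : ℝ≥0∞) : EReal) - ((B : ℝ≥0∞) : EReal) = ⊤ := EReal.top_sub_coe (B : ℝ)
      rw [this, EReal.add_top_of_ne_bot (EReal.add_ne_bot_iff.2 ⟨keyA _, nb _⟩),
        EReal.top_add_of_ne_bot (nb _)]
      rfl
  · have hr : F + R + P + k ≠ ⊤ := by
      rw [← h]
      exact ENNReal.add_ne_top.2 ⟨ENNReal.add_ne_top.2 ⟨hs, ENNReal.coe_ne_top⟩, ENNReal.coe_ne_top⟩
    simp only [ENNReal.add_ne_top] at hr
    obtain ⟨⟨⟨hF, hR⟩, hP⟩, -⟩ := hr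
    lift s to ℝ≥0 using hs
    lift F to ℝ≥0 using hF
    lift R to ℝ≥0 using hR
    lift P to ℝ≥0 using hP
    have h' : s + A + B = F + R + P + k := by exact_mod_cast h
    have h2 : (s : ℝ) + A + B = F + R + P + k := by exact_mod_cast h'
    change (((s : ℝ) : EReal)) = ((-(A : ℝ) + F + R + ((P : ℝ) - B) + k : ℝ) : EReal)
    exact congrArg _ (by linarith)

/-- The non-negative one-stage cost is the given one, up to terms that do not depend on the
control. -/
theorem coe_stageCost_shifted (hM : M.Assumptions) (hξ : Measurable ξ)
    (hle : ∀ y ∈ M.E, ∀ a ∈ M.U y, ξ y ≤ M.lam (y, a)) (hh : BorelOn M.E h)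
    (hC : ∀ z ∈ M.E, -(C : ℝ) ≤ h z) {x : EuclideanSpace ℝ (Fin n)}
    (hx : x ∈ M.E) (hk : M.expectedSojourn ξ x ≠ ⊤) {Θ : RelaxedControl 𝕌}
    (hΘ : Θ ∈ M.relaxedControls x) :
    (M.stageCost α (M.shiftedCost α ρ C ξ h) (M.shiftedBdry C h) x Θ : EReal) =
      M.cost α ρ h x Θ + ((C + ρ * M.expectedSojourn ξ x : ℝ≥0∞) : EReal) := by
  wlog hΘm : Measurable Θ.1.1 generalizing Θ
  · obtain ⟨Θ', hΘ', hm, hb, hae⟩ := exists_measurable_control hΘ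
    rw [stageCost_congr_ae hb hae, cost_congr_ae hb hae]
    exact this hΘ' hm
  set hp : EuclideanSpace ℝ (Fin n) → ℝ≥0∞ := fun z => ENNReal.ofReal (h z)
  set hn : EuclideanSpace ℝ (Fin n) → ℝ≥0∞ := fun z => ENNReal.ofReal (-h z)
  set k := M.expectedSojourn ξ x with hkdef
  have hEcl : ∀ y ∈ M.E, y ∈ closure M.E := fun y hy => subset_closure hy
  have hpm : Measurable (M.E.indicator hp) :=
    measurable_indicator_of_borelOn (ENNReal.measurable_ofReal.comp hh)
  have hG : ∀ g : EuclideanSpace ℝ (Fin n) → ℝ≥0∞, M.Gpos α g x Θ =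
      M.stageCost α (fun p => M.lam p * M.Qpos (M.E.indicator g) p.1 p.2)
        (fun p => M.Qpos (M.E.indicator g) p.1 p.2) x Θ := fun g => by
    rw [Gpos, ← stageCost_congr hM hx hΘ (c := fun p => M.lam p * M.Qpos g p.1 p.2)
      (ψ := fun p => M.Qpos g p.1 p.2), stageCost_eq_Lop_add_Hop hM hx hΘ]
    · exact fun y hy a _ => by rw [Qpos_indicator _ (hEcl y hy)]
    · exact fun z hz a _ => by rw [Qpos_indicator _ hz]
  have hL : ∀ v : EuclideanSpace ℝ (Fin n) × 𝕌 → ℝ≥0∞,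
      M.Lop α (fun y a => v (y, a)) x Θ = M.stageCost α v (fun _ => 0) x Θ := fun v => by
    rw [stageCost_eq_Lop_add_Hop hM hx hΘ]
    simp [Hop]
  have hrate1 := stageCost_rate_one (α := α) hM hx hΘ hΘm
  have hkeq := stageCost_expectedSojourn (α := α) hM hξ hle hx hΘ hΘm
  have hcalL : M.calL α x Θ ≤ k := by
    rw [calL, hL fun _ => 1, hkdef, ← hkeq]
    exact stageCost_mono hM hx hΘ (fun _ _ _ _ => le_self_add) fun _ _ _ _ => le_rfl
  have hGn : M.Gpos α hn x Θ ≤ C := by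
    calc M.Gpos α hn x Θ ≤ M.stageCost α (fun p => C * (α + M.lam p)) (fun _ => C * 1) x Θ := by
          rw [hG]
          refine stageCost_mono hM hx hΘ (fun y hy a _ => ?_) fun z hz a _ => ?_
          · rw [Qpos_indicator _ (hEcl y hy), mul_comm]
            exact mul_le_mul' (Qpos_neg_le hC (hEcl y hy) a) le_add_self
          · rw [Qpos_indicator _ hz, mul_one]
            exact Qpos_neg_le hC hz a
      _ = C := by rw [stageCost_const_mul, hrate1, mul_one]
  have hlamm : Measurable fun p : EuclideanSpace ℝ (Fin n) × 𝕌 => (C : ℝ≥0∞) * (α + M.lam p) :=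
    measurable_const.mul (measurable_const.add measurable_lam_coe)
  have hsum : M.stageCost α (M.shiftedCost α ρ C ξ h) (M.shiftedBdry C h) x Θ +
      ρ * M.calL α x Θ + M.Gpos α hn x Θ =
      M.Lop α (fun y a => (M.f (y, a) : ℝ≥0∞)) x Θ + M.Hop α (fun y a => (M.r (y, a) : ℝ≥0∞)) x Θ +
        M.Gpos α hp x Θ + (C + ρ * k) := by
    have hfm := M.measurable_f.coe_nnreal_ennreal
    have hrm := M.measurable_r.coe_nnreal_ennreal
    have hcm : Measurable fun p => M.shiftedCost α ρ C ξ h p + ρ * 1 :=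
      (measurable_shiftedCost hξ hh).add measurable_const
    have hψm : Measurable fun p : EuclideanSpace ℝ (Fin n) × 𝕌 => M.shiftedBdry C h p + ρ * 0 :=
      (measurable_shiftedBdry hh).add measurable_const
    have hfm' : Measurable fun p => (M.f p : ℝ≥0∞) + M.lam p * M.Qpos (M.E.indicator hp) p.1 p.2 :=
      hfm.add (measurable_lam_coe.mul (measurable_Qpos hpm))
    have hrm' : Measurable fun p => (M.r p : ℝ≥0∞) + M.Qpos (M.E.indicator hp) p.1 p.2 :=
      hrm.add (measurable_Qpos hpm)
    rw [← stageCost_eq_Lop_add_Hop hM hx hΘ (c := fun p => (M.f p : ℝ≥0∞))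
      (ψ := fun p => (M.r p : ℝ≥0∞)), hG hp, hG hn, calL, hL fun _ => 1, ← stageCost_const_mul,
      ← stageCost_add x hΘm (measurable_shiftedCost hξ hh) (measurable_shiftedBdry hh),
      ← stageCost_add x hΘm hcm hψm,
      ← stageCost_add x hΘm hfm hrm, hkdef, ← hkeq,
      show (C : ℝ≥0∞) = C * M.stageCost α (fun p => α + M.lam p) (fun _ => 1) x Θ by
        rw [hrate1, mul_one], ← stageCost_const_mul, ← stageCost_const_mul,
      ← stageCost_add x hΘm hlamm measurable_const,
      ← stageCost_add x hΘm hfm' hrm']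
    refine stageCost_congr hM hx hΘ (fun y hy a ha => ?_) fun z hz a ha => ?_
    · have hQ := Qpos_shifted hh hC (hEcl y hy) a
      simp only [shiftedCost]
      rw [Qpos_indicator _ (hEcl y hy), Qpos_indicator _ (hEcl y hy)]
      calc _ = M.f (y, a) + C * α + ρ * (1 + (α + (M.lam (y, a) - ξ y)) * M.expectedSojourn ξ y) +
            M.lam (y, a) * (M.Qpos (M.shifted C h) y a + M.Qpos hn y a) := by ring
        _ = _ := by
          rw [hQ]
          ring
    · have hQ := Qpos_shifted hh hC hz a
      simp only [shiftedBdry]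
      rw [Qpos_indicator _ hz, Qpos_indicator _ hz]
      calc _ = M.r (z, a) + (M.Qpos (M.shifted C h) z a + M.Qpos hn z a) := by ring
        _ = _ := by
          rw [hQ]
          ring
  exact coe_eq_neg_add_add_add_sub
    (ENNReal.mul_ne_top ENNReal.coe_ne_top (ne_top_of_le_ne_top hk hcalL))
    (ne_top_of_le_ne_top ENNReal.coe_ne_top hGn)
    (ENNReal.add_ne_top.2 ⟨ENNReal.coe_ne_top, ENNReal.mul_ne_top ENNReal.coe_ne_top hk⟩) hsum

/-! ### Lower semicontinuity of the costs -/

/-- The integral of a non-negative function against the jump kernel is, as a function of the action,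
an increasing limit of integrals of bounded functions, which are continuous. -/
theorem exists_Qpos_eq_iSup (hM : M.Assumptions) {g : EuclideanSpace ℝ (Fin n) → ℝ≥0∞}
    (hg : Measurable g) {x : EuclideanSpace ℝ (Fin n)} (hx : x ∈ closure M.E) :
    ∃ q : ℕ → 𝕌 → ℝ≥0, (∀ k, ContinuousOn (q k) (M.U x)) ∧
      ∀ a, M.Qpos g x a = ⨆ k, (q k a : ℝ≥0∞) := by
  have := M.isMarkovKernel_Q
  have hm : ∀ k : ℕ, Measurable fun z => (min (g z) k).toReal := fun k =>
    (hg.min measurable_const).ennreal_toReal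
  have hfin : ∀ (k : ℕ) z, min (g z) (k : ℝ≥0∞) ≠ ⊤ := fun k z =>
    ne_top_of_le_ne_top (ENNReal.natCast_ne_top k) (min_le_right _ _)
  have hbd : ∀ (k : ℕ) z, |(min (g z) k).toReal| ≤ k := fun k z => by
    rw [abs_of_nonneg ENNReal.toReal_nonneg]
    exact ENNReal.toReal_le_of_le_ofReal (Nat.cast_nonneg k) (by simp)
  refine ⟨fun k a => (∫ z, (min (g z) k).toReal ∂(M.Q (x, a))).toNNReal, fun k =>
    continuous_real_toNNReal.comp_continuousOn (hM.continuousOn_Q x hx _ (hm k) ⟨k, hbd k⟩),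
    fun a => ?_⟩
  calc M.Qpos g x a = ∫⁻ z, ⨆ k : ℕ, min (g z) k ∂(M.Q (x, a)) := by
        refine lintegral_congr fun z => ?_
        rw [← inf_iSup_eq, ENNReal.iSup_natCast, inf_top_eq]
    _ = ⨆ k : ℕ, ∫⁻ z, min (g z) k ∂(M.Q (x, a)) :=
        lintegral_iSup (fun k => hg.min measurable_const)
          fun k l hkl z => min_le_min le_rfl (Nat.cast_le.2 hkl)
    _ = _ := by
        refine iSup_congr fun k => ?_
        change _ = ENNReal.ofReal _
        rw [ofReal_integral_eq_lintegral_ofReal]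
        · exact lintegral_congr fun z => (ENNReal.ofReal_toReal (hfin k z)).symm
        · exact Integrable.of_bound (hm k).aestronglyMeasurable k (ae_of_all _ (hbd k))
        · exact ae_of_all _ fun z => ENNReal.toReal_nonneg

theorem lowerSemicontinuousOn_mul_Qpos (hM : M.Assumptions)
    {g : EuclideanSpace ℝ (Fin n) → ℝ≥0∞} (hg : Measurable g) {x : EuclideanSpace ℝ (Fin n)}
    (hx : x ∈ closure M.E) {l : 𝕌 → ℝ≥0} (hl : ContinuousOn l (M.U x)) :
    LowerSemicontinuousOn (fun a => (l a : ℝ≥0∞) * M.Qpos g x a) (M.U x) := by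
  obtain ⟨q, hq, heq⟩ := exists_Qpos_eq_iSup hM hg hx
  simp only [heq, ENNReal.mul_iSup, ← ENNReal.coe_mul]
  exact lowerSemicontinuousOn_iSup fun k =>
    (ENNReal.continuous_coe.comp_continuousOn (hl.mul (hq k))).lowerSemicontinuousOn

/-- An increasing limit of continuous functions is lower semicontinuous. -/
theorem lowerSemicontinuousOn_of_tendsto {S : Set 𝕌} {F : ℕ → 𝕌 → ℝ≥0} {f : 𝕌 → ℝ≥0}
    (hF : ∀ j, ContinuousOn (F j) S)
    (hf : ∀ a ∈ S, Monotone (fun j => F j a) ∧ Tendsto (fun j => F j a) atTop (𝓝 (f a))) :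
    LowerSemicontinuousOn (fun a => (f a : ℝ≥0∞)) S := by
  have h : LowerSemicontinuousOn (fun a => ⨆ j, (F j a : ℝ≥0∞)) S :=
    lowerSemicontinuousOn_iSup fun j =>
      (ENNReal.continuous_coe.comp_continuousOn (hF j)).lowerSemicontinuousOn
  have heq : ∀ a ∈ S, (f a : ℝ≥0∞) = ⨆ j, (F j a : ℝ≥0∞) := fun a ha => by
    obtain ⟨hm, ht⟩ := hf a ha
    exact tendsto_nhds_unique (ENNReal.tendsto_coe.2 ht)
      (tendsto_atTop_iSup fun i j hij => ENNReal.coe_le_coe.2 (hm hij))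
  intro a ha y hy
  filter_upwards [h a ha y (lt_of_lt_of_eq (show y < f a from hy) (heq a ha)), self_mem_nhdsWithin] with b hb hbS
  exact lt_of_lt_of_eq (show y < _ from hb) (heq b hbS).symm

theorem lowerSemicontinuousOn_shiftedBdry (hM : M.Assumptions) (hh : BorelOn M.E h)
    {z : EuclideanSpace ℝ (Fin n)} (hz : z ∈ frontier M.E) :
    LowerSemicontinuousOn (fun a => M.shiftedBdry C h (z, a)) (M.U z) := by
  obtain ⟨F, -, hF⟩ := hM.approx_r
  refine (lowerSemicontinuousOn_of_tendsto (hF z hz).1 (hF z hz).2).add ?_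
  simpa using lowerSemicontinuousOn_mul_Qpos hM (measurable_shifted (C := C) hh)
    (frontier_subset_closure hz) (continuousOn_const (c := (1 : ℝ≥0)))

theorem lowerSemicontinuousOn_shiftedCost (hM : M.Assumptions) (hh : BorelOn M.E h)
    {x : EuclideanSpace ℝ (Fin n)} (hx : x ∈ M.E) (hk : M.expectedSojourn ξ x ≠ ⊤) :
    LowerSemicontinuousOn (fun a => M.shiftedCost α ρ C ξ h (x, a)) (M.U x) := by
  obtain ⟨F, -, hF⟩ := hM.approx_f
  have hx' := subset_closure hx
  refine (((lowerSemicontinuousOn_of_tendsto (hF x hx').1 (hF x hx').2).add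
    lowerSemicontinuousOn_const).add (ContinuousOn.lowerSemicontinuousOn ?_)).add
    (lowerSemicontinuousOn_mul_Qpos hM (measurable_shifted (C := C) hh) hx'
      (hM.continuousOn_lam x hx))
  have h1 : ContinuousOn (fun a => (α : ℝ≥0∞) + (M.lam (x, a) - ξ x)) (M.U x) :=
    continuousOn_const.add ((ENNReal.continuous_sub_right _).comp_continuousOn
      (continuousOn_lam_coe hM hx))
  have h2 := (ENNReal.continuous_mul_const hk).comp_continuousOn h1
  exact (ENNReal.continuous_const_mul (ENNReal.coe_ne_top (r := ρ))).comp_continuousOn h2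

/-! ### The Hamiltonian as a uniformized cost -/

theorem coe_shiftedBdry (hh : BorelOn M.E h) (hC : ∀ z ∈ M.E, -(C : ℝ) ≤ h z)
    {z : EuclideanSpace ℝ (Fin n)} (hz : z ∈ closure M.E) (a : 𝕌) :
    (M.shiftedBdry C h (z, a) : EReal) = M.boundaryHamiltonian h z a + ((C : ℝ) : EReal) := by
  have hQ := Qpos_shifted hh hC hz a
  have hn := Qpos_neg_le hC hz a
  rw [boundaryHamiltonian, Qop, shiftedBdry]
  dsimp only
  generalize M.Qpos (M.shifted C h) z a = q' at *
  generalize M.Qpos (fun z => ENNReal.ofReal (-h z)) z a = qn at *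
  generalize M.Qpos (fun z => ENNReal.ofReal (h z)) z a = qp at *
  lift qn to ℝ≥0 using ne_top_of_le_ne_top ENNReal.coe_ne_top hn
  induction qp with
  | top =>
    have : q' = ⊤ := by simpa using hQ
    subst this
    rw [add_top]
    rfl
  | coe qp =>
    have : q' ≠ ⊤ := fun ht => by simp [ht, ← ENNReal.coe_add] at hQ
    lift q' to ℝ≥0 using this
    have h1 : q' + qn = qp + C := by exact_mod_cast hQ
    have h2 : (q' : ℝ) + qn = qp + C := by exact_mod_cast h1
    change (((M.r (z, a) : ℝ) + q' : ℝ) : EReal) =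
      (((M.r (z, a) : ℝ) + ((qp : ℝ) - qn) + C : ℝ) : EReal)
    exact congrArg _ (by linarith)

/-- At a given point, the uniformized cost for the shifted value is the Hamiltonian for `w`, up to a
term that does not depend on the action. -/
theorem coe_uniformizedCost_shifted (hM : M.Assumptions)
    (hle : ∀ y ∈ M.E, ∀ a ∈ M.U y, ξ y ≤ M.lam (y, a)) (hh : BorelOn M.E h)
    (hC : ∀ z ∈ M.E, -(C : ℝ) ≤ h z) {v : EuclideanSpace ℝ (Fin n) → ℝ≥0∞}
    {w : EuclideanSpace ℝ (Fin n) → ℝ} {x : EuclideanSpace ℝ (Fin n)} (hx : x ∈ M.E)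
    (hk : M.expectedSojourn ξ x ≠ ⊤)
    (hv : (v x : EReal) = (w x : EReal) + ((C + ρ * M.expectedSojourn ξ x : ℝ≥0∞) : EReal)) :
    ∃ R : ℝ, ∀ a ∈ M.U x, (M.uniformizedCost (M.shiftedCost α ρ C ξ h) v (x, a) : EReal) =
      M.hamiltonian w h x a + (R : EReal) := by
  lift M.expectedSojourn ξ x to ℝ≥0 using hk with k hkdef
  have hb := rateSup_ne_top hM hx
  have hvt : v x ≠ ⊤ := fun ht => by
    rw [ht] at hv
    exact absurd hv.symm (EReal.coe_ne_top (w x + (C + ρ * k : ℝ≥0)))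
  have hlb : ∀ a ∈ M.U x, (M.lam (x, a) : ℝ≥0∞) ≤ M.rateSup x := fun a ha => lam_le_rateSup hx ha
  have hvR : (v x).toReal = w x + (C + ρ * k) := by
    lift v x to ℝ≥0 using hvt with v'
    change ((v' : ℝ) : EReal) = ((w x + (C + ρ * k : ℝ≥0) : ℝ) : EReal) at hv
    have := EReal.coe_injective hv
    simpa using this
  refine ⟨(M.rateSup x).toReal * (v x).toReal + C * α + α * ρ * k - ξ x * ρ * k, fun a ha => ?_⟩
  have hQ := Qpos_shifted hh hC (subset_closure hx) a
  have hn := Qpos_neg_le hC (subset_closure hx) a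
  have hξ := hle x hx a ha
  have hla := hlb a ha
  rw [hamiltonian, Qop, uniformizedCost, shiftedCost]
  dsimp only
  rw [← hkdef]
  generalize M.Qpos (M.shifted C h) x a = q' at *
  generalize M.Qpos (fun z => ENNReal.ofReal (-h z)) x a = qn at *
  generalize M.Qpos (fun z => ENNReal.ofReal (h z)) x a = qp at *
  generalize M.rateSup x = lb at *
  generalize v x = v' at *
  generalize M.lam (x, a) = l at *
  lift qn to ℝ≥0 using ne_top_of_le_ne_top ENNReal.coe_ne_top hn
  lift lb to ℝ≥0 using hb
  lift v' to ℝ≥0 using hvt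
  have hla' : l ≤ lb := by exact_mod_cast hla
  have hsub1 : ((l : ℝ≥0∞) - ξ x) = ((l - ξ x : ℝ≥0) : ℝ≥0∞) := ENNReal.coe_sub.symm
  have hsub2 : ((lb : ℝ≥0∞) - l) = ((lb - l : ℝ≥0) : ℝ≥0∞) := ENNReal.coe_sub.symm
  have hsub1' : ((l - ξ x : ℝ≥0) : ℝ) = l - ξ x := NNReal.coe_sub hξ
  have hsub2' : ((lb - l : ℝ≥0) : ℝ) = lb - l := NNReal.coe_sub hla'
  rw [hsub1, hsub2]
  simp only [ENNReal.coe_toReal] at hvR ⊢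
  induction qp with
  | top =>
    have : q' = ⊤ := by simpa using hQ
    subst this
    have hbot : (w x : EReal) - (((⊤ : ℝ≥0∞) : EReal) - ((qn : ℝ≥0∞) : EReal)) = ⊥ := by
      rw [show ((⊤ : ℝ≥0∞) : EReal) - ((qn : ℝ≥0∞) : EReal) = ⊤ from EReal.top_sub_coe (qn : ℝ)]
      rfl
    rw [hbot]
    -- if the jump rate vanishes, both sides rely on `0 * ∞ = 0`
    rcases eq_or_ne l 0 with rfl | hl
    · have hξ0 : ξ x = 0 := le_antisymm hξ bot_le
      simp only [hξ0, ENNReal.coe_zero, zero_mul, add_zero, NNReal.coe_zero, EReal.coe_zero,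
        sub_zero, tsub_zero]
      change (((M.f (x, a) : ℝ) + C * α + ρ * (α * k) + lb * v' : ℝ) : EReal) =
        (((M.f (x, a) : ℝ) + (lb * v' + C * α + α * ρ * k) : ℝ) : EReal)
      exact congrArg _ (by ring)
    · have hl' : (0 : ℝ) < l := NNReal.coe_pos.2 (pos_iff_ne_zero.2 hl)
      rw [EReal.coe_mul_bot_of_pos hl', ENNReal.mul_top (by exact_mod_cast hl), add_top, top_add]
      rfl
  | coe qp =>
    have : q' ≠ ⊤ := fun ht => by simp [ht, ← ENNReal.coe_add] at hQ
    lift q' to ℝ≥0 using this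
    have h1 : q' + qn = qp + C := by exact_mod_cast hQ
    have h2 : (q' : ℝ) + qn = qp + C := by exact_mod_cast h1
    change (((M.f (x, a) : ℝ) + C * α + ρ * ((α + (l - ξ x : ℝ≥0)) * k) + l * q' +
      (lb - l : ℝ≥0) * v' : ℝ) : EReal) =
      (((M.f (x, a) : ℝ) - l * (w x - ((qp : ℝ) - qn)) +
        (lb * v' + C * α + α * ρ * k - ξ x * ρ * k) : ℝ) : EReal)
    rw [hsub1', hsub2', hvR, show (q' : ℝ) = qp + C - qn by linarith]
    exact congrArg _ (by ring)

/-! ### Minimizing selectors -/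

/-- If `g` and `H` differ by a real constant on `S`, a point of `S` minimizes one if and only if it
minimizes the other. -/
theorem iInf_eq_iff_of_eq_add_coe {S : Set 𝕌} {g : 𝕌 → ℝ≥0∞} {H : 𝕌 → EReal} {R : ℝ}
    (hR : ∀ a ∈ S, (g a : EReal) = H a + (R : EReal)) {b : 𝕌} (hb : b ∈ S) :
    ⨅ a ∈ S, H a = H b ↔ ∀ a ∈ S, g b ≤ g a := by
  have h : (∀ a ∈ S, g b ≤ g a) ↔ ∀ a ∈ S, H b ≤ H a := forall₂_congr fun a ha => by
    rw [← EReal.coe_ennreal_le_coe_ennreal_iff, hR a ha, hR b hb]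
    exact (EReal.addLECancellable_coe R).add_le_add_iff_right
  rw [h]
  refine ⟨fun heq a ha => heq ▸ iInf₂_le a ha, fun hle => le_antisymm (iInf₂_le b hb) ?_⟩
  exact le_iInf₂ hle

theorem exists_actionSelector (hM : M.Assumptions) (hc : Measurable c)
    (hcl : ∀ x ∈ M.E, LowerSemicontinuousOn (fun a => c (x, a)) (M.U x)) (hψ : Measurable ψ)
    (hψl : ∀ z ∈ frontier M.E, LowerSemicontinuousOn (fun a => ψ (z, a)) (M.U z)) :
    ∃ u ∈ M.actionSelectors, (∀ y ∈ M.E, ∀ a ∈ M.U y, c (y, u y) ≤ c (y, a)) ∧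
      ∀ z ∈ frontier M.E, ∀ a ∈ M.U z, ψ (z, u z) ≤ ψ (z, a) := by
  classical
  have : Nonempty 𝕌 := (M.U_nonempty _ M.Δ_mem).to_subtype.map Subtype.val
  have hE : MeasurableSet {p : EuclideanSpace ℝ (Fin n) × 𝕌 | p.1 ∈ M.E} :=
    measurable_fst M.measurableSet_E
  set g : EuclideanSpace ℝ (Fin n) × 𝕌 → ℝ≥0∞ :=
    {p : EuclideanSpace ℝ (Fin n) × 𝕌 | p.1 ∈ M.E}.piecewise c ψ
  have hgE : ∀ y ∈ M.E, ∀ a, g (y, a) = c (y, a) := fun y hy a => piecewise_eq_of_mem _ _ _ hy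
  have hgF : ∀ z ∈ frontier M.E, ∀ a, g (z, a) = ψ (z, a) := fun z hz a =>
    piecewise_eq_of_notMem _ _ _ fun hzE => M.notMem_frontier hzE hz
  have hgl : ∀ y ∈ closure M.E, LowerSemicontinuousOn (fun a => g (y, a)) (M.U y) := fun y hy => by
    rw [M.closure_eq] at hy
    rcases hy with hy | hy
    · simpa only [hgE y hy] using hcl y hy
    · simpa only [hgF y hy] using hψl y hy
  obtain ⟨u, hum, hu⟩ := exists_measurable_argmin
    (measurableSet_graphOn hM isClosed_closure.measurableSet subset_rfl)
    (isClosed_section_graphOn hM subset_rfl) (hc.piecewise hE hψ)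
    (lowerSemicontinuousOn_section hgl)
  have hu' : ∀ y ∈ closure M.E, u y ∈ M.U y ∧ ∀ a ∈ M.U y, g (y, u y) ≤ g (y, a) := fun y hy => by
    obtain ⟨h1, h2⟩ := hu y ((M.U_nonempty y hy).imp fun a ha => ⟨hy, ha⟩)
    exact ⟨h1.2, fun a ha => h2 a ⟨hy, ha⟩⟩
  refine ⟨u, ⟨hum, fun y hy => (hu' y hy).1⟩, fun y hy a ha => ?_, fun z hz a ha => ?_⟩
  · rw [← hgE y hy, ← hgE y hy]
    exact (hu' y (subset_closure hy)).2 a ha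
  · rw [← hgF z hz, ← hgF z hz]
    exact (hu' z (frontier_subset_closure hz)).2 a ha

/-! ### Regularity along the flow -/

theorem cumul_rate_ne_top (hM : M.Assumptions)
    (hle : ∀ y ∈ M.E, ∀ a ∈ M.U y, ξ y ≤ M.lam (y, a)) {x : EuclideanSpace ℝ (Fin n)}
    (hx : x ∈ M.E) {t : ℝ≥0} (ht : (t : ℝ≥0∞) ≤ M.tstar x) :
    cumul (fun s => ξ (M.φ s x)) t ≠ ⊤ := by
  refine ne_top_of_le_ne_top (cumul_rateSupPath_ne_top hM hx ht) (cumul_le_cumul fun s hs => ?_)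
  have hy := M.flow_mem_E hx (lt_of_lt_of_le hs ht)
  obtain ⟨a, ha⟩ := M.U_nonempty _ (subset_closure hy)
  exact (ENNReal.coe_le_coe.2 (hle _ hy a ha)).trans (lam_le_rateSup hy ha)

/-- A difference of values along the trajectories is regular along the flow. -/
theorem mac_of_eq_sub {w : EuclideanSpace ℝ (Fin n) → ℝ} {v k : EuclideanSpace ℝ (Fin n) → ℝ≥0∞}
    (hv : Measurable v) (hk : Measurable k) {b d : ℝ}
    (hw : ∀ x ∈ M.E, w x = (v x).toReal - (b + d * (k x).toReal))
    {a G a' G' : EuclideanSpace ℝ (Fin n) → ℝ≥0 → ℝ≥0∞}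
    {B B' : EuclideanSpace ℝ (Fin n) → ℝ≥0∞}
    (ha : ∀ x, Measurable (a x)) (hG : ∀ x, Measurable (G x))
    (ha' : ∀ x, Measurable (a' x)) (hG' : ∀ x, Measurable (G' x))
    (hafin : ∀ x ∈ M.E, ∀ t : ℝ≥0, (t : ℝ≥0∞) ≤ M.tstar x → cumul (a x) t ≠ ⊤)
    (hafin' : ∀ x ∈ M.E, ∀ t : ℝ≥0, (t : ℝ≥0∞) ≤ M.tstar x → cumul (a' x) t ≠ ⊤)
    (hvflow : ∀ x ∈ M.E, ∀ t : ℝ≥0, (t : ℝ≥0∞) < M.tstar x →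
      v (M.φ t x) = valueAt (a x) (G x) (B x) (M.tstar x) t)
    (hkflow : ∀ x ∈ M.E, ∀ t : ℝ≥0, (t : ℝ≥0∞) < M.tstar x →
      k (M.φ t x) = valueAt (a' x) (G' x) (B' x) (M.tstar x) t)
    (hvfin : ∀ x ∈ M.E, pathValue (a x) (G x) (B x) (M.tstar x) ≠ ⊤)
    (hkfin : ∀ x ∈ M.E, pathValue (a' x) (G' x) (B' x) (M.tstar x) ≠ ⊤) : M.Mac w := by
  have hflow : ∀ x ∈ M.E, ∀ t : ℝ≥0, (t : ℝ≥0∞) < M.tstar x → w (M.φ t x) =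
      (valueAt (a x) (G x) (B x) (M.tstar x) t).toReal -
        (b + d * (valueAt (a' x) (G' x) (B' x) (M.tstar x) t).toReal) := fun x hx t ht => by
    rw [hw _ (M.flow_mem_E hx ht), hvflow x hx t ht, hkflow x hx t ht]
  refine ⟨?_, fun x hx T hT => ?_, fun x hx hT => ?_⟩
  · have : (fun x : M.E => w x) = fun x : M.E => (v x).toReal - (b + d * (k x).toReal) :=
      funext fun x => hw x x.2
    rw [BorelOn, this]
    exact (hv.ennreal_toReal.sub ((hk.ennreal_toReal.const_mul d).const_add b)).comp
      measurable_subtype_coe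
  · have h1 := absolutelyContinuousOnInterval_valueAt (ha x) (hG x) hT.le (hafin x hx T hT.le)
      (hvfin x hx)
    have h2 := absolutelyContinuousOnInterval_valueAt (ha' x) (hG' x) hT.le (hafin' x hx T hT.le)
      (hkfin x hx)
    have h3 : AbsolutelyContinuousOnInterval (fun _ : ℝ => b) 0 (T : ℝ) :=
      LipschitzOnWith.absolutelyContinuousOnInterval (K := 0) (LipschitzWith.const b).lipschitzOnWith
    refine AbsolutelyContinuousOnInterval.congr_of_eqOn (h1.sub (h3.add (h2.const_mul d)))
      fun s hs => ?_
    rw [uIcc_of_le T.coe_nonneg] at hs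
    exact hflow x hx _ ((ENNReal.coe_le_coe.2 (Real.toNNReal_le_iff_le_coe.2 hs.2)).trans_lt hT)
  · obtain ⟨t, ht⟩ : ∃ t : ℝ≥0, (t : ℝ≥0∞) = M.tstar x := ⟨_, ENNReal.coe_toNNReal hT.ne⟩
    have ht0 : t ≠ 0 := fun h0 => M.tstar_ne_zero hx (by rw [← ht, h0, ENNReal.coe_zero])
    obtain ⟨l, hl⟩ := exists_tendsto_valueAt (ha x) (hG x) (B := B x) ht0
      (hafin x hx t ht.le) (ht ▸ hvfin x hx)
    obtain ⟨l', hl'⟩ := exists_tendsto_valueAt (ha' x) (hG' x) (B := B' x) ht0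
      (hafin' x hx t ht.le) (ht ▸ hkfin x hx)
    refine ⟨l - (b + d * l'), ?_⟩
    rw [← ht, ENNReal.toNNReal_coe]
    refine (hl.sub ((hl'.const_mul d).const_add b)).congr' ?_
    filter_upwards [self_mem_nhdsWithin] with s hs
    have := hflow x hx s (ht ▸ ENNReal.coe_lt_coe.2 hs)
    rw [this, ← ht]

end ControlledPDMP

/-! ### Optimality of minimizing feedback selectors -/

open ControlledPDMP

theorem theorem6p4 {n : ℕ} {𝕌 : Type*} [MetricSpace 𝕌] [CompactSpace 𝕌] [MeasurableSpace 𝕌]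
    [BorelSpace 𝕌] (M : ControlledPDMP n 𝕌) (hM : M.Assumptions)
    (α ρ : ℝ≥0) (h : EuclideanSpace ℝ (Fin n) → ℝ) (hh : BorelOn M.E h)
    (hbd : ∃ c : ℝ, ∀ x ∈ M.E, c ≤ h x)
    (w : EuclideanSpace ℝ (Fin n) → ℝ)
    (hw : ∀ x ∈ M.E, M.relaxedOp α ρ h x = (w x : EReal)) :
    M.Mac w ∧
    (∀ x ∈ M.E, M.relaxedOp α ρ h x = M.ordinaryOp α ρ h x) ∧
    (∃ u, M.IsMinimizingSelector w h u) ∧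
    ∀ u, ∀ hu : M.IsMinimizingSelector w h u,
      M.feedback u hu.mem.1 ∈ M.ordinarySelectors ∧
      ∀ x ∈ M.E, M.ordinaryOp α ρ h x =
        M.cost α ρ h x (M.feedback u hu.mem.1 x).toRelaxed := by
  obtain ⟨ξ, hξ, hle, ⟨K, hK⟩, -⟩ := hM.lower_rate
  obtain ⟨C, hC⟩ : ∃ C : ℝ≥0, ∀ z ∈ M.E, -(C : ℝ) ≤ h z := by
    obtain ⟨b, hb⟩ := hbd
    exact ⟨(-b).toNNReal, fun z hz => (neg_le.1 (Real.le_coe_toNNReal _)).trans (hb z hz)⟩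
  set k := M.expectedSojourn ξ with hkdef
  have hkm : Measurable k := measurable_expectedSojourn hξ
  have hk : ∀ x ∈ M.E, k x ≠ ⊤ := fun x hx => by
    rw [hkdef, expectedSojourn_eq hx]
    exact ne_top_of_le_ne_top ENNReal.coe_ne_top (hK x hx)
  set c := M.shiftedCost α ρ C ξ h
  set ψ := M.shiftedBdry C h
  have hc : Measurable c := measurable_shiftedCost hξ hh
  have hψ : Measurable ψ := measurable_shiftedBdry hh
  have hcl : ∀ x ∈ M.E, LowerSemicontinuousOn (fun a => c (x, a)) (M.U x) := fun x hx =>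
    lowerSemicontinuousOn_shiftedCost hM hh hx (hk x hx)
  have hψl : ∀ z ∈ frontier M.E, LowerSemicontinuousOn (fun a => ψ (z, a)) (M.U z) := fun z hz =>
    lowerSemicontinuousOn_shiftedBdry hM hh hz
  set v := M.value α c ψ
  have hvm : Measurable v := measurable_value hM hc hcl hψ hψl
  -- the real constant by which the two problems differ at `x`
  set D : EuclideanSpace ℝ (Fin n) → ℝ := fun x => C + ρ * (k x).toReal with hD
  have hDcoe : ∀ x ∈ M.E, ((C + ρ * k x : ℝ≥0∞) : EReal) = (D x : EReal) := fun x hx => by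
    have h1 := hk x hx
    simp only [hD]
    lift k x to ℝ≥0 using h1 with kx
    rfl
  have hcost : ∀ x ∈ M.E, ∀ Θ ∈ M.relaxedControls x,
      (M.stageCost α c ψ x Θ : EReal) = M.cost α ρ h x Θ + (D x : EReal) :=
    fun x hx Θ hΘ => hDcoe x hx ▸ coe_stageCost_shifted hM hξ hle hh hC hx (hk x hx) hΘ
  have hvle : ∀ x ∈ M.E, (v x : EReal) - D x ≤ w x := fun x hx => by
    rw [← hw x hx]
    refine le_iInf₂ fun Θ hΘ => EReal.sub_le_of_le_add ?_
    rw [← hcost x hx Θ hΘ]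
    exact EReal.coe_ennreal_le_coe_ennreal_iff.2 (value_le_stageCost hM hc hx hΘ)
  have hvfin : ∀ x ∈ M.E, v x ≠ ⊤ := fun x hx ht => by
    have := hvle x hx
    rw [ht, EReal.coe_ennreal_top, EReal.top_sub_coe, top_le_iff] at this
    exact EReal.coe_ne_top _ this
  have hfeed : ∀ u, ∀ hu : u ∈ M.actionSelectors,
      (∀ y ∈ M.E, ∀ a ∈ M.U y, M.uniformizedCost c v (y, u y) ≤ M.uniformizedCost c v (y, a)) →
      (∀ z ∈ frontier M.E, ∀ a ∈ M.U z, ψ (z, u z) ≤ ψ (z, a)) →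
      ∀ x ∈ M.E, M.cost α ρ h x (M.feedback u hu.1 x).toRelaxed ≤ (v x : EReal) - D x :=
    fun u hu h1 h2 x hx => by
      have h3 := stageCost_feedback_le hM hc hcl hψ hψl hu h1 h2 hx (hvfin x hx)
      have h4 := EReal.coe_ennreal_le_coe_ennreal_iff.2 h3
      rw [hcost x hx _ (toRelaxed_mem hx (feedback_mem hu hx))] at h4
      exact (EReal.le_sub_iff_add_le (.inl (EReal.coe_ne_bot _)) (.inl (EReal.coe_ne_top _))).2 h4
  obtain ⟨u, hu, humin, hubd⟩ := exists_actionSelector hM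
    (measurable_uniformizedCost hM hc hvm)
    (fun x hx => lowerSemicontinuousOn_uniformizedCost hM hx (hcl x hx) v) hψ hψl
  have hwv : ∀ x ∈ M.E, (w x : EReal) = (v x : EReal) - D x := fun x hx => by
    refine le_antisymm ?_ (hvle x hx)
    rw [← hw x hx]
    exact (iInf₂_le _ (toRelaxed_mem hx (feedback_mem hu hx))).trans
      (hfeed u hu humin hubd x hx)
  have hwreal : ∀ x ∈ M.E, w x = (v x).toReal - D x := fun x hx => by
    have h1 := hwv x hx
    have h2 := hvfin x hx
    lift v x to ℝ≥0 using h2 with vx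
    exact EReal.coe_injective h1
  have hvw : ∀ x ∈ M.E, (v x : EReal) =
      (w x : EReal) + ((C + ρ * k x : ℝ≥0∞) : EReal) := fun x hx => by
    have h1 := hwreal x hx
    have h2 := hvfin x hx
    rw [hDcoe x hx]
    lift v x to ℝ≥0 using h2 with vx
    exact congrArg ((↑) : ℝ → EReal) (show (vx : ℝ) = w x + D x by rw [h1, ENNReal.coe_toReal]; ring)
  have hmin : ∀ u ∈ M.actionSelectors, M.IsMinimizingSelector w h u ↔
      (∀ y ∈ M.E, ∀ a ∈ M.U y, M.uniformizedCost c v (y, u y) ≤ M.uniformizedCost c v (y, a)) ∧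
      (∀ z ∈ frontier M.E, ∀ a ∈ M.U z, ψ (z, u z) ≤ ψ (z, a)) := fun u hu => by
    have h1 : ∀ y ∈ M.E, (⨅ a ∈ M.U y, M.hamiltonian w h y a = M.hamiltonian w h y (u y) ↔
        ∀ a ∈ M.U y, M.uniformizedCost c v (y, u y) ≤ M.uniformizedCost c v (y, a)) :=
      fun y hy => by
        obtain ⟨R, hR⟩ := coe_uniformizedCost_shifted (α := α) (ρ := ρ) (w := w) (v := v) hM hle hh
          hC hy (hk y hy) (hvw y hy)
        exact iInf_eq_iff_of_eq_add_coe hR (hu.2 y (subset_closure hy))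
    have h2 : ∀ z ∈ frontier M.E, (⨅ a ∈ M.U z, M.boundaryHamiltonian h z a =
        M.boundaryHamiltonian h z (u z) ↔ ∀ a ∈ M.U z, ψ (z, u z) ≤ ψ (z, a)) := fun z hz => by
      have hz' := frontier_subset_closure hz
      exact iInf_eq_iff_of_eq_add_coe (fun a _ => coe_shiftedBdry hh hC hz' a) (hu.2 z hz')
    exact ⟨fun H => ⟨fun y hy => (h1 y hy).1 (H.interior_min y hy),
      fun z hz => (h2 z hz).1 (H.boundary_min z hz)⟩,
      fun H => ⟨hu, fun y hy => (h1 y hy).2 (H.1 y hy), fun z hz => (h2 z hz).2 (H.2 z hz)⟩⟩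
  have hrel : ∀ x ∈ M.E, M.relaxedOp α ρ h x ≤ M.ordinaryOp α ρ h x := fun x hx =>
    le_iInf₂ fun Υ hΥ => iInf₂_le _ (toRelaxed_mem hx hΥ)
  have hopt : ∀ u, ∀ hu : M.IsMinimizingSelector w h u, ∀ x ∈ M.E,
      M.cost α ρ h x (M.feedback u hu.mem.1 x).toRelaxed ≤ M.relaxedOp α ρ h x :=
    fun u hu x hx => by
      obtain ⟨h1, h2⟩ := (hmin u hu.mem).1 hu
      rw [hw x hx, hwv x hx]
      exact hfeed u hu.mem h1 h2 x hx
  have hord : ∀ u, ∀ hu : M.IsMinimizingSelector w h u, ∀ x ∈ M.E, M.ordinaryOp α ρ h x ≤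
      M.cost α ρ h x (M.feedback u hu.mem.1 x).toRelaxed := fun u hu x hx =>
    iInf₂_le _ (feedback_mem hu.mem hx)
  have hsel : M.IsMinimizingSelector w h u := (hmin u hu).2 ⟨humin, hubd⟩
  refine ⟨?_, fun x hx => le_antisymm (hrel x hx) ((hord u hsel x hx).trans (hopt u hsel x hx)),
    ⟨u, hsel⟩, fun u hu => ⟨feedback_mem_ordinarySelectors hu.mem, fun x hx =>
      le_antisymm (hord u hu x hx) ((hopt u hu x hx).trans (hrel x hx))⟩⟩
  refine mac_of_eq_sub hvm hkm hwreal
    (fun x => measurable_const.add (measurable_rateSupPath hM x))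
    (fun x => (measurable_minOn_uniformizedCost hM hc hcl hvm).comp (M.continuous_path x).measurable)
    (fun x => (hξ.comp (M.continuous_path x).measurable).coe_nnreal_ennreal)
    (fun _ => measurable_const) (fun x hx t ht => ?_)
    (fun x hx t ht => cumul_rate_ne_top hM hle hx ht)
    (fun x hx t ht => value_flow hM hc hcl hψ hψl hx ht)
    (fun x hx t ht => expectedSojourn_flow hx ht)
    (fun x hx => value_eq_pathValue hM hc hcl hψ hψl hx ▸ hvfin x hx)
    (fun x hx => expectedSojourn_eq_pathValue hx ▸ hk x hx)
  change cumul (fun s => α + M.rateSupPath x s) t ≠ ⊤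
  rw [cumul_fun_add measurable_const, cumul_const]
  exact ENNReal.add_ne_top.2 ⟨ENNReal.mul_ne_top ENNReal.coe_ne_top ENNReal.coe_ne_top,
    cumul_rateSupPath_ne_top hM hx ht⟩

end
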